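/- **Setting.** Fix $N,M\in\mathbb N$. Let $T>0$, let $\Box=\partial_t^2-\Delta$ on $[0,T]\times\mathbb R^3$ with $\partial=(\partial_t,\nabla)=(\partial_0,\dots,\partial_3)$, and write $r=|x|$, $\partial_r=\frac xr\cdot\nabla$, $\not\nabla=\nabla-\frac xr\partial_r$, $\not\partial=(\partial_t+\partial_r,\not\nabla)$. Let $$Z=(\partial_t,\partial_1,\partial_2,\partial_3,\Omega_1,\Omega_2,\Omega_3,S),\qquad \Omega=x\times\nabla,\quad S=t\partial_t+r\partial_r .$$ In every expression containing $Z^{\le N}u$ inside absolute values one sums over $Z^\mu u$ with $|\mu|\le N$ ($\mu\in\mathbb N^8$), e.g. $|Z^{\le N}u|=\sum_{|\mu|\le N}|Z^\mu u|$, $|\partial Z^{\le N}u|=\sum_{|\mu|\le N}|\partial Z^\mu u|$, $|(\partial_t+\partial_r)(rZ^{\le N}u)|=\sum_{|\mu|\le N}|(\partial_t+\partial_r)(rZ^\mu u)|$; and $|(r\not\partial)^{\le1}Z^{\le N}u|=|Z^{\le N}u|+r|\not\partial Z^{\le N}u|$. Put $\langle s\rangle=3+|s|$, $\sigma_U(s)=\frac{s}{U+|s|}$.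 Let $L^pL^q=L^p([0,T];L^q(\mathbb R^3))$, let $U$ range over the dyadic values $2^j$, $j\ge0$, and let $$X_1=\{(t,x)\in[0,T]\times\mathbb R^3:|t-r|<2\},\qquad X_U=\{(t,x)\in[0,T]\times\mathbb R^3:U<t-r<2U\}\quad(U>1).$$ With $A_1=\{|x|<2\}$ and $A_R=\{R<|x|<2R\}$ for $R>1$, let $\|f\|_{LE}=\sup_{j\ge0}2^{-j/2}\|f\|_{L^2L^2([0,T]\times A_{2^j})}$ and $\|u\|_{LE^1}=\|(\partial u,|x|^{-1}u)\|_{LE}$. For real functions $h^{I,\alpha\beta}_J$ ($1\le I,J\le M$, $0\le\alpha,\beta\le3$) put $(\Box_hw)^I=(\partial_t^2-\Delta)w^I-\sum_{J,\alpha,\beta}h^{I,\alpha\beta}_J\partial_\alpha\partial_\beta w^J$, $|h|=\sum_{I,J,\alpha,\beta}|h^{I,\alpha\beta}_J|$, $|\partial h|=\sum_{I,J,\alpha,\beta,\gamma}|\partial_\gamma h^{I,\alpha\beta}_J|$, $|(\partial_t+\partial_r)h|=\sum_{I,J,\alpha,\beta}|(\partial_t+\partial_r)h^{I,\alpha\beta}_J|$.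 Finally let $$\Box_hZ^{\le N}u\cdot(\partial_t+\partial_r)(rZ^{\le N}u)=\sum_{|\mu|\le N}\sum_{I=1}^M(\Box_hZ^\mu u)^I\,(\partial_t+\partial_r)(rZ^\mu u)^I .$$ **Statement.** There is a constant $C$, depending only on $N$ and $M$, such that the following holds for every $T>0$. Suppose that $h^{I,\alpha\beta}_J=h^{I,\beta\alpha}_J=h^{J,\alpha\beta}_I\in C^1([0,T]\times\mathbb R^3)$, that $u\in C^{N+2}([0,T]\times\mathbb R^3;\mathbb R^M)$, and that for all $t\in[0,T]$, $r^{\frac32}\bigl(|Z^{\le N}u(t,x)|+|\partial Z^{\le N}u(t,x)|\bigr)\to0$ as $|x|\to\infty$. Then $$\begin{aligned} &\|\langle r\rangle^{\frac12}\not\partial Z^{\le N}u\|^2_{L^\infty L^2}+\|r^{-\frac12}Z^{\le N}u\|^2_{L^\infty L^2}+\|\not\partial Z^{\le N}u\|^2_{L^2L^2}+\|r^{-1}Z^{\le N}u\|^2_{L^2L^2}\\ &\quad+\sup_{U\ge1}\Bigl(\|r^{-\frac12}\langle t-r\rangle^{-\frac12}(\partial_t+\partial_r)(rZ^{\le N}u)\|^2_{L^2L^2(X_U)}+\|r^{-\frac12}(\log\langle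 r\rangle)^{-1}\langle t-r\rangle^{-\frac12}Z^{\le N}u\|^2_{L^2L^2(X_U)}\Bigr)\\ &\le C\Bigl[\|r^{-\frac12}(r\not\partial)^{\le1}Z^{\le N}u(0,\cdot)\|^2_{L^2}+\sup_{t\in[0,T]}\int r|h||\partial Z^{\le N}u|\Bigl(|\partial Z^{\le N}u|+\frac{|Z^{\le N}u|}r\Bigr)dx\\ &\quad+\sup_{U\ge1}\sup_{t\in[0,T]}\Bigl|\int_0^t\!\!\int e^{-\sigma_U(t-r)}\,\Box_hZ^{\le N}u\cdot(\partial_t+\partial_r)(rZ^{\le N}u)\,dx\,dt\Bigr|\\ &\quad+\int_0^T\!\!\int\Bigl(|\partial h|+\frac{|h|}r\Bigr)|\partial Z^{\le N}u|\,|(\partial_t+\partial_r)(rZ^{\le N}u)|\,dx\,dt+\int_0^T\!\!\int|h||\partial Z^{\le N}u|\Bigl(|\not\nabla Z^{\le N}u|+\frac{|Z^{\le N}u|}r\Bigr)dx\,dt\\ &\quad+\int_0^T\!\!\int|h|\langle t-r\rangle^{-1}|\partial Z^{\le N}u|\,|(\partial_t+\partial_r)(rZ^{\le N}u)|\,dx\,dt+\int_0^T\!\!\int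 r\Bigl(|(\partial_t+\partial_r)h|+\frac{|h|}r\Bigr)|\partial Z^{\le N}u|^2\,dx\,dt\\ &\quad+\|\partial Z^{\le N}u\|^2_{L^\infty L^2}+\|Z^{\le N}u\|^2_{LE^1}\Bigr]. \end{aligned}$$ The inequality is between elements of $[0,\infty]$. The signed integral $|\int_0^t\int\cdots|$ is the usual one if the integrand is integrable on $[0,t]\times\mathbb R^3$; in general it is read as $\limsup_{R\to\infty}|\int_0^t\int_{|x|<R}\cdots|$. -/

import Mathlib

open MeasureTheory Set Filter Topology
open scoped ENNReal NNReal

noncomputable section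

namespace GhostWave

/-- Physical space `ℝ³` with its Euclidean norm, `r = ‖x‖`. -/
abbrev E3 : Type := EuclideanSpace ℝ (Fin 3)

/-- Space-time points `(t, x)`. -/
abbrev SpaceTime : Type := ℝ × E3

/-- The closed slab `[0,T] × ℝ³`. -/
def slab (T : ℝ) : Set SpaceTime := Icc (0 : ℝ) T ×ˢ (univ : Set E3)

/-- The coordinate directions of space-time: index `0` is `t`, indices `1, 2, 3` are `x₁, x₂, x₃`. -/
def dir (α : Fin 4) : SpaceTime :=
  Fin.cases ((1 : ℝ), (0 : E3)) (fun i : Fin 3 => ((0 : ℝ), EuclideanSpace.single i (1 : ℝ))) α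

section Operators

variable {F : Type*} [NormedAddCommGroup F] [NormedSpace ℝ F]

/-- The partial derivative `∂_α` on `[0,T] × ℝ³` (one-sided in `t` at `t = 0` and `t = T`). -/
def pd (T : ℝ) (α : Fin 4) (w : SpaceTime → F) (z : SpaceTime) : F :=
  fderivWithin ℝ w (slab T) z (dir α)

/-- The radial derivative `∂_r = (x / r) · ∇`. -/
def dr (T : ℝ) (w : SpaceTime → F) (z : SpaceTime) : F :=
  ∑ i : Fin 3, (z.2 i / ‖z.2‖) • pd T i.succ w z

/-- The outgoing derivative `∂_t + ∂_r`. -/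
def outD (T : ℝ) (w : SpaceTime → F) (z : SpaceTime) : F := pd T 0 w z + dr T w z

/-- The components of the angular gradient `∇ - (x / r) ∂_r`. -/
def ang (T : ℝ) (i : Fin 3) (w : SpaceTime → F) (z : SpaceTime) : F :=
  pd T i.succ w z - (z.2 i / ‖z.2‖) • dr T w z

/-- The scaling field `S = t ∂_t + r ∂_r = t ∂_t + x · ∇`. -/
def scal (T : ℝ) (w : SpaceTime → F) (z : SpaceTime) : F :=
  z.1 • pd T 0 w z + ∑ i : Fin 3, z.2 i • pd T i.succ w z

/-- The rotations, i.e. the components of `x × ∇` (indices modulo 3). -/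
def rot (T : ℝ) (i : Fin 3) (w : SpaceTime → F) (z : SpaceTime) : F :=
  z.2 (i + 1) • pd T (i + 2).succ w z - z.2 (i + 2) • pd T (i + 1).succ w z

/-- The family `Z = (∂_t, ∂_1, ∂_2, ∂_3, Ω_1, Ω_2, Ω_3, S)`. -/
def Z (T : ℝ) : Fin 8 → (SpaceTime → F) → SpaceTime → F :=
  ![pd T 0, pd T 1, pd T 2, pd T 3, rot T 0, rot T 1, rot T 2, scal T]

/-- `Z^μ = Z_0^{μ_0} Z_1^{μ_1} ⋯ Z_7^{μ_7}` for a multi-index `μ`. -/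
def Zpow (T : ℝ) (μ : Fin 8 → ℕ) (w : SpaceTime → F) : SpaceTime → F :=
  (List.finRange 8).foldr (fun i v => (Z T i)^[μ i] v) w

/-- `|∂w|`, the length of the space-time gradient. -/
def gradAbs (T : ℝ) (w : SpaceTime → F) (z : SpaceTime) : ℝ :=
  Real.sqrt (∑ α : Fin 4, ‖pd T α w z‖ ^ 2)

/-- The length of the angular gradient of `w`. -/
def angAbs (T : ℝ) (w : SpaceTime → F) (z : SpaceTime) : ℝ :=
  Real.sqrt (∑ i : Fin 3, ‖ang T i w z‖ ^ 2)

/-- The length of the good derivatives of `w`: the outgoing derivative together with the angular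
gradient. -/
def goodAbs (T : ℝ) (w : SpaceTime → F) (z : SpaceTime) : ℝ :=
  Real.sqrt (‖outD T w z‖ ^ 2 + ∑ i : Fin 3, ‖ang T i w z‖ ^ 2)

/-- The function `r w`. -/
def rmul (w : SpaceTime → F) (z : SpaceTime) : F := ‖z.2‖ • w z

end Operators

/-- The multi-indices `μ ∈ ℕ⁸` with `|μ| ≤ N`. -/
def multiIdx (N : ℕ) : Finset (Fin 8 → ℕ) :=
  (Fintype.piFinset fun _ : Fin 8 => Finset.range (N + 1)).filter fun μ => ∑ i, μ i ≤ N

section Sums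

variable {F : Type*} [NormedAddCommGroup F] [NormedSpace ℝ F]

/-- `|Z^{≤N} u|`. -/
def zAbs (T : ℝ) (N : ℕ) (u : SpaceTime → F) (z : SpaceTime) : ℝ :=
  ∑ μ ∈ multiIdx N, ‖Zpow T μ u z‖

/-- `|∂ Z^{≤N} u|`. -/
def zGrad (T : ℝ) (N : ℕ) (u : SpaceTime → F) (z : SpaceTime) : ℝ :=
  ∑ μ ∈ multiIdx N, gradAbs T (Zpow T μ u) z

/-- The length of the angular gradient of `Z^{≤N} u`. -/
def zAng (T : ℝ) (N : ℕ) (u : SpaceTime → F) (z : SpaceTime) : ℝ :=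
  ∑ μ ∈ multiIdx N, angAbs T (Zpow T μ u) z

/-- The length of the good derivatives of `Z^{≤N} u`. -/
def zGood (T : ℝ) (N : ℕ) (u : SpaceTime → F) (z : SpaceTime) : ℝ :=
  ∑ μ ∈ multiIdx N, goodAbs T (Zpow T μ u) z

/-- `|(∂_t + ∂_r)(r Z^{≤N} u)|`. -/
def zOut (T : ℝ) (N : ℕ) (u : SpaceTime → F) (z : SpaceTime) : ℝ :=
  ∑ μ ∈ multiIdx N, ‖outD T (rmul (Zpow T μ u)) z‖

end Sums

/-- The Japanese bracket `⟨s⟩ = 3 + |s|`. -/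
def jb (s : ℝ) : ℝ := 3 + |s|

/-- The function `σ_U(s) = s / (U + |s|)` in the ghost weight `e^{-σ_U(t-r)}`. -/
def sig (U s : ℝ) : ℝ := s / (U + |s|)

/-- The dyadic annuli `A_{2^j}`: `{|x| < 2}` for `j = 0`, `{2^j < |x| < 2^{j+1}}` for `j ≥ 1`. -/
def ann (j : ℕ) : Set E3 :=
  if j = 0 then {x | ‖x‖ < 2} else {x | (2 : ℝ) ^ j < ‖x‖ ∧ ‖x‖ < 2 * (2 : ℝ) ^ j}

/-- The dyadic regions `X_U`, `U = 2^j`: `{|t - r| < 2}` for `j = 0`,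
`{U < t - r < 2U}` for `j ≥ 1`, inside `[0,T] × ℝ³`. -/
def XU (T : ℝ) (j : ℕ) : Set SpaceTime :=
  if j = 0 then {z | z ∈ slab T ∧ |z.1 - ‖z.2‖| < 2}
  else {z | z ∈ slab T ∧ (2 : ℝ) ^ j < z.1 - ‖z.2‖ ∧ z.1 - ‖z.2‖ < 2 * (2 : ℝ) ^ j}

/-- The `L²_t L²_x` norm over a space-time region. -/
def normL2 (X : Set SpaceTime) (f : SpaceTime → ℝ) : ℝ≥0∞ := eLpNorm f 2 (volume.restrict X)

/-- The `L^∞_t L²_x` norm over `[0,T] × ℝ³`. -/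
def normLinfL2 (T : ℝ) (f : SpaceTime → ℝ) : ℝ≥0∞ :=
  ⨆ t ∈ Icc (0 : ℝ) T, eLpNorm (fun x : E3 => f (t, x)) 2 volume

/-- The local energy norm `sup_{j ≥ 0} 2^{-j/2} ‖f‖_{L²L²([0,T] × A_{2^j})}`. -/
def normLE (T : ℝ) (f : SpaceTime → ℝ) : ℝ≥0∞ :=
  ⨆ j : ℕ, ENNReal.ofReal ((2 : ℝ) ^ (-(j : ℝ) / 2)) * normL2 (Icc (0 : ℝ) T ×ˢ ann j) f

/-- `‖Z^{≤N} u‖_{LE¹} = ‖(∂ Z^{≤N} u, |x|⁻¹ Z^{≤N} u)‖_{LE}`. -/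
def zLE1 {F : Type*} [NormedAddCommGroup F] [NormedSpace ℝ F]
    (T : ℝ) (N : ℕ) (u : SpaceTime → F) : ℝ≥0∞ :=
  normLE T fun z => Real.sqrt (zGrad T N u z ^ 2 + (‖z.2‖⁻¹ * zAbs T N u z) ^ 2)

/-- Systems of `M` real unknowns. -/
abbrev Vec (M : ℕ) : Type := EuclideanSpace ℝ (Fin M)

/-- Perturbation coefficients; `h I J α β` is `h^{I,αβ}_J`. -/
abbrev Pert (M : ℕ) : Type := Fin M → Fin M → Fin 4 → Fin 4 → SpaceTime → ℝ

section Perturbation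

variable {M : ℕ}

/-- `h^{I,αβ}_J = h^{I,βα}_J = h^{J,αβ}_I` and `h^{I,αβ}_J ∈ C¹([0,T] × ℝ³)`. -/
structure Admissible (T : ℝ) (h : Pert M) : Prop where
  symm_deriv : ∀ I J α β, ∀ z ∈ slab T, h I J α β z = h I J β α z
  symm_index : ∀ I J α β, ∀ z ∈ slab T, h I J α β z = h J I α β z
  contDiff : ∀ I J α β, ContDiffOn ℝ 1 (h I J α β) (slab T)

/-- `|h|`. -/
def hAbs (h : Pert M) (z : SpaceTime) : ℝ := ∑ I, ∑ J, ∑ α, ∑ β, |h I J α β z|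

/-- `|∂h|`. -/
def hGrad (T : ℝ) (h : Pert M) (z : SpaceTime) : ℝ :=
  ∑ I, ∑ J, ∑ α, ∑ β, ∑ γ, |pd T γ (h I J α β) z|

/-- `|(∂_t + ∂_r) h|`. -/
def hOut (T : ℝ) (h : Pert M) (z : SpaceTime) : ℝ :=
  ∑ I, ∑ J, ∑ α, ∑ β, |outD T (h I J α β) z|

/-- `(□_h w)^I = (∂_t² - Δ) w^I - h^{I,αβ}_J ∂_α ∂_β w^J`. -/
def boxh (T : ℝ) (h : Pert M) (w : SpaceTime → Vec M) (z : SpaceTime) (I : Fin M) : ℝ :=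
  pd T 0 (pd T 0 w) z I - ∑ i : Fin 3, pd T i.succ (pd T i.succ w) z I
    - ∑ J, ∑ α, ∑ β, h I J α β z * pd T α (pd T β w) z J

/-- The integrand `e^{-σ_U(t-r)} □_h Z^{≤N} u · (∂_t + ∂_r)(r Z^{≤N} u)`; the dot product runs
over the multi-indices `|μ| ≤ N` and over the components `I`. -/
def pairDensity (T : ℝ) (N : ℕ) (h : Pert M) (u : SpaceTime → Vec M) (U : ℝ) (z : SpaceTime) : ℝ :=
  Real.exp (-sig U (z.1 - ‖z.2‖)) *
    ∑ μ ∈ multiIdx N, ∑ I,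
      boxh T h (Zpow T μ u) z I * outD T (rmul (Zpow T μ u)) z I

/-- `|∫_0^t ∫ f dx dt|`, the integral over `ℝ³` being taken as the limit of the integrals over the
balls `{|x| < R}`, `R → ∞` (the upper limit of the absolute values if there is no limit). For
integrable `f` this is the ordinary integral, see `absIntegral_eq`. -/
def absIntegral (t : ℝ) (f : SpaceTime → ℝ) : ℝ≥0∞ :=
  limsup (fun R : ℝ => ‖∫ z in Icc (0 : ℝ) t ×ˢ Metric.ball (0 : E3) R, f z‖ₑ) atTop

end Perturbation

theorem absIntegral_eq (t : ℝ) (f : SpaceTime → ℝ) (hf : IntegrableOn f (slab t)) :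
    absIntegral t f = ‖∫ z in slab t, f z‖ₑ := by
  have hU : (⋃ R : ℝ, Icc (0 : ℝ) t ×ˢ Metric.ball (0 : E3) R) = slab t := by
    rw [← prod_iUnion]
    congr 1
    exact eq_univ_of_forall fun x => mem_iUnion.2 ⟨‖x‖ + 1, by simp⟩
  have h := tendsto_setIntegral_of_monotone (μ := volume) (f := f)
    (s := fun R : ℝ => Icc (0 : ℝ) t ×ˢ Metric.ball (0 : E3) R)
    (fun R => measurableSet_Icc.prod Metric.isOpen_ball.measurableSet)
    (fun R R' hR => prod_mono subset_rfl (Metric.ball_subset_ball hR))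
    (by rw [hU]; exact hf)
  rw [hU] at h
  exact (h.enorm).limsup_eq

end GhostWave

end

open GhostWave

open GhostWave

noncomputable section

namespace GhostWave

/-! The proof is a multiplier argument, applied to every scalar component w of every Z^μ u. Write R
= (∂_t + ∂_r)(r w), V = R / r and g = e^{-σ_U(t-r)}; the multiplier is g R.

Flat part. Since r □w = (∂_t - ∂_r)(∂_t + ∂_r)(r w) - r Δ̸w, the product g R □w is a space-time
divergence plus the bulk term ½ g (V² + |∇̸w|²) - g' r V², with energy density ½ g r (V² + |∇̸w|²)
(`box_identity`). The weight decreases in t - r, so g' = -σ_U' g and the whole bulk is nonnegative;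
on X_U the number σ_U'(t-r) is comparable to ⟨t-r⟩⁻¹, which yields the weighted bound for (∂_t +
∂_r)(r w). As |σ_U| ≤ 1, the weight lies between 1/3 and 3 and is harmless elsewhere.

Perturbation. With X = r (∂_t + ∂_r) one has R = X w + w. The symmetries of h turn the second order
part of h^{αβ} ∂_α∂_β w · R into total derivatives, and what remains has at most one derivative on h
(`pert_identity`, `abs_sum_pertRem_le`). Because X(t - r) = 0, differentiating the weight costs only
|h| ⟨t-r⟩⁻¹ |∂w| |R|.

Integration. The currents are C¹ only away from r = 0 and need not decay, so they are multiplied by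
a radial cutoff whose derivative is O(1/r) and lives where r ≤ 2/L or r ≥ L. The flux is at most r
(H + F): the part F from the flat operator is integrable on the slab, so its error tends to 0, while
the part H from h is kept as a source. Fatou's lemma then removes the cutoff (`energy_estimate`).
Integrability of F follows from finiteness of the L^∞L² norm of ∂Z^{≤N}u, the decay assumption and
Hardy's inequality (`hardy_slice`). The signed source is paired with a smooth cutoff, but that
cutoff is an average of indicators of balls, so the limsup over balls controls it
(`eventually_ofReal_integral_cut_le`).

Zeroth order terms. The divergence of (w²/r)(1, x/r) is V² - ((∂_t + ∂_r)w)², so the bound for V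
gives w²/r on slices and (∂_t + ∂_r)w, and then w/r, in L²L² (`lintegral_out_le`). The same current
with the factors U/(U² + (t-r)²) and 1/log(3 + r) gives the logarithmic term on X_U
(`lintegral_log_le`).

All terms are finally summed over |μ| ≤ N and the components, with integer constants
(`weighted_estimate`). -/

/-- `f` is differentiable at `z` within the slab, with partial derivatives `d`. -/
def HasPD (T : ℝ) (f : SpaceTime → ℝ) (z : SpaceTime) (d : Fin 4 → ℝ) : Prop :=
  ∃ f' : SpaceTime →L[ℝ] ℝ, HasFDerivWithinAt f f' (slab T) z ∧ ∀ α, f' (dir α) = d α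

theorem uniqueDiffOn_slab {T : ℝ} (hT : 0 < T) : UniqueDiffOn ℝ (slab T) :=
  (uniqueDiffOn_Icc hT).prod uniqueDiffOn_univ

/-! ### Calculus of one-sided partial derivatives on the closed slab -/

namespace HasPD

variable {T : ℝ} {f g : SpaceTime → ℝ} {z : SpaceTime} {d e : Fin 4 → ℝ}

/-- For positive T derivatives within the slab are unique, even on the faces t = 0 and t = T, so a
list found by the product and chain rules is the one `fderivWithin` selects. -/
theorem pd_eq (h : HasPD T f z d) (hT : 0 < T) (hz : z ∈ slab T) (α : Fin 4) :
    pd T α f z = d α := by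
  obtain ⟨f', hf, hd⟩ := h
  rw [pd, hf.fderivWithin (uniqueDiffOn_slab hT z hz), hd]

theorem of_differentiableWithinAt (h : DifferentiableWithinAt ℝ f (slab T) z) :
    HasPD T f z fun α => pd T α f z :=
  ⟨_, h.hasFDerivWithinAt, fun _ => rfl⟩

theorem congr (h : HasPD T f z d) (hde : ∀ α, d α = e α) : HasPD T f z e :=
  let ⟨f', hf, hd⟩ := h; ⟨f', hf, fun α => (hd α).trans (hde α)⟩

theorem const (c : ℝ) : HasPD T (fun _ => c) z fun _ => 0 :=
  ⟨0, hasFDerivWithinAt_const c z _, fun _ => rfl⟩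

theorem add (hf : HasPD T f z d) (hg : HasPD T g z e) :
    HasPD T (fun z => f z + g z) z fun α => d α + e α := by
  obtain ⟨f', hf, hd⟩ := hf
  obtain ⟨g', hg, he⟩ := hg
  exact ⟨f' + g', hf.add hg, fun α => by simp [hd, he]⟩

theorem sub (hf : HasPD T f z d) (hg : HasPD T g z e) :
    HasPD T (fun z => f z - g z) z fun α => d α - e α := by
  obtain ⟨f', hf, hd⟩ := hf
  obtain ⟨g', hg, he⟩ := hg
  exact ⟨f' - g', hf.sub hg, fun α => by simp [hd, he]⟩

theorem mul (hf : HasPD T f z d) (hg : HasPD T g z e) :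
    HasPD T (fun z => f z * g z) z fun α => f z * e α + g z * d α := by
  obtain ⟨f', hf, hd⟩ := hf
  obtain ⟨g', hg, he⟩ := hg
  exact ⟨_, hf.mul hg, fun α => by simp [hd, he]⟩

theorem sum {ι : Type*} {s : Finset ι} {f : ι → SpaceTime → ℝ} {d : ι → Fin 4 → ℝ}
    (h : ∀ i ∈ s, HasPD T (f i) z (d i)) :
    HasPD T (fun z => ∑ i ∈ s, f i z) z fun α => ∑ i ∈ s, d i α := by
  classical
  induction s using Finset.induction_on with
  | empty => simpa using const 0
  | insert a s ha ih =>
    simp only [Finset.sum_insert ha]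
    exact (h a (Finset.mem_insert_self a s)).add (ih fun i hi => h i (Finset.mem_insert_of_mem hi))

theorem comp {φ : ℝ → ℝ} {φ' : ℝ} (hf : HasPD T f z d) (hφ : HasDerivAt φ φ' (f z)) :
    HasPD T (fun z => φ (f z)) z fun α => φ' * d α := by
  obtain ⟨f', hf, hd⟩ := hf
  exact ⟨_, hφ.comp_hasFDerivWithinAt z hf, fun α => by simp [hd]⟩

theorem inv (hf : HasPD T f z d) (h0 : f z ≠ 0) :
    HasPD T (fun z => (f z)⁻¹) z fun α => -(f z ^ 2)⁻¹ * d α :=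
  hf.comp (hasDerivAt_inv h0)

theorem sq (hf : HasPD T f z d) : HasPD T (fun z => f z ^ 2) z fun α => 2 * f z * d α := by
  have := hf.mul hf
  simp only [← pow_two] at this
  exact this.congr fun α => by ring

theorem time : HasPD T (fun z => z.1) z ![1, 0, 0, 0] := by
  refine ⟨ContinuousLinearMap.fst ℝ ℝ E3, hasFDerivWithinAt_fst, fun α => ?_⟩
  fin_cases α <;> simp [dir] <;> rfl

theorem coord (j : Fin 3) :
    HasPD T (fun z => z.2 j) z fun α => if α = j.succ then 1 else 0 := by
  refine ⟨(EuclideanSpace.proj j).comp (ContinuousLinearMap.snd ℝ ℝ E3),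
    ContinuousLinearMap.hasFDerivWithinAt ((EuclideanSpace.proj j : E3 →L[ℝ] ℝ).comp
      (ContinuousLinearMap.snd ℝ ℝ E3)), fun α => ?_⟩
  refine Fin.cases ?_ (fun i => ?_) α
  · simp [dir, (Fin.succ_ne_zero j).symm]
  · simp [dir, PiLp.single_apply, eq_comm]

end HasPD

theorem norm_sq_eq (x : E3) : ‖x‖ ^ 2 = x 0 ^ 2 + x 1 ^ 2 + x 2 ^ 2 := by
  rw [EuclideanSpace.norm_sq_eq, Fin.sum_univ_three]; simp

theorem HasPD.radius {T : ℝ} {z : SpaceTime} (hx : z.2 ≠ 0) :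
    HasPD T (fun z => ‖z.2‖) z
      ![0, z.2 0 / ‖z.2‖, z.2 1 / ‖z.2‖, z.2 2 / ‖z.2‖] := by
  have h0 : ‖z.2‖ ^ 2 ≠ 0 := by positivity
  have h := (((HasPD.coord (T := T) (z := z) 0).sq).add ((HasPD.coord 1).sq)).add
    ((HasPD.coord 2).sq)
  simp only [← norm_sq_eq] at h
  have h2 := h.comp (Real.hasDerivAt_sqrt h0)
  simp only [Real.sqrt_sq (norm_nonneg _)] at h2
  refine h2.congr fun α => ?_
  fin_cases α <;> simp [Fin.succ] <;> field_simp

/-! ### The field r (∂_t + ∂_r), radial and angular derivatives -/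

/-- The components of the vector field `r (∂_t + ∂_r)`. -/
def outVec (γ : Fin 4) (z : SpaceTime) : ℝ := ![‖z.2‖, z.2 0, z.2 1, z.2 2] γ

/-- The partial derivatives `∂_α` of `outVec γ`. -/
def outVecD (z : SpaceTime) (γ α : Fin 4) : ℝ :=
  if γ = 0 then ![0, z.2 0 / ‖z.2‖, z.2 1 / ‖z.2‖, z.2 2 / ‖z.2‖] α
  else if α = γ then 1 else 0

theorem hasPD_outVec {T : ℝ} {z : SpaceTime} (hx : z.2 ≠ 0) (γ : Fin 4) :
    HasPD T (outVec γ) z (outVecD z γ) := by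
  fin_cases γ
  · exact (HasPD.radius hx).congr fun α => by simp [outVecD]
  · exact (HasPD.coord 0).congr fun α => by simp [outVecD]
  · exact (HasPD.coord 1).congr fun α => by simp [outVecD]
  · exact (HasPD.coord 2).congr fun α => by simp [outVecD]

/-- The function `r (∂_t + ∂_r) w + w`, which is `(∂_t + ∂_r)(r w)` away from the origin. -/
def outR (T : ℝ) (w : SpaceTime → ℝ) (z : SpaceTime) : ℝ :=
  ∑ γ, outVec γ z * pd T γ w z + w z

/-- The function `x · ∇w`. -/
def xGrad (T : ℝ) (w : SpaceTime → ℝ) (z : SpaceTime) : ℝ := ∑ i : Fin 3, z.2 i * pd T i.succ w z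

/-- The squared length of the angular gradient. -/
def angSq (T : ℝ) (w : SpaceTime → ℝ) (z : SpaceTime) : ℝ := ∑ i : Fin 3, ang T i w z ^ 2

section Pointwise

variable {T : ℝ} {w : SpaceTime → ℝ} {z : SpaceTime}

theorem norm_mul_outD (hx : z.2 ≠ 0) :
    ‖z.2‖ * outD T w z = ∑ γ, outVec γ z * pd T γ w z := by
  have h0 : ‖z.2‖ ≠ 0 := by simpa using hx
  simp only [outD, dr, outVec, Fin.sum_univ_four, Fin.sum_univ_three, smul_eq_mul]
  simp only [Matrix.cons_val, Fin.succ_zero_eq_one, Fin.succ_one_eq_two,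
    show (2 : Fin 3).succ = 3 from rfl]
  field_simp
  ring

theorem outR_eq (hx : z.2 ≠ 0) : outR T w z = ‖z.2‖ * outD T w z + w z := by
  rw [outR, norm_mul_outD hx]

theorem outR_eq' : outR T w z = ‖z.2‖ * pd T 0 w z + xGrad T w z + w z := by
  simp only [outR, xGrad, outVec, Fin.sum_univ_four, Fin.sum_univ_three]
  simp only [Matrix.cons_val, Fin.succ_zero_eq_one, Fin.succ_one_eq_two,
    show (2 : Fin 3).succ = 3 from rfl]
  ring

/-- Pythagoras: the angular gradient is the part of ∇w orthogonal to x/r, and ∂_r w = x·∇w / r. -/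
theorem angSq_eq (hx : z.2 ≠ 0) :
    angSq T w z = ∑ i : Fin 3, pd T i.succ w z ^ 2 - xGrad T w z ^ 2 / ‖z.2‖ ^ 2 := by
  have h0 : ‖z.2‖ ≠ 0 := by simpa using hx
  have h := norm_sq_eq z.2
  simp only [angSq, ang, dr, xGrad, Fin.sum_univ_three, smul_eq_mul]
  generalize pd T (0 : Fin 3).succ w z = a
  generalize pd T (1 : Fin 3).succ w z = b
  generalize pd T (2 : Fin 3).succ w z = c
  have e : (z.2 0 / ‖z.2‖ * a + z.2 1 / ‖z.2‖ * b + z.2 2 / ‖z.2‖ * c)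
    = (z.2 0 * a + z.2 1 * b + z.2 2 * c) / ‖z.2‖ := by field_simp
  rw [e]
  generalize hs : z.2 0 * a + z.2 1 * b + z.2 2 * c = s
  field_simp
  linear_combination (-2 * s * ‖z.2‖ ^ 2) * hs + (-s ^ 2) * h

end Pointwise

/-! ### The flat wave operator: current and divergence identity -/

section SecondOrder

variable {T : ℝ} {w : SpaceTime → ℝ} {z : SpaceTime}

theorem HasPD.of_contDiffOn {n : WithTop ℕ∞} (hw : ContDiffOn ℝ n w (slab T)) (hn : 1 ≤ n)
    (hz : z ∈ slab T) : HasPD T w z fun α => pd T α w z :=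
  .of_differentiableWithinAt ((hw.differentiableOn (by positivity)) z hz)

theorem contDiffOn_pd {F : Type*} [NormedAddCommGroup F] [NormedSpace ℝ F] {w : SpaceTime → F}
    {m n : WithTop ℕ∞} (hT : 0 < T) (hw : ContDiffOn ℝ n w (slab T))
    (hmn : m + 1 ≤ n) (α : Fin 4) : ContDiffOn ℝ m (pd T α w) (slab T) :=
  (hw.fderivWithin (uniqueDiffOn_slab hT) hmn).clm_apply contDiffOn_const

/-- Symmetry of the second derivative within a set holds at points in the closure of the interior;
every point of the slab is one, including the faces t = 0 and t = T. -/
theorem pd_comm (hT : 0 < T) (hw : ContDiffOn ℝ 2 w (slab T)) (hz : z ∈ slab T) (α β : Fin 4) :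
    pd T α (pd T β w) z = pd T β (pd T α w) z := by
  have hu := uniqueDiffOn_slab hT
  have hd : DifferentiableWithinAt ℝ (fderivWithin ℝ w (slab T)) (slab T) z :=
    ((hw.fderivWithin hu (m := 1) (by norm_num)).differentiableOn (by norm_num)) z hz
  have key : ∀ α β, pd T α (pd T β w) z
      = fderivWithin ℝ (fderivWithin ℝ w (slab T)) (slab T) z (dir α) (dir β) := by
    intro α β
    have := hd.hasFDerivWithinAt.clm_apply (hasFDerivWithinAt_const (dir β) z (slab T))
    change fderivWithin ℝ (fun y => fderivWithin ℝ w (slab T) y (dir β)) (slab T) z (dir α) = _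
    rw [this.fderivWithin (hu z hz)]
    simp
  rw [key, key]
  refine (hw z hz).isSymmSndFDerivWithinAt (by simp) hu ?_ hz _ _
  have hi : interior (slab T) = Ioo 0 T ×ˢ univ := by simp [slab, interior_prod_eq]
  rw [hi, closure_prod_eq, closure_Ioo hT.ne]
  simpa [slab] using hz

theorem hasPD_outR (hT : 0 < T) (hw : ContDiffOn ℝ 2 w (slab T)) (hz : z ∈ slab T)
    (hx : z.2 ≠ 0) : HasPD T (outR T w) z fun α =>
      ∑ γ, (outVec γ z * pd T α (pd T γ w) z + pd T γ w z * outVecD z γ α) + pd T α w z :=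
  (HasPD.sum fun γ _ => (hasPD_outVec hx γ).mul
    (.of_contDiffOn (contDiffOn_pd hT hw (m := 1) (by norm_num) γ) le_rfl hz)).add
    (.of_contDiffOn hw (by norm_num) hz)

theorem hasPD_xGrad (hT : 0 < T) (hw : ContDiffOn ℝ 2 w (slab T)) (hz : z ∈ slab T) :
    HasPD T (xGrad T w) z fun α => ∑ i : Fin 3, (z.2 i * pd T α (pd T i.succ w) z
      + pd T i.succ w z * if α = i.succ then 1 else 0) :=
  HasPD.sum fun i _ => (HasPD.coord i).mul
    (.of_contDiffOn (contDiffOn_pd hT hw (m := 1) (by norm_num) i.succ) le_rfl hz)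

theorem HasPD.retarded {g : ℝ → ℝ} {g' : ℝ} (hx : z.2 ≠ 0)
    (hg : HasDerivAt g g' (z.1 - ‖z.2‖)) :
    HasPD T (fun z => g (z.1 - ‖z.2‖)) z
      ![g', -(g' * (z.2 0 / ‖z.2‖)), -(g' * (z.2 1 / ‖z.2‖)), -(g' * (z.2 2 / ‖z.2‖))] := by
  have h : HasPD T (fun z => z.1 - ‖z.2‖) z _ := HasPD.time.sub (HasPD.radius hx)
  refine (h.comp hg).congr fun α => ?_
  fin_cases α <;> simp

/-- The energy current of the flat wave operator for the multiplier `g(t - r) (∂_t + ∂_r)(r w)`. -/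
def boxCurrent (T : ℝ) (g : ℝ → ℝ) (w : SpaceTime → ℝ) (α : Fin 4) (z : SpaceTime) : ℝ :=
  if α = 0 then g (z.1 - ‖z.2‖) * (1 / 2 * (outR T w z ^ 2 * ‖z.2‖⁻¹
      + ‖z.2‖ * ∑ i : Fin 3, pd T i.succ w z ^ 2 - xGrad T w z ^ 2 * ‖z.2‖⁻¹))
  else g (z.1 - ‖z.2‖) * (1 / 2 * (outVec α z * (∑ i : Fin 3, pd T i.succ w z ^ 2
      - xGrad T w z ^ 2 * (‖z.2‖⁻¹) ^ 2 - outR T w z ^ 2 * (‖z.2‖⁻¹) ^ 2))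
      - outR T w z * (pd T α w z - outVec α z * (xGrad T w z * (‖z.2‖⁻¹) ^ 2)))

end SecondOrder

/-- The polynomial core of the flat identity in the case g = 1. Here ρ is 1/r, the a's and b's are
first and second derivatives of w, s = x·∇w, Q = |∇w|², and (D1, D2, D3), D0 are x·∇ applied to ∇w
and ∂_t w. Only these contractions of the second derivatives with x occur, apart from the diagonal
ones forming □w. -/
theorem box_algebra {r ρ x y z a0 a1 a2 a3 b00 b01 b02 b03 b11 b22 b33 R s Q D1 D2 D3 D0 w : ℝ}
    (h1 : r * ρ = 1) (h2 : r ^ 2 = x ^ 2 + y ^ 2 + z ^ 2) (hR : R = r * a0 + s + w)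
    (hs : s = x * a1 + y * a2 + z * a3) (hQ : Q = a1 ^ 2 + a2 ^ 2 + a3 ^ 2)
    (hD0 : D0 = x * b01 + y * b02 + z * b03) :
    (1 / 2) * (2 * R * (r * b00 + D0 + a0) * ρ + r * (2 * (a1 * b01 + a2 * b02 + a3 * b03))
      - 2 * s * D0 * ρ)
      + (3 / 2 * (Q - s ^ 2 * ρ ^ 2 - R ^ 2 * ρ ^ 2) + (a1 * D1 + a2 * D2 + a3 * D3)
      - s * ρ ^ 2 * (x * (D1 + a1) + y * (D2 + a2) + z * (D3 + a3)) + s ^ 2 * ρ ^ 2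
      - R * ρ ^ 2 * (x * (r * b01 + D1 + 2 * a1 + x * ρ * a0)
        + y * (r * b02 + D2 + 2 * a2 + y * ρ * a0) + z * (r * b03 + D3 + 2 * a3 + z * ρ * a0))
      + R ^ 2 * ρ ^ 2
      - ((r * b01 + D1 + 2 * a1 + x * ρ * a0) * (a1 - x * s * ρ ^ 2)
        + (r * b02 + D2 + 2 * a2 + y * ρ * a0) * (a2 - y * s * ρ ^ 2)
        + (r * b03 + D3 + 2 * a3 + z * ρ * a0) * (a3 - z * s * ρ ^ 2))
      - R * ((b11 + b22 + b33) - s * ρ ^ 2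
        - ρ ^ 2 * (x * (D1 + a1) + y * (D2 + a2) + z * (D3 + a3))))
    = (b00 - b11 - b22 - b33) * R - 1 / 2 * (R ^ 2 * ρ ^ 2 + Q - s ^ 2 * ρ ^ 2) := by
  -- The scalars x·D, ∇w·D, Δw and ∇w·∇∂_t w are kept opaque, so this identity needs only rρ = 1 and
  -- the formula for R; coordinates reappear in the final linear combination.
  have e : ∀ N A T β : ℝ, ρ * R * (r * b00 + D0 + a0) + r * β - s * D0 * ρ
      + 3 / 2 * (Q - s ^ 2 * ρ ^ 2 - R ^ 2 * ρ ^ 2) + A - s * ρ ^ 2 * (N + s) + s ^ 2 * ρ ^ 2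
      - R * ρ ^ 2 * (r * D0 + N + 2 * s + r ^ 2 * ρ * a0) + R ^ 2 * ρ ^ 2
      - (r * β + A + 2 * Q + ρ * s * a0 - s * ρ ^ 2 * (r * D0 + N + 2 * s + r ^ 2 * ρ * a0))
      - R * (T - s * ρ ^ 2 - ρ ^ 2 * (N + s))
      = (b00 - T) * R - 1 / 2 * (R ^ 2 * ρ ^ 2 + Q - s ^ 2 * ρ ^ 2) := by
    intro N A T β
    clear hs hQ hD0 h2
    grind
  linear_combination e (x * D1 + y * D2 + z * D3) (a1 * D1 + a2 * D2 + a3 * D3) (b11 + b22 + b33)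
    (a1 * b01 + a2 * b02 + a3 * b03) + r * ρ ^ 2 * (R - s) * hD0 + ρ ^ 3 * a0 * (R - s) * h2
    + (R * ρ ^ 2 + ρ * a0 - s * ρ ^ 2) * hs + 2 * hQ

section BoxIdentity

variable {T : ℝ} {w : SpaceTime → ℝ} {z : SpaceTime}

theorem hasPD_spatialGradSq (hT : 0 < T) (hw : ContDiffOn ℝ 2 w (slab T)) (hz : z ∈ slab T) :
    HasPD T (fun z => ∑ i : Fin 3, pd T i.succ w z ^ 2) z fun α =>
      ∑ i : Fin 3, 2 * pd T i.succ w z * pd T α (pd T i.succ w) z :=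
  HasPD.sum fun i _ => HasPD.sq
    (.of_contDiffOn (contDiffOn_pd hT hw (m := 1) (by norm_num) i.succ) le_rfl hz)

/-- In polar coordinates r R (∂_t - ∂_r)R = ½ (∂_t - ∂_r)(r R²) + ½ R², and the angular part
integrates by parts to ½ (∂_t + ∂_r)(r³ |∇̸w|²) + ½ r² |∇̸w|². Now (∂_t - ∂_r) g(t-r) = 2g' while
(∂_t + ∂_r) g(t-r) = 0, so g' meets V² only and never the angular gradient. The proof verifies this
in Cartesian coordinates. -/
theorem box_identity (hT : 0 < T) (hw : ContDiffOn ℝ 2 w (slab T)) (hz : z ∈ slab T)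
    (hx : z.2 ≠ 0) {g : ℝ → ℝ} {g' : ℝ} (hg : HasDerivAt g g' (z.1 - ‖z.2‖)) :
    ∑ α, pd T α (boxCurrent T g w α) z
      = g (z.1 - ‖z.2‖) * ((pd T 0 (pd T 0 w) z - ∑ i : Fin 3, pd T i.succ (pd T i.succ w) z)
          * outR T w z - 1 / 2 * ((outR T w z / ‖z.2‖) ^ 2 + angSq T w z))
        + g' * ‖z.2‖ * (outR T w z / ‖z.2‖) ^ 2 := by
  have h0 : ‖z.2‖ ≠ 0 := by simpa using hx
  have hR := hasPD_outR hT hw hz hx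
  have hS := hasPD_xGrad hT hw hz
  have hQ := hasPD_spatialGradSq hT hw hz
  have hr := HasPD.radius (T := T) hx
  have hri := hr.inv h0
  have hG := HasPD.retarded (T := T) hx hg
  have ha := fun α : Fin 4 => HasPD.of_contDiffOn
    (contDiffOn_pd hT hw (m := 1) (by norm_num) α) le_rfl hz
  have hP0 : HasPD T (boxCurrent T g w 0) z _ :=
    hG.mul ((HasPD.const (1 / 2)).mul (((hR.sq.mul hri).add (hr.mul hQ)).sub (hS.sq.mul hri)))
  have hP : ∀ i : Fin 3, HasPD T (boxCurrent T g w i.succ) z _ := fun i =>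
    hG.mul (((HasPD.const (1 / 2)).mul ((hasPD_outVec hx i.succ).mul
      ((hQ.sub (hS.sq.mul hri.sq)).sub (hR.sq.mul hri.sq)))).sub
      (hR.mul ((ha i.succ).sub ((hasPD_outVec hx i.succ).mul (hS.mul hri.sq)))))
  have e0 := hP0.pd_eq hT hz 0
  have e := fun i => (hP i).pd_eq hT hz i.succ
  clear hP hP0 ha hG hri hr hQ hS hR
  have hRv := outR_eq' (T := T) (w := w) (z := z)
  have hsv : xGrad T w z = ∑ i : Fin 3, z.2 i * pd T i.succ w z := rfl
  have hc := pd_comm hT hw hz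
  have c1 := hc 1 0
  have c2 := hc 2 0
  have c3 := hc 3 0
  have c4 := hc 2 1
  have c5 := hc 3 1
  have c6 := hc 3 2
  rw [Fin.sum_univ_succ, e0, angSq_eq hx]
  simp only [e]
  clear e e0 hc
  generalize outR T w z = R at *
  generalize xGrad T w z = s at *
  simp only [outVec, outVecD, Fin.sum_univ_four, Fin.sum_univ_three, Fin.succ_zero_eq_one,
    Fin.succ_one_eq_two, show (2 : Fin 3).succ = 3 from rfl, Matrix.cons_val, c1, c2, c3, c4, c5,
    c6, Fin.reduceEq, if_true, if_false, div_eq_mul_inv, ← inv_pow] at *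
  have h1 : ‖z.2‖ * ‖z.2‖⁻¹ = 1 := mul_inv_cancel₀ h0
  have h2 := norm_sq_eq z.2
  clear c1 c2 c3 c4 c5 c6 hg hx hw hz
  generalize pd T 0 (pd T 0 w) z = b00 at *
  generalize pd T 0 (pd T 1 w) z = b01 at *
  generalize pd T 0 (pd T 2 w) z = b02 at *
  generalize pd T 0 (pd T 3 w) z = b03 at *
  generalize pd T 1 (pd T 1 w) z = b11 at *
  generalize pd T 1 (pd T 2 w) z = b12 at *
  generalize pd T 1 (pd T 3 w) z = b13 at *
  generalize pd T 2 (pd T 2 w) z = b22 at *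
  generalize pd T 2 (pd T 3 w) z = b23 at *
  generalize pd T 3 (pd T 3 w) z = b33 at *
  generalize pd T 0 w z = a0 at *
  generalize pd T 1 w z = a1 at *
  generalize pd T 2 w z = a2 at *
  generalize pd T 3 w z = a3 at *
  generalize w z = w at *
  generalize ‖z.2‖⁻¹ = ρ at *
  generalize g (z.1 - ‖z.2‖) = G at *
  generalize ‖z.2‖ = r at *
  generalize z.2 0 = x at *
  generalize z.2 1 = y at *
  generalize z.2 2 = z at *
  -- `D1`, `D2`, `D3` form the Hessian of w applied to x. The identity with g = 1 is multiplied by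
  -- the weight below; the terms with g' are added separately.
  have key := box_algebra h1 h2 hRv hsv rfl rfl (b00 := b00) (b01 := b01) (b02 := b02)
    (b03 := b03) (b11 := b11) (b22 := b22) (b33 := b33) (D1 := x * b11 + y * b12 + z * b13)
    (D2 := x * b12 + y * b22 + z * b23) (D3 := x * b13 + y * b23 + z * b33)
  have u : ρ ^ 2 * (x ^ 2 + y ^ 2 + z ^ 2) = 1 := by rw [← h2, ← mul_pow, mul_comm, h1, one_pow]
  have v : ρ * (x ^ 2 + y ^ 2 + z ^ 2) = r := by rw [← h2]; linear_combination r * h1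
  linear_combination G * key + (G * (R - s) ^ 2 * ρ ^ 2 - R * ρ * s * g' + 1 / 2 * R ^ 2 * ρ * g'
    + 1 / 2 * ρ * s ^ 2 * g') * u - R * ρ * g' * hsv - R ^ 2 * ρ * g' * h1
    - 1 / 2 * (a1 ^ 2 + a2 ^ 2 + a3 ^ 2) * g' * v

end BoxIdentity

/-! ### The perturbation: current, divergence identity and remainder -/

section PertIdentity

variable {T : ℝ} {M : ℕ} {w : Fin M → SpaceTime → ℝ} {h : Pert M} {z : SpaceTime}

/-- The quadratic form `h^{αβ} ∂_α w ∂_β w`. -/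
def pertForm (T : ℝ) (h : Pert M) (w : Fin M → SpaceTime → ℝ) (z : SpaceTime) : ℝ :=
  ∑ I, ∑ J, ∑ α, ∑ β, h I J α β z * (pd T β (w J) z * pd T α (w I) z)

/-- The energy current of the perturbation for the multiplier `g(t - r) (∂_t + ∂_r)(r w)`. -/
def pertCurrent (T : ℝ) (g : ℝ → ℝ) (h : Pert M) (w : Fin M → SpaceTime → ℝ) (α : Fin 4)
    (z : SpaceTime) : ℝ :=
  1 / 2 * (outVec α z * (g (z.1 - ‖z.2‖) * pertForm T h w z))
    - ∑ I, ∑ J, ∑ β, g (z.1 - ‖z.2‖) * (h I J α β z * (pd T β (w J) z * outR T (w I) z))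

/-- The lower order terms in the divergence of the current `pertCurrent`. -/
def pertRem (T : ℝ) (G : ℝ) (G' : Fin 4 → ℝ) (h : Pert M) (w : Fin M → SpaceTime → ℝ)
    (z : SpaceTime) (I J : Fin M) (α β : Fin 4) : ℝ :=
  1 / 2 * G * ((3 * h I J α β z + ∑ γ, outVec γ z * pd T γ (h I J α β) z)
      * (pd T β (w J) z * pd T α (w I) z))
    - G * (pd T α (h I J α β) z * (pd T β (w J) z * outR T (w I) z))
    - G * (h I J α β z * (pd T β (w J) z
        * (∑ γ, pd T γ (w I) z * outVecD z γ α + pd T α (w I) z)))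
    - G' α * (h I J α β z * (pd T β (w J) z * outR T (w I) z))

/-- The partial derivatives of a function `g(t - r)` in terms of `g'`. -/
def retardedD (g' : ℝ) (z : SpaceTime) : Fin 4 → ℝ :=
  ![g', -(g' * (z.2 0 / ‖z.2‖)), -(g' * (z.2 1 / ‖z.2‖)), -(g' * (z.2 2 / ‖z.2‖))]

/-- The field r (∂_t + ∂_r) annihilates every function of t - r, so transporting the quadratic form
along it never differentiates the weight. -/
theorem sum_outVec_mul_retardedD (hx : z.2 ≠ 0) (g' : ℝ) :
    ∑ α, outVec α z * retardedD g' z α = 0 := by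
  have h0 : ‖z.2‖ ≠ 0 := by simpa using hx
  have h := norm_sq_eq z.2
  simp only [outVec, retardedD, Fin.sum_univ_four, Matrix.cons_val]
  field_simp
  linear_combination g' * h

/-- The divergence of r (∂_t + ∂_r): r is independent of t and div x = 3. It is the source of the
term 3h in `pertRem`. -/
theorem sum_outVecD_diag : ∑ α, outVecD z α α = 3 := by
  simp [outVecD, Fin.sum_univ_four]; norm_num

/-- Interchange (I, α) with (J, β); both symmetries of h are needed. It makes h^{αβ} ∂_βw · X∂_αw
half of the X-derivative of the quadratic form, up to the term with Xh. -/
theorem sum_quad_swap {h : Fin M → Fin M → Fin 4 → Fin 4 → ℝ}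
    (h1 : ∀ I J α β, h I J α β = h I J β α) (h2 : ∀ I J α β, h I J α β = h J I α β)
    (a b : Fin M → Fin 4 → ℝ) :
    ∑ I, ∑ J, ∑ α, ∑ β, h I J α β * (a J β * b I α)
      = ∑ I, ∑ J, ∑ α, ∑ β, h I J α β * (b J β * a I α) := by
  rw [Finset.sum_comm]
  refine Finset.sum_congr rfl fun J _ => Finset.sum_congr rfl fun I _ => ?_
  rw [Finset.sum_comm]
  refine Finset.sum_congr rfl fun β _ => Finset.sum_congr rfl fun α _ => ?_
  rw [h1, h2]; ring

theorem hasPD_pertForm (hT : 0 < T) (hh : Admissible T h)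
    (hw : ∀ I, ContDiffOn ℝ 2 (w I) (slab T)) (hz : z ∈ slab T) :
    HasPD T (pertForm T h w) z fun γ => ∑ I, ∑ J, ∑ α, ∑ β,
      (h I J α β z * (pd T β (w J) z * pd T γ (pd T α (w I)) z
        + pd T α (w I) z * pd T γ (pd T β (w J)) z)
        + (pd T β (w J) z * pd T α (w I) z) * pd T γ (h I J α β) z) := by
  have ha := fun I (α : Fin 4) => HasPD.of_contDiffOn
    (contDiffOn_pd hT (hw I) (m := 1) (by norm_num) α) le_rfl hz
  exact HasPD.sum fun I _ => HasPD.sum fun J _ => HasPD.sum fun α _ => HasPD.sum fun β _ =>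
    (HasPD.of_contDiffOn (hh.contDiff I J α β) le_rfl hz).mul ((ha J β).mul (ha I α))

/-- Moving ∂_α off ∂_α∂_β w onto R produces ∂_αR = X∂_αw + [∂_α, X]w + ∂_αw with X = r (∂_t + ∂_r).
The top order product h ∂_βw · X∂_αw is cancelled by the divergence of ½ X · g h^{αβ} ∂_αw ∂_βw, and
what is left is `pertRem`. -/
theorem pert_identity (hT : 0 < T) (hh : Admissible T h)
    (hw : ∀ I, ContDiffOn ℝ 2 (w I) (slab T)) (hz : z ∈ slab T)
    (hx : z.2 ≠ 0) {g : ℝ → ℝ} {g' : ℝ} (hg : HasDerivAt g g' (z.1 - ‖z.2‖)) :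
    ∑ α, pd T α (pertCurrent T g h w α) z
      = -(g (z.1 - ‖z.2‖) * ∑ I, (∑ J, ∑ α, ∑ β, h I J α β z * pd T α (pd T β (w J)) z)
          * outR T (w I) z)
        + ∑ I, ∑ J, ∑ α, ∑ β, pertRem T (g (z.1 - ‖z.2‖)) (retardedD g' z) h w z I J α β := by
  have hG : HasPD T (fun z => g (z.1 - ‖z.2‖)) z (retardedD g' z) := HasPD.retarded hx hg
  have hS := hasPD_pertForm hT hh hw hz
  have ha := fun I (α : Fin 4) => HasPD.of_contDiffOn
    (contDiffOn_pd hT (hw I) (m := 1) (by norm_num) α) le_rfl hz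
  have hR := fun I => hasPD_outR hT (hw I) hz hx
  have hQ : ∀ α, HasPD T (pertCurrent T g h w α) z _ := fun α =>
    ((HasPD.const (1 / 2)).mul ((hasPD_outVec hx α).mul (hG.mul hS))).sub
      (HasPD.sum fun I _ => HasPD.sum fun J _ => HasPD.sum fun β _ =>
        hG.mul ((HasPD.of_contDiffOn (hh.contDiff I J α β) le_rfl hz).mul ((ha J β).mul (hR I))))
  have e := fun α => (hQ α).pd_eq hT hz α
  simp only [e]
  clear e hQ hR ha hS hG
  generalize g (z.1 - ‖z.2‖) = G
  have hsw := sum_quad_swap (fun I J α β => hh.symm_deriv I J α β z hz)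
    (fun I J α β => hh.symm_index I J α β z hz) (fun I α => pd T α (w I) z)
    (fun I α => ∑ γ, outVec γ z * pd T γ (pd T α (w I)) z)
  -- The X-derivative of the quadratic form: by symmetry its two second order halves agree, whence
  -- the factor 2.
  have e1 : ∑ γ, outVec γ z * ∑ I, ∑ J, ∑ α, ∑ β,
      (h I J α β z * (pd T β (w J) z * pd T γ (pd T α (w I)) z
        + pd T α (w I) z * pd T γ (pd T β (w J)) z)
        + (pd T β (w J) z * pd T α (w I) z) * pd T γ (h I J α β) z)
      = ∑ I, ∑ J, ∑ α, ∑ β, (2 * (h I J α β z * (pd T β (w J) z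
          * ∑ γ, outVec γ z * pd T γ (pd T α (w I)) z))
        + (pd T β (w J) z * pd T α (w I) z) * ∑ γ, outVec γ z * pd T γ (h I J α β) z) := by
    have : ∑ I, ∑ J, ∑ α, ∑ β, (2 * (h I J α β z * (pd T β (w J) z
          * ∑ γ, outVec γ z * pd T γ (pd T α (w I)) z))
        + (pd T β (w J) z * pd T α (w I) z) * ∑ γ, outVec γ z * pd T γ (h I J α β) z)
      = ∑ I, ∑ J, ∑ α, ∑ β, (h I J α β z * (pd T β (w J) z
          * ∑ γ, outVec γ z * pd T γ (pd T α (w I)) z)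
        + h I J α β z * ((∑ γ, outVec γ z * pd T γ (pd T β (w J)) z) * pd T α (w I) z)
        + (pd T β (w J) z * pd T α (w I) z) * ∑ γ, outVec γ z * pd T γ (h I J α β) z) := by
      simp only [two_mul, Finset.sum_add_distrib]
      rw [hsw]
    rw [this]
    simp only [Finset.mul_sum, Finset.sum_mul]
    rw [Finset.sum_comm]
    refine Finset.sum_congr rfl fun I _ => ?_
    rw [Finset.sum_comm]
    refine Finset.sum_congr rfl fun J _ => ?_
    rw [Finset.sum_comm]
    refine Finset.sum_congr rfl fun α _ => ?_
    rw [Finset.sum_comm]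
    refine Finset.sum_congr rfl fun β _ => ?_
    simp only [← Finset.sum_add_distrib]
    exact Finset.sum_congr rfl fun γ _ => by ring
  have e2 := sum_outVec_mul_retardedD hx g'
  have e3 := sum_outVecD_diag (z := z)
  -- Splits ∂_αR into X∂_αw, which will cancel, and the commutator terms, which go into `pertRem`.
  have e4 : ∀ (α : Fin 4) I, ∑ γ, (outVec γ z * pd T α (pd T γ (w I)) z
        + pd T γ (w I) z * outVecD z γ α) + pd T α (w I) z
      = ∑ γ, outVec γ z * pd T γ (pd T α (w I)) z
        + (∑ γ, pd T γ (w I) z * outVecD z γ α + pd T α (w I) z) := by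
    intro α I
    rw [Finset.sum_add_distrib, add_assoc]
    simp only [pd_comm hT (hw I) hz α]
  simp only [e4]
  set D := fun γ => ∑ I, ∑ J, ∑ α, ∑ β,
      (h I J α β z * (pd T β (w J) z * pd T γ (pd T α (w I)) z
        + pd T α (w I) z * pd T γ (pd T β (w J)) z)
        + (pd T β (w J) z * pd T α (w I) z) * pd T γ (h I J α β) z) with hD
  -- Divergence of X times the weighted form, grouped so that X applied to the weight (zero) and div
  -- X (three) stand alone.
  have e5 : ∑ α, (1 / 2 * (outVec α z * (G * D α + pertForm T h w z * retardedD g' z α)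
      + G * pertForm T h w z * outVecD z α α) + outVec α z * (G * pertForm T h w z) * 0)
      = 1 / 2 * (G * ∑ α, outVec α z * D α + pertForm T h w z
        * ∑ α, outVec α z * retardedD g' z α + G * pertForm T h w z * ∑ α, outVecD z α α) := by
    simp only [Finset.mul_sum, ← Finset.sum_add_distrib]
    exact Finset.sum_congr rfl fun γ _ => by ring
  rw [Finset.sum_sub_distrib, e5, e1, e2, e3, pertForm]
  have e6 : ∀ F : Fin 4 → Fin M → Fin M → Fin 4 → ℝ,
      ∑ α, ∑ I, ∑ J, ∑ β, F α I J β = ∑ I, ∑ J, ∑ α, ∑ β, F α I J β := by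
    intro F
    rw [Finset.sum_comm]
    exact Finset.sum_congr rfl fun I _ => Finset.sum_comm
  rw [e6]
  simp only [Finset.mul_sum, Finset.sum_mul, mul_zero, add_zero, ← Finset.sum_add_distrib,
    ← Finset.sum_neg_distrib, ← Finset.sum_sub_distrib]
  refine Finset.sum_congr rfl fun I _ => Finset.sum_congr rfl fun J _ =>
    Finset.sum_congr rfl fun α _ => Finset.sum_congr rfl fun β _ => ?_
  rw [pertRem]
  simp only [Fin.sum_univ_four]
  ring

/-- The lower order terms of the perturbation are bounded by `|∂h| |∂w| |(∂_t + ∂_r)(r w)|` and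
similar quantities. -/
theorem abs_pertRem_le (hx : z.2 ≠ 0) {G g' D O : ℝ} (hG : 0 ≤ G)
    (hD : ∀ I α, |pd T α (w I) z| ≤ D) (hO : ∀ I, |outR T (w I) z| ≤ O) (I J : Fin M)
    (α β : Fin 4) :
    |pertRem T G (retardedD g' z) h w z I J α β|
      ≤ G * ((3 / 2 * |h I J α β z| + 1 / 2 * (‖z.2‖ * |outD T (h I J α β) z|)) * D ^ 2)
        + G * (|pd T α (h I J α β) z| * (D * O)) + G * (|h I J α β z| * (3 * D ^ 2))
        + |g'| * (|h I J α β z| * (D * O)) := by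
  have h0 : 0 < ‖z.2‖ := by simpa using hx
  have hD0 : 0 ≤ D := (abs_nonneg _).trans (hD I 0)
  have hO0 : 0 ≤ O := (abs_nonneg _).trans (hO I)
  have hx1 : ∀ i, |z.2 i / ‖z.2‖| ≤ 1 := fun i => by
    rw [abs_div, abs_norm, div_le_one h0]
    exact EuclideanSpace.norm_eq z.2 ▸ PiLp.norm_apply_le z.2 i
  have hR : |retardedD g' z α| ≤ |g'| := by
    have : ∀ i, |-(g' * (z.2 i / ‖z.2‖))| ≤ |g'| := fun i => by
      rw [abs_neg, abs_mul]
      exact mul_le_of_le_one_right (abs_nonneg _) (hx1 i)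
    fin_cases α
    · exact le_rfl
    · exact this 0
    · exact this 1
    · exact this 2
  -- The commutator [∂_α, X]w consists of (∂_α r) ∂_t w and, for spatial α, of ∂_αw; with the
  -- derivative of the summand w in R this makes at most three first derivatives.
  have hc : |∑ γ, pd T γ (w I) z * outVecD z γ α + pd T α (w I) z| ≤ 3 * D := by
    have e : ∑ γ, pd T γ (w I) z * outVecD z γ α
        = pd T 0 (w I) z * outVecD z 0 α + if α = 0 then 0 else pd T α (w I) z := by
      fin_cases α <;> simp [outVecD, Fin.sum_univ_four]
    have e2 : |outVecD z 0 α| ≤ 1 := by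
      fin_cases α
      · simp [outVecD]
      · exact hx1 0
      · exact hx1 1
      · exact hx1 2
    have e3 : |pd T 0 (w I) z * outVecD z 0 α| ≤ D := by
      rw [abs_mul]
      exact (mul_le_of_le_one_right (abs_nonneg _) e2).trans (hD I 0)
    have e4 : |if α = 0 then 0 else pd T α (w I) z| ≤ D := by
      split_ifs
      · simpa using hD0
      · exact hD I α
    rw [e]
    calc _ ≤ _ := abs_add_three _ _ _
      _ ≤ D + D + D := add_le_add (add_le_add e3 e4) (hD I α)
      _ = 3 * D := by ring
  have hDD : |pd T β (w J) z * pd T α (w I) z| ≤ D ^ 2 := by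
    rw [abs_mul, sq]; exact mul_le_mul (hD J β) (hD I α) (abs_nonneg _) hD0
  have hDO : |pd T β (w J) z * outR T (w I) z| ≤ D * O := by
    rw [abs_mul]; exact mul_le_mul (hD J β) (hO I) (abs_nonneg _) hD0
  rw [pertRem, ← norm_mul_outD hx]
  refine (abs_sub _ _).trans (add_le_add ((abs_sub _ _).trans (add_le_add ((abs_sub _ _).trans
    (add_le_add ?_ ?_)) ?_)) ?_)
  · rw [abs_mul, abs_mul (_ + _), abs_of_nonneg (by positivity : 0 ≤ 1 / 2 * G)]
    calc 1 / 2 * G * (|3 * h I J α β z + ‖z.2‖ * outD T (h I J α β) z|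
          * |pd T β (w J) z * pd T α (w I) z|)
        ≤ 1 / 2 * G * ((3 * |h I J α β z| + ‖z.2‖ * |outD T (h I J α β) z|) * D ^ 2) := by
          gcongr
          refine (abs_add_le _ _).trans ?_
          rw [abs_mul, abs_mul, abs_norm, abs_of_nonneg (by norm_num : (0 : ℝ) ≤ 3)]
      _ = _ := by ring
  · rw [abs_mul, abs_mul, abs_of_nonneg hG]
    gcongr
  · rw [abs_mul, abs_mul, abs_mul, abs_of_nonneg hG]
    gcongr G * (|h I J α β z| * ?_)
    calc _ ≤ D * (3 * D) := mul_le_mul (hD J β) hc (abs_nonneg _) hD0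
      _ = _ := by ring
  · rw [abs_mul, abs_mul]
    gcongr

theorem abs_sum_pertRem_le (hx : z.2 ≠ 0) {G g' D O : ℝ} (hG : 0 ≤ G)
    (hD : ∀ I α, |pd T α (w I) z| ≤ D) (hO : ∀ I, |outR T (w I) z| ≤ O) (hD0 : 0 ≤ D)
    (hO0 : 0 ≤ O) :
    |∑ I, ∑ J, ∑ α, ∑ β, pertRem T G (retardedD g' z) h w z I J α β|
      ≤ G * ((3 / 2 * hAbs h z + 1 / 2 * (‖z.2‖ * hOut T h z)) * D ^ 2)
        + G * (hGrad T h z * (D * O)) + G * (hAbs h z * (3 * D ^ 2))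
        + |g'| * (hAbs h z * (D * O)) := by
  have h1 : |∑ I, ∑ J, ∑ α, ∑ β, pertRem T G (retardedD g' z) h w z I J α β|
      ≤ ∑ I, ∑ J, ∑ α, ∑ β,
        (G * ((3 / 2 * |h I J α β z| + 1 / 2 * (‖z.2‖ * |outD T (h I J α β) z|)) * D ^ 2)
        + G * ((∑ γ, |pd T γ (h I J α β) z|) * (D * O)) + G * (|h I J α β z| * (3 * D ^ 2))
        + |g'| * (|h I J α β z| * (D * O))) := by
    refine (Finset.abs_sum_le_sum_abs _ _).trans (Finset.sum_le_sum fun I _ => ?_)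
    refine (Finset.abs_sum_le_sum_abs _ _).trans (Finset.sum_le_sum fun J _ => ?_)
    refine (Finset.abs_sum_le_sum_abs _ _).trans (Finset.sum_le_sum fun α _ => ?_)
    refine (Finset.abs_sum_le_sum_abs _ _).trans (Finset.sum_le_sum fun β _ => ?_)
    refine (abs_pertRem_le hx hG hD hO I J α β).trans ?_
    gcongr
    exact Finset.single_le_sum (f := fun γ => |pd T γ (h I J α β) z|)
      (fun _ _ => abs_nonneg _) (Finset.mem_univ α)
  refine h1.trans (le_of_eq ?_)
  simp only [hAbs, hOut, hGrad, Finset.sum_add_distrib, Finset.mul_sum, Finset.sum_mul, add_mul,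
    mul_add]

end PertIdentity

/-! ### Currents controlling w itself -/

/-- The current `ψ(t - r) ℓ(r) w² (1, x / r)`. -/
def outCurrent (ψ ℓ : ℝ → ℝ) (w : SpaceTime → ℝ) (α : Fin 4) (z : SpaceTime) : ℝ :=
  ψ (z.1 - ‖z.2‖) * (ℓ ‖z.2‖ * (w z ^ 2 * ‖z.2‖⁻¹)) * outVec α z

/-- The current is ψ ℓ w² times the field ∂_t + ∂_r, which kills ψ(t-r) and has divergence 2/r; and
2w (∂_t + ∂_r)w + 2w²/r = 2wV. -/
theorem out_identity {T : ℝ} {w : SpaceTime → ℝ} {z : SpaceTime} (hT : 0 < T)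
    (hw : ContDiffOn ℝ 1 w (slab T)) (hz : z ∈ slab T) (hx : z.2 ≠ 0) {ψ ℓ : ℝ → ℝ} {ψ' ℓ' : ℝ}
    (hψ : HasDerivAt ψ ψ' (z.1 - ‖z.2‖)) (hl : HasDerivAt ℓ ℓ' ‖z.2‖) :
    ∑ α, pd T α (outCurrent ψ ℓ w α) z
      = ψ (z.1 - ‖z.2‖) * (2 * w z * ℓ ‖z.2‖ * (outR T w z / ‖z.2‖) + ℓ' * w z ^ 2) := by
  have h0 : ‖z.2‖ ≠ 0 := by simpa using hx
  have hr := HasPD.radius (T := T) hx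
  have hwz := HasPD.of_contDiffOn hw le_rfl hz
  have hP : ∀ α, HasPD T (outCurrent ψ ℓ w α) z _ := fun α =>
    ((HasPD.retarded hx hψ).mul ((hr.comp hl).mul (hwz.sq.mul (hr.inv h0)))).mul
      (hasPD_outVec hx α)
  have e := fun α => (hP α).pd_eq hT hz α
  simp only [e, outR]
  have h2 := norm_sq_eq z.2
  simp only [outVec, outVecD, Fin.sum_univ_four, Matrix.cons_val, Fin.reduceEq, if_true, if_false]
  field_simp
  generalize ψ (z.1 - ‖z.2‖) = Ψ
  generalize ℓ ‖z.2‖ = L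
  generalize ‖z.2‖ = r at *
  linear_combination (w z ^ 2 * (r * L * ψ' - r * Ψ * ℓ' + Ψ * L)) * h2

/-! ### Divergence theorem on the slab for currents of bounded spatial support -/

section Divergence

variable {T τ : ℝ}

theorem slab_subset (h : τ ≤ T) : slab τ ⊆ slab T := prod_mono (Icc_subset_Icc_right h) subset_rfl

theorem measurableSet_slab (T : ℝ) : MeasurableSet (slab T) := measurableSet_Icc.prod .univ

theorem integrableOn_slab {f : SpaceTime → ℝ} {K : Set E3} (hK : IsCompact K)
    (hf : ContinuousOn f (Icc 0 T ×ˢ K)) (h0 : ∀ z, z.2 ∉ K → f z = 0) (hτ : τ ≤ T) :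
    IntegrableOn f (slab τ) := by
  have h1 : IntegrableOn f (Icc 0 τ ×ˢ K) :=
    (hf.mono (prod_mono (Icc_subset_Icc_right hτ) subset_rfl)).integrableOn_compact
      (isCompact_Icc.prod hK)
  exact h1.of_forall_sdiff_eq_zero (measurableSet_slab τ) fun z hz =>
    h0 z fun hz2 => hz.2 ⟨hz.1.1, hz2⟩

theorem setIntegral_slab {f : SpaceTime → ℝ} (hf : IntegrableOn f (slab τ)) :
    ∫ z in slab τ, f z = ∫ t in Icc 0 τ, ∫ x, f (t, x) := by
  rw [slab, Measure.volume_eq_prod] at *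
  rw [setIntegral_prod f hf]
  simp

theorem setIntegral_slab_symm {f : SpaceTime → ℝ} (hf : IntegrableOn f (slab τ)) :
    ∫ z in slab τ, f z = ∫ x, ∫ t in Icc 0 τ, f (t, x) := by
  rw [IntegrableOn, slab, Measure.volume_eq_prod, ← Measure.prod_restrict,
    Measure.restrict_univ] at *
  exact integral_prod_symm f hf

theorem hasFDerivAt_slice {Q : SpaceTime → ℝ} (hQ : DifferentiableOn ℝ Q (slab T)) {t : ℝ}
    (ht : t ∈ Icc 0 T) (x : E3) :
    HasFDerivAt (fun x => Q (t, x))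
      ((fderivWithin ℝ Q (slab T) (t, x)).comp (ContinuousLinearMap.inr ℝ ℝ E3)) x := by
  have h1 := (hQ (t, x) ⟨ht, mem_univ _⟩).hasFDerivWithinAt
  have h2 : HasFDerivWithinAt (fun x : E3 => (t, x)) (ContinuousLinearMap.inr ℝ ℝ E3) univ x :=
    (hasFDerivAt_prodMk_right t x).hasFDerivWithinAt
  exact (h1.comp x h2 fun y _ => ⟨ht, mem_univ _⟩).hasFDerivAt univ_mem

/-- Integration by parts on ℝ³ against the constant function 1, the slice being C¹ with compact
support. -/
theorem integral_pd_slice_eq_zero {Q : SpaceTime → ℝ} (hT : 0 < T)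
    (hQ : ContDiffOn ℝ 1 Q (slab T)) {b : ℝ}
    (hb : ∀ z : SpaceTime, b < ‖z.2‖ → Q z = 0) {t : ℝ} (ht : t ∈ Icc 0 T) (i : Fin 3) :
    ∫ x, pd T i.succ Q (t, x) = 0 := by
  have hd := hQ.differentiableOn (by norm_num)
  have e : ∀ x, pd T i.succ Q (t, x)
      = fderiv ℝ (fun x => Q (t, x)) x (EuclideanSpace.single i 1) := fun x => by
    rw [(hasFDerivAt_slice hd ht x).fderiv]
    simp [pd, dir]
  have hmaps : MapsTo (fun x : E3 => (t, x)) univ (slab T) := fun y _ => ⟨ht, mem_univ _⟩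
  have hc : Continuous fun x => pd T i.succ Q (t, x) := by
    rw [← continuousOn_univ]
    exact (contDiffOn_pd hT hQ (m := 0) (by norm_num) i.succ).continuousOn.comp
      (by fun_prop) hmaps
  have hc0 : Continuous fun x => Q (t, x) := by
    rw [← continuousOn_univ]
    exact hQ.continuousOn.comp (by fun_prop) hmaps
  have hs0 : HasCompactSupport fun x => Q (t, x) :=
    HasCompactSupport.intro (isCompact_closedBall (0 : E3) b) fun x hx =>
      hb _ (by simpa using hx)
  have hs : HasCompactSupport fun x => pd T i.succ Q (t, x) := by
    simp only [e]
    exact hs0.fderiv_apply (𝕜 := ℝ) _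
  have := integral_mul_fderiv_eq_neg_fderiv_mul_of_integrable (𝕜 := ℝ)
    (μ := (volume : Measure E3)) (f := fun _ => (1 : ℝ))
    (g := fun x => Q (t, x)) (v := EuclideanSpace.single i (1 : ℝ)) (by simp)
    (by simp only [one_mul, ← e]; exact hc.integrable_of_hasCompactSupport hs)
    (by simpa using hc0.integrable_of_hasCompactSupport hs0)
    (fun _ _ => differentiableAt_const _)
    (fun x _ => (hasFDerivAt_slice hd ht x).differentiableAt)
  simpa [← e] using this

theorem integral_pd_time {Q : SpaceTime → ℝ} (hT : 0 < T) (hτ : τ ∈ Icc 0 T)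
    (hQ : ContDiffOn ℝ 1 Q (slab T)) (x : E3) :
    ∫ t in Icc 0 τ, pd T 0 Q (t, x) = Q (τ, x) - Q (0, x) := by
  have hd := hQ.differentiableOn (by norm_num)
  have hmaps : MapsTo (fun t : ℝ => (t, x)) (Icc 0 τ) (slab T) :=
    fun t ht => ⟨⟨ht.1, ht.2.trans hτ.2⟩, mem_univ _⟩
  rw [integral_Icc_eq_integral_Ioc, ← intervalIntegral.integral_of_le hτ.1]
  refine intervalIntegral.integral_eq_sub_of_hasDerivAt_of_le hτ.1
    (hQ.continuousOn.comp (by fun_prop) hmaps) (fun t ht => ?_) ?_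
  · have hmem : slab T ∈ 𝓝 ((t, x) : SpaceTime) :=
      prod_mem_nhds (Icc_mem_nhds ht.1 (ht.2.trans_le hτ.2)) univ_mem
    have h1 := ((hd (t, x) (mem_of_mem_nhds hmem)).hasFDerivWithinAt).hasFDerivAt hmem
    have h2 : HasFDerivAt (fun t : ℝ => (t, x)) (ContinuousLinearMap.inl ℝ ℝ E3) t :=
      hasFDerivAt_prodMk_left t x
    have h3 := (h1.comp t h2).hasDerivAt
    convert h3 using 1
    simp [pd, dir]
  · refine ContinuousOn.intervalIntegrable ?_
    rw [uIcc_of_le hτ.1]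
    exact (contDiffOn_pd hT hQ (m := 0) (by norm_num) 0).continuousOn.comp (by fun_prop) hmaps

theorem pd_eq_zero_of_lt {Q : SpaceTime → ℝ} {b : ℝ}
    (hb : ∀ z : SpaceTime, b < ‖z.2‖ → Q z = 0) (α : Fin 4) {z : SpaceTime} (hz : b < ‖z.2‖) :
    pd T α Q z = 0 := by
  have h : Q =ᶠ[𝓝 z] fun _ => 0 :=
    Filter.mem_of_superset ((isOpen_lt continuous_const (continuous_norm.comp continuous_snd)).mem_nhds
      (show z ∈ {y : SpaceTime | b < ‖y.2‖} from hz)) fun y hy => hb y hy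
  rw [pd, (h.filter_mono nhdsWithin_le_nhds).fderivWithin_eq (hb z hz)]
  simp

/-- Fubini in two orders: spatial derivatives are integrated in x first and vanish, the time
derivative is integrated in t first and gives the two end slices. -/
theorem integral_div_slab {Q : Fin 4 → SpaceTime → ℝ} (hT : 0 < T) (hτ : τ ∈ Icc 0 T)
    (hQ : ∀ α, ContDiffOn ℝ 1 (Q α) (slab T)) {b : ℝ}
    (hb : ∀ α, ∀ z : SpaceTime, b < ‖z.2‖ → Q α z = 0) :
    ∫ z in slab τ, ∑ α, pd T α (Q α) z = ∫ x, (Q 0 (τ, x) - Q 0 (0, x)) := by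
  have hi : ∀ α, IntegrableOn (pd T α (Q α)) (slab τ) := fun α =>
    integrableOn_slab (isCompact_closedBall (0 : E3) b)
      ((contDiffOn_pd hT (hQ α) (m := 0) (by norm_num) α).continuousOn.mono
        (prod_mono subset_rfl (subset_univ _)))
      (fun z hz => pd_eq_zero_of_lt (hb α) α (by simpa using hz)) hτ.2
  rw [integral_finsetSum _ fun α _ => hi α, Fin.sum_univ_succ]
  have h2 : ∀ i : Fin 3, ∫ z in slab τ, pd T i.succ (Q i.succ) z = 0 := fun i => by
    rw [setIntegral_slab (hi _)]
    rw [setIntegral_congr_fun measurableSet_Icc (g := fun _ => 0) fun t ht =>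
      integral_pd_slice_eq_zero hT (hQ _) (hb _) ⟨ht.1, ht.2.trans hτ.2⟩ i]
    simp
  rw [setIntegral_slab_symm (hi 0)]
  simp only [h2, Finset.sum_const_zero, add_zero, integral_pd_time hT hτ (hQ 0)]

end Divergence

/-! ### The radial cutoff -/

section Profile

/-- A continuous probability density supported in `[1, 2]`. -/
def bump (s : ℝ) : ℝ := max 0 (6 * ((s - 1) * (2 - s)))

/-- A decreasing `C¹` function equal to `1` for `s ≤ 1` and to `0` for `s ≥ 2`. -/
def step (s : ℝ) : ℝ := 1 - ∫ ρ in (1 : ℝ)..s, bump ρ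

theorem continuous_bump : Continuous bump := by unfold bump; fun_prop

theorem bump_nonneg (s : ℝ) : 0 ≤ bump s := le_max_left _ _

theorem bump_eq_zero {s : ℝ} (h : s ≤ 1 ∨ 2 ≤ s) : bump s = 0 := by
  refine max_eq_left ?_
  rcases h with h | h
  · nlinarith
  · nlinarith

/-- Outside [1, 2] the product vanishes; inside, s ≤ 2 and the parabola is at most 3/2. -/
theorem mul_bump_le {s : ℝ} (hs : 0 ≤ s) : s * bump s ≤ 3 := by
  by_cases h : s ≤ 1 ∨ 2 ≤ s
  · rw [bump_eq_zero h]; norm_num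
  · push Not at h
    have : bump s ≤ 3 / 2 := max_le (by norm_num) (by nlinarith [sq_nonneg (2 * s - 3)])
    nlinarith [bump_nonneg s]

theorem integral_bump : ∫ ρ in (1 : ℝ)..2, bump ρ = 1 := by
  have h : ∫ ρ in (1 : ℝ)..2, bump ρ = ∫ ρ in (1 : ℝ)..2, (-6 * ρ ^ 2 + 18 * ρ - 12) := by
    refine intervalIntegral.integral_congr fun ρ hρ => ?_
    rw [uIcc_of_le (by norm_num)] at hρ
    have : 0 ≤ (ρ - 1) * (2 - ρ) := mul_nonneg (by linarith [hρ.1]) (by linarith [hρ.2])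
    simp only [bump]
    rw [max_eq_right (by positivity)]
    ring
  rw [h, intervalIntegral.integral_sub, intervalIntegral.integral_add,
    intervalIntegral.integral_const_mul, intervalIntegral.integral_const_mul, integral_pow,
    integral_id, intervalIntegral.integral_const]
  · norm_num
  all_goals exact Continuous.intervalIntegrable (by fun_prop) _ _

theorem hasDerivAt_step (s : ℝ) : HasDerivAt step (-bump s) s := by
  have h := intervalIntegral.integral_hasDerivAt_right (continuous_bump.intervalIntegrable 1 s)
    continuous_bump.stronglyMeasurable.stronglyMeasurableAtFilter continuous_bump.continuousAt
  exact h.const_sub 1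

theorem antitone_step : Antitone step :=
  antitone_of_deriv_nonpos (fun s => (hasDerivAt_step s).differentiableAt) fun s => by
    rw [(hasDerivAt_step s).deriv]; linarith [bump_nonneg s]

theorem step_eq_one {s : ℝ} (h : s ≤ 1) : step s = 1 := by
  have : ∫ ρ in (1 : ℝ)..s, bump ρ = ∫ _ρ in (1 : ℝ)..s, (0 : ℝ) :=
    intervalIntegral.integral_congr fun ρ hρ => by
      rw [uIcc_of_ge h] at hρ
      exact bump_eq_zero (Or.inl hρ.2)
  rw [step, this]; simp

theorem step_eq_zero {s : ℝ} (h : 2 ≤ s) : step s = 0 := by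
  have h2 : ∫ ρ in (2 : ℝ)..s, bump ρ = ∫ _ρ in (2 : ℝ)..s, (0 : ℝ) :=
    intervalIntegral.integral_congr fun ρ hρ => by
      rw [uIcc_of_le h] at hρ
      exact bump_eq_zero (Or.inr hρ.1)
  rw [step, ← intervalIntegral.integral_add_adjacent_intervals
    (continuous_bump.intervalIntegrable 1 2) (continuous_bump.intervalIntegrable 2 s),
    integral_bump, h2]
  simp

theorem step_nonneg (s : ℝ) : 0 ≤ step s := by
  rcases le_total s 2 with h | h
  · simpa [step_eq_zero le_rfl] using antitone_step h
  · exact (step_eq_zero h).ge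

theorem step_le_one (s : ℝ) : step s ≤ 1 := by
  rcases le_total s 1 with h | h
  · exact (step_eq_one h).le
  · simpa [step_eq_one le_rfl] using antitone_step h

theorem contDiff_step : ContDiff ℝ 1 step := by
  rw [contDiff_one_iff_deriv]
  refine ⟨fun s => (hasDerivAt_step s).differentiableAt, ?_⟩
  rw [show deriv step = fun s => -bump s from funext fun s => (hasDerivAt_step s).deriv]
  exact continuous_bump.neg

/-- `step` is an average of indicator functions of half-lines. -/
theorem step_eq_integral (s : ℝ) :
    step s = ∫ ρ in Ioc (1 : ℝ) 2, bump ρ * (if s < ρ then 1 else 0) := by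
  have hi : ∀ a b, IntervalIntegrable bump volume a b := fun a b =>
    continuous_bump.intervalIntegrable a b
  have h1 : ∫ ρ in Ioc (1 : ℝ) 2, bump ρ * (if s < ρ then 1 else 0)
      = ∫ ρ in Ioc (1 : ℝ) 2 ∩ Ioi s, bump ρ := by
    rw [← setIntegral_indicator measurableSet_Ioi]
    refine integral_congr_ae (Eventually.of_forall fun ρ => ?_)
    by_cases h : s < ρ <;> simp [h, indicator]
  rw [h1, Ioc_inter_Ioi]
  rcases le_total s 2 with h | h
  · rw [← intervalIntegral.integral_of_le (max_le (by norm_num) h)]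
    rcases le_total s 1 with h3 | h3
    · rw [max_eq_left h3, integral_bump, step_eq_one h3]
    · rw [max_eq_right h3, step, ← intervalIntegral.integral_interval_sub_left (hi 1 2) (hi 1 s),
        integral_bump]
  · rw [step_eq_zero h, Ioc_eq_empty (by simp [h])]
    simp

/-- The radial profile of the cutoff. -/
def cutP (L r : ℝ) : ℝ := step (r / L) - step (L * r)

/-- The derivative of `cutP`. -/
def cutD (L r : ℝ) : ℝ := -bump (r / L) / L + L * bump (L * r)

theorem hasDerivAt_cutP (L r : ℝ) : HasDerivAt (cutP L) (cutD L r) r := by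
  have h1 := (hasDerivAt_step (r / L)).comp r ((hasDerivAt_id r).div_const L)
  have h2 := (hasDerivAt_step (L * r)).comp r ((hasDerivAt_id r).const_mul L)
  refine (h1.sub h2).congr_deriv ?_
  simp only [cutD]; ring

theorem contDiff_cutP (L : ℝ) : ContDiff ℝ 1 (cutP L) :=
  (contDiff_step.comp (by fun_prop)).sub (contDiff_step.comp (by fun_prop))

theorem continuous_cutD (L : ℝ) : Continuous (cutD L) := by
  have := continuous_bump
  unfold cutD
  fun_prop

variable {L r : ℝ}

theorem cutP_eq_zero_of_le (hL : 2 ≤ L) (hr : r ≤ L⁻¹) : cutP L r = 0 := by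
  have hL0 : 0 < L := by linarith
  have h1 : L * r ≤ 1 := by
    calc L * r ≤ L * L⁻¹ := by gcongr
      _ = 1 := mul_inv_cancel₀ hL0.ne'
  have h2 : r / L ≤ 1 := by
    rw [div_le_one hL0]
    exact hr.trans ((inv_le_one_of_one_le₀ (by linarith)).trans (by linarith))
  rw [cutP, step_eq_one h1, step_eq_one h2, sub_self]

theorem cutP_eq_zero_of_ge (hL : 2 ≤ L) (hr : 2 * L ≤ r) : cutP L r = 0 := by
  have hL0 : 0 < L := by linarith
  have h1 : 2 ≤ L * r := by nlinarith
  have h2 : 2 ≤ r / L := by rwa [le_div_iff₀ hL0]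
  rw [cutP, step_eq_zero h1, step_eq_zero h2, sub_self]

theorem cutP_nonneg (hL : 2 ≤ L) (hr : 0 ≤ r) : 0 ≤ cutP L r := by
  refine sub_nonneg.2 (antitone_step ?_)
  rw [div_le_iff₀ (by linarith)]
  nlinarith [mul_nonneg hr (by nlinarith : 0 ≤ L * L - 1)]

theorem cutP_le_one (L r : ℝ) : cutP L r ≤ 1 := by
  unfold cutP
  linarith [step_le_one (r / L), step_nonneg (L * r)]

theorem cutP_eq_one (hL : 2 ≤ L) (h1 : 2 / L ≤ r) (h2 : r ≤ L) : cutP L r = 1 := by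
  have hL0 : 0 < L := by linarith
  rw [cutP, step_eq_one ((div_le_one hL0).2 h2),
    step_eq_zero (by rwa [div_le_iff₀ hL0, mul_comm] at h1), sub_zero]

/-- The indicator function of the region where the cutoff is not constant. -/
def cutI (L r : ℝ) : ℝ := if r ≤ 2 / L ∨ L ≤ r then 1 else 0

theorem cutI_nonneg : 0 ≤ cutI L r := by unfold cutI; split_ifs <;> norm_num

theorem cutI_le_one : cutI L r ≤ 1 := by unfold cutI; split_ifs <;> norm_num

/-- r times the derivative is invariant under scaling: each transition layer contributes a value s ·
`bump` s ≤ 3 and there are two. Uniformity in L lets a flux of size r F be charged to the integral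
of F. -/
theorem abs_cutD_mul_le (hL : 2 ≤ L) (hr : 0 ≤ r) : |cutD L r| * r ≤ 6 * cutI L r := by
  have hL0 : 0 < L := by linarith
  by_cases h : r ≤ 2 / L ∨ L ≤ r
  · rw [cutI, if_pos h, mul_one]
    have e : |cutD L r| ≤ bump (r / L) / L + L * bump (L * r) := by
      refine (abs_add_le _ _).trans (le_of_eq ?_)
      rw [abs_div, abs_neg, abs_mul, abs_of_nonneg (bump_nonneg _), abs_of_nonneg (bump_nonneg _),
        abs_of_pos hL0]
    calc |cutD L r| * r ≤ (bump (r / L) / L + L * bump (L * r)) * r := by gcongr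
      _ = r / L * bump (r / L) + L * r * bump (L * r) := by ring
      _ ≤ 3 + 3 := add_le_add (mul_bump_le (by positivity)) (mul_bump_le (by positivity))
      _ = 6 := by norm_num
  · rw [cutI, if_neg h]
    push Not at h
    have h1 : r / L ≤ 1 := (div_le_one hL0).2 h.2.le
    have h2 : 2 ≤ L * r := by
      have := h.1.le
      rwa [div_le_iff₀ hL0, mul_comm] at this
    simp [cutD, bump_eq_zero (Or.inl h1), bump_eq_zero (Or.inr h2)]

theorem cutD_eq_zero_of_le (hL : 2 ≤ L) (hr : r ≤ L⁻¹) : cutD L r = 0 := by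
  have hL0 : 0 < L := by linarith
  have h1 : L * r ≤ 1 := by
    calc L * r ≤ L * L⁻¹ := by gcongr
      _ = 1 := mul_inv_cancel₀ hL0.ne'
  have h2 : r / L ≤ 1 := by
    rw [div_le_one hL0]
    exact hr.trans ((inv_le_one_of_one_le₀ (by linarith)).trans (by linarith))
  simp [cutD, bump_eq_zero (Or.inl h1), bump_eq_zero (Or.inl h2)]

theorem cutD_eq_zero_of_ge (hL : 2 ≤ L) (hr : 2 * L ≤ r) : cutD L r = 0 := by
  have hL0 : 0 < L := by linarith
  have h1 : 2 ≤ L * r := by nlinarith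
  have h2 : 2 ≤ r / L := by rwa [le_div_iff₀ hL0]
  simp [cutD, bump_eq_zero (Or.inr h1), bump_eq_zero (Or.inr h2)]

theorem eventually_cutP_eq_one (hr : 0 < r) :
    ∀ᶠ n : ℕ in atTop, cutP ((n : ℝ) + 2) r = 1 ∧ cutI ((n : ℝ) + 2) r = 0 := by
  have h : Tendsto (fun n : ℕ => (n : ℝ) + 2) atTop atTop :=
    tendsto_atTop_add_const_right _ _ tendsto_natCast_atTop_atTop
  filter_upwards [h.eventually_gt_atTop r, h.eventually_gt_atTop (2 / r)] with n h1 h2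
  have hL0 : (0 : ℝ) < (n : ℝ) + 2 := by positivity
  have h3 : 2 / ((n : ℝ) + 2) < r := by
    rw [div_lt_iff₀ hr] at h2
    rw [div_lt_iff₀ hL0]; linarith
  refine ⟨cutP_eq_one (by linarith [n.cast_nonneg (α := ℝ)]) h3.le h1.le, ?_⟩
  rw [cutI, if_neg]
  push Not
  exact ⟨h3, h1⟩

end Profile

/-! ### Regularity away from the spatial origin; the truncated divergence theorem -/

section Cutoff

variable {L : ℝ}

/-- The norm is not differentiable at 0, but there the cutoff vanishes identically in a
neighbourhood. -/
theorem contDiff_cutP_norm (hL : 2 ≤ L) : ContDiff ℝ 1 fun x : E3 => cutP L ‖x‖ := by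
  rw [contDiff_iff_contDiffAt]
  intro x
  rcases eq_or_ne x 0 with rfl | hx
  · have h : (fun x : E3 => cutP L ‖x‖) =ᶠ[𝓝 0] fun _ => 0 := by
      filter_upwards [Metric.closedBall_mem_nhds (0 : E3) (inv_pos.2 (by linarith : 0 < L))] with y hy
      exact cutP_eq_zero_of_le hL (by simpa using hy)
    exact contDiffAt_const.congr_of_eventuallyEq h
  · exact (contDiff_cutP L).contDiffAt.comp x (contDiffAt_norm ℝ hx)

/-- The closed annulus supporting the cutoff. -/
def annulus (L : ℝ) : Set E3 := {x | L⁻¹ ≤ ‖x‖ ∧ ‖x‖ ≤ 2 * L}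

theorem isCompact_annulus (L : ℝ) : IsCompact (annulus L) := by
  refine (isCompact_closedBall (0 : E3) (2 * L)).of_isClosed_subset ?_ fun x hx => by
    simpa using hx.2
  exact (isClosed_le continuous_const continuous_norm).inter
    (isClosed_le continuous_norm continuous_const)

theorem cutP_norm_eq_zero (hL : 2 ≤ L) {x : E3} (hx : x ∉ annulus L) : cutP L ‖x‖ = 0 := by
  simp only [annulus, mem_ofPred_eq, not_and_or, not_le] at hx
  rcases hx with hx | hx
  · exact cutP_eq_zero_of_le hL hx.le
  · exact cutP_eq_zero_of_ge hL hx.le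

theorem cutD_norm_eq_zero (hL : 2 ≤ L) {x : E3} (hx : x ∉ annulus L) : cutD L ‖x‖ = 0 := by
  simp only [annulus, mem_ofPred_eq, not_and_or, not_le] at hx
  rcases hx with hx | hx
  · exact cutD_eq_zero_of_le hL hx.le
  · exact cutD_eq_zero_of_ge hL hx.le

theorem ne_zero_of_mem_annulus (hL : 2 ≤ L) {x : E3} (hx : x ∈ annulus L) : x ≠ 0 := by
  rintro rfl
  have := hx.1
  have : 0 < L⁻¹ := inv_pos.2 (by linarith)
  simp at *
  linarith

/-- Continuity on the slab away from the spatial origin. -/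
def ContOff (T : ℝ) (f : SpaceTime → ℝ) : Prop :=
  ∀ z ∈ slab T, z.2 ≠ 0 → ContinuousWithinAt f (slab T) z

/-- Continuous differentiability on the slab away from the spatial origin. -/
def C1Off (T : ℝ) (f : SpaceTime → ℝ) : Prop :=
  ∀ z ∈ slab T, z.2 ≠ 0 → ContDiffWithinAt ℝ 1 f (slab T) z

variable {T τ : ℝ}

theorem C1Off.contOff {f : SpaceTime → ℝ} (hf : C1Off T f) : ContOff T f := fun z hz hx =>
  (hf z hz hx).continuousWithinAt

theorem ContOff.continuousOn_annulus {f : SpaceTime → ℝ} (hf : ContOff T f) (hL : 2 ≤ L) :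
    ContinuousOn f (Icc 0 T ×ˢ annulus L) := fun z hz =>
  (hf z ⟨hz.1, mem_univ _⟩ (ne_zero_of_mem_annulus hL hz.2)).mono
    (prod_mono subset_rfl (subset_univ _))

theorem ContOff.mul {f g : SpaceTime → ℝ} (hf : ContOff T f) (hg : ContOff T g) :
    ContOff T fun z => f z * g z := fun z hz hx => (hf z hz hx).mul (hg z hz hx)

theorem ContOff.add {f g : SpaceTime → ℝ} (hf : ContOff T f) (hg : ContOff T g) :
    ContOff T fun z => f z + g z := fun z hz hx => (hf z hz hx).add (hg z hz hx)

theorem ContOff.sub {f g : SpaceTime → ℝ} (hf : ContOff T f) (hg : ContOff T g) :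
    ContOff T fun z => f z - g z := fun z hz hx => (hf z hz hx).sub (hg z hz hx)

theorem ContOff.pow {f : SpaceTime → ℝ} (hf : ContOff T f) (n : ℕ) :
    ContOff T fun z => f z ^ n := fun z hz hx => (hf z hz hx).pow n

theorem ContOff.sum {ι : Type*} {s : Finset ι} {f : ι → SpaceTime → ℝ}
    (hf : ∀ i ∈ s, ContOff T (f i)) : ContOff T fun z => ∑ i ∈ s, f i z := fun z hz hx => by
  exact tendsto_finsetSum _ fun i hi => hf i hi z hz hx

theorem ContOff.of_continuousOn {f : SpaceTime → ℝ} (hf : ContinuousOn f (slab T)) : ContOff T f :=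
  fun z hz _ => hf z hz

theorem ContOff.of_continuous {f : SpaceTime → ℝ} (hf : Continuous f) : ContOff T f :=
  .of_continuousOn hf.continuousOn

theorem ContOff.inv_norm : ContOff T fun z => ‖z.2‖⁻¹ := fun z _ hx =>
  ContinuousAt.continuousWithinAt (ContinuousAt.inv₀ (by fun_prop) (by simpa using hx))

theorem ContOff.integrableOn_cut {f : SpaceTime → ℝ} (hf : ContOff T f) (hL : 2 ≤ L) (hτ : τ ≤ T) :
    IntegrableOn (fun z => cutP L ‖z.2‖ * f z) (slab τ) :=
  integrableOn_slab (isCompact_annulus L) (((ContOff.of_continuous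
    ((contDiff_cutP L).continuous.comp (by fun_prop : Continuous fun z : SpaceTime => ‖z.2‖))).mul
      hf).continuousOn_annulus hL) (fun z hz => by simp [cutP_norm_eq_zero hL hz]) hτ

theorem ContOff.integrableOn_cutD {f : SpaceTime → ℝ} (hf : ContOff T f) (hL : 2 ≤ L)
    (hτ : τ ≤ T) : IntegrableOn (fun z => cutD L ‖z.2‖ * f z) (slab τ) :=
  integrableOn_slab (isCompact_annulus L) (((ContOff.of_continuous
    ((continuous_cutD L).comp (by fun_prop : Continuous fun z : SpaceTime => ‖z.2‖))).mul
      hf).continuousOn_annulus hL) (fun z hz => by simp [cutD_norm_eq_zero hL hz]) hτ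

theorem ContOff.continuousOn_slice {f : SpaceTime → ℝ} (hf : ContOff T f) {t : ℝ}
    (ht : t ∈ Icc 0 T) : ContinuousOn (fun x => f (t, x)) {x | x ≠ 0} := fun x hx =>
  (hf (t, x) ⟨ht, mem_univ _⟩ hx).comp (t := slab T) (by fun_prop) fun _ _ => ⟨ht, mem_univ _⟩

theorem integrable_cut_slice {f : E3 → ℝ} (hf : ContinuousOn f {x | x ≠ 0}) (hL : 2 ≤ L) :
    Integrable fun x => cutP L ‖x‖ * f x := by
  have h1 : ContinuousOn (fun x => cutP L ‖x‖ * f x) (annulus L) :=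
    (contDiff_cutP_norm hL).continuous.continuousOn.mul
      (hf.mono fun x hx => ne_zero_of_mem_annulus hL hx)
  rw [← integrableOn_univ]
  exact (h1.integrableOn_compact (isCompact_annulus L)).of_forall_sdiff_eq_zero .univ
    fun x hx => by simp [cutP_norm_eq_zero hL hx.2]

theorem integrable_cutD_slice {f : E3 → ℝ} (hf : ContinuousOn f {x | x ≠ 0}) (hL : 2 ≤ L) :
    Integrable fun x => cutD L ‖x‖ * f x := by
  have h1 : ContinuousOn (fun x => cutD L ‖x‖ * f x) (annulus L) :=
    ((continuous_cutD L).comp continuous_norm).continuousOn.mul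
      (hf.mono fun x hx => ne_zero_of_mem_annulus hL hx)
  rw [← integrableOn_univ]
  exact (h1.integrableOn_compact (isCompact_annulus L)).of_forall_sdiff_eq_zero .univ
    fun x hx => by simp [cutD_norm_eq_zero hL hx.2]

/-- The radial component of a current. -/
def radialFlux (P : Fin 4 → SpaceTime → ℝ) (z : SpaceTime) : ℝ :=
  ∑ i : Fin 3, z.2 i / ‖z.2‖ * P i.succ z

section CutCurrent

variable {P : SpaceTime → ℝ}

theorem cut_eventuallyEq_zero (hL : 2 ≤ L) {z : SpaceTime} (hx : z.2 = 0) :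
    (fun z : SpaceTime => cutP L ‖z.2‖ * P z) =ᶠ[𝓝 z] fun _ => 0 := by
  have h1 : ∀ᶠ y : SpaceTime in 𝓝 z, ‖y.2‖ < L⁻¹ :=
    (Continuous.continuousAt (by fun_prop : Continuous fun y : SpaceTime => ‖y.2‖)).eventually_lt
      continuousAt_const (by simpa [hx] using by linarith)
  filter_upwards [h1] with y hy
  rw [cutP_eq_zero_of_le hL hy.le, zero_mul]

theorem C1Off.contDiffOn_cut (hP : C1Off T P) (hL : 2 ≤ L) :
    ContDiffOn ℝ 1 (fun z => cutP L ‖z.2‖ * P z) (slab T) := by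
  intro z hz
  by_cases hx : z.2 = 0
  · exact contDiffWithinAt_const.congr_of_eventuallyEq
      ((cut_eventuallyEq_zero hL hx).filter_mono nhdsWithin_le_nhds)
      (cut_eventuallyEq_zero hL hx).eq_of_nhds
  · have : ContDiff ℝ 1 fun z : SpaceTime => cutP L ‖z.2‖ :=
      (contDiff_cutP_norm hL).comp contDiff_snd
    exact this.contDiffWithinAt.mul (hP z hz hx)

/-- Product rule off the origin. At the origin, where P is arbitrary, both sides vanish because the
cutoff and its derivative do. -/
theorem C1Off.pd_cut (hT : 0 < T) (hP : C1Off T P) (hL : 2 ≤ L) {z : SpaceTime} (hz : z ∈ slab T)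
    (α : Fin 4) :
    pd T α (fun z => cutP L ‖z.2‖ * P z) z = cutP L ‖z.2‖ * pd T α P z
      + P z * (cutD L ‖z.2‖ * ![0, z.2 0 / ‖z.2‖, z.2 1 / ‖z.2‖, z.2 2 / ‖z.2‖] α) := by
  by_cases hx : z.2 = 0
  · rw [pd, ((cut_eventuallyEq_zero hL hx).filter_mono nhdsWithin_le_nhds).fderivWithin_eq
      (cut_eventuallyEq_zero hL hx).eq_of_nhds]
    have h1 : (0 : ℝ) ≤ L⁻¹ := by positivity
    simp [hx, cutP_eq_zero_of_le hL h1, cutD_eq_zero_of_le hL h1]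
  · exact (((HasPD.radius hx).comp (hasDerivAt_cutP L _)).mul (.of_differentiableWithinAt
      ((hP z hz hx).differentiableWithinAt (by norm_num)))).pd_eq hT hz α

theorem C1Off.contOff_pd (hT : 0 < T) (hP : C1Off T P) (α : Fin 4) : ContOff T (pd T α P) := by
  intro z hz hx
  have h := (hP z hz hx).fderivWithin_right (uniqueDiffOn_slab hT) (m := 0) (by norm_num) hz
  exact h.continuousWithinAt.clm_apply continuousWithinAt_const

end CutCurrent

/-- The cutoff is radial and independent of t, so differentiating it exposes only the radial
component of the current. -/
theorem integral_div_cut {P : Fin 4 → SpaceTime → ℝ} (hT : 0 < T) (hτ : τ ∈ Icc 0 T)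
    (hP : ∀ α, C1Off T (P α)) (hL : 2 ≤ L) :
    ∫ z in slab τ, (cutP L ‖z.2‖ * ∑ α, pd T α (P α) z + cutD L ‖z.2‖ * radialFlux P z)
      = ∫ x, (cutP L ‖x‖ * P 0 (τ, x) - cutP L ‖x‖ * P 0 (0, x)) := by
  rw [← integral_div_slab hT hτ (fun α => (hP α).contDiffOn_cut hL) (b := 2 * L)
    (fun α z hz => by rw [cutP_eq_zero_of_ge hL hz.le, zero_mul])]
  refine setIntegral_congr_fun (measurableSet_slab τ) fun z hz => ?_
  simp only [(hP _).pd_cut hT hL (slab_subset hτ.2 hz), Fin.sum_univ_four, radialFlux,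
    Fin.sum_univ_three, Matrix.cons_val, Fin.succ_zero_eq_one, Fin.succ_one_eq_two,
    show (2 : Fin 3).succ = 3 from rfl]
  ring

/-- The version at a fixed time, needed for Hardy's inequality. -/
theorem integral_div_cut_slice {P : Fin 4 → SpaceTime → ℝ} (hT : 0 < T) {t : ℝ} (ht : t ∈ Icc 0 T)
    (hP : ∀ α, C1Off T (P α)) (hL : 2 ≤ L) :
    ∫ x, (cutP L ‖x‖ * ∑ i : Fin 3, pd T i.succ (P i.succ) (t, x)
      + cutD L ‖x‖ * radialFlux P (t, x)) = 0 := by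
  have h := fun i : Fin 3 => integral_pd_slice_eq_zero hT ((hP i.succ).contDiffOn_cut hL)
    (b := 2 * L) (fun z hz => by rw [cutP_eq_zero_of_ge hL hz.le, zero_mul]) ht i
  have e : ∀ (i : Fin 3) (x : E3), pd T i.succ (fun z => cutP L ‖z.2‖ * P i.succ z) (t, x)
      = cutP L ‖x‖ * pd T i.succ (P i.succ) (t, x)
        + cutD L ‖x‖ * (x i / ‖x‖ * P i.succ (t, x)) := fun i x => by
    rw [(hP _).pd_cut hT hL ⟨ht, mem_univ _⟩]
    fin_cases i <;> simp <;> ring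
  have hc : ∀ i : Fin 3, ContinuousOn (fun x : E3 => x i / ‖x‖) {x | x ≠ 0} := fun i x hx =>
    ContinuousAt.continuousWithinAt (ContinuousAt.div (by fun_prop) (by fun_prop) (by simpa using hx))
  have hi : ∀ i : Fin 3, Integrable fun x : E3 => cutP L ‖x‖ * pd T i.succ (P i.succ) (t, x)
        + cutD L ‖x‖ * (x i / ‖x‖ * P i.succ (t, x)) := fun i =>
    (integrable_cut_slice (((hP _).contOff_pd hT _).continuousOn_slice ht) hL).add
      (integrable_cutD_slice ((hc i).mul ((hP _).contOff.continuousOn_slice ht)) hL)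
  simp only [e] at h
  calc _ = ∫ x, ∑ i : Fin 3, (cutP L ‖x‖ * pd T i.succ (P i.succ) (t, x)
        + cutD L ‖x‖ * (x i / ‖x‖ * P i.succ (t, x))) := by
        refine integral_congr_ae (Eventually.of_forall fun x => ?_)
        simp only [radialFlux, Finset.mul_sum, ← Finset.sum_add_distrib]
    _ = 0 := by rw [integral_finsetSum _ fun i _ => hi i]; simp [h]

end Cutoff

/-! ### Integrals in [0, ∞] and null sets -/

variable {T τ : ℝ}

/-- Drop the negative part; if f is not integrable the left integral is 0 by convention. No
measurability is required, so error terms may be majorized freely. -/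
theorem ofReal_integral_le_lintegral {α : Type*} [MeasurableSpace α] {μ : Measure α} (f : α → ℝ) :
    ENNReal.ofReal (∫ x, f x ∂μ) ≤ ∫⁻ x, ENNReal.ofReal (f x) ∂μ := by
  by_cases hf : Integrable f μ
  · rw [integral_eq_lintegral_pos_part_sub_lintegral_neg_part hf]
    exact (ENNReal.ofReal_le_ofReal (sub_le_self _ ENNReal.toReal_nonneg)).trans
      ENNReal.ofReal_toReal_le
  · simp [integral_undef hf]

theorem ofReal_mul_le_of_le_one {c a : ℝ} (h0 : 0 ≤ c) (h1 : c ≤ 1) :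
    ENNReal.ofReal (c * a) ≤ ENNReal.ofReal a := by
  rcases le_total 0 a with ha | ha
  · exact ENNReal.ofReal_le_ofReal (mul_le_of_le_one_left ha h1)
  · rw [ENNReal.ofReal_of_nonpos (mul_nonpos_of_nonneg_of_nonpos h0 ha)]
    exact zero_le

theorem ae_ne_zero : ∀ᵐ x : E3, x ≠ 0 := by
  simp [ae_iff]

theorem ae_slab_ne_zero (τ : ℝ) : ∀ᵐ z ∂(volume.restrict (slab τ)), z ∈ slab τ ∧ z.2 ≠ 0 := by
  refine (ae_restrict_mem (measurableSet_slab τ)).and (ae_restrict_of_ae ?_)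
  have h : {z : SpaceTime | ¬z.2 ≠ 0} = univ ×ˢ {0} := by ext; simp
  rw [ae_iff, h, Measure.volume_eq_prod, Measure.prod_prod]
  simp

theorem ContOff.aemeasurable {f : SpaceTime → ℝ} (hf : ContOff T f) :
    AEMeasurable f (volume.restrict (slab T)) := by
  have h1 : MeasurableSet (slab T ∩ {z | z.2 ≠ 0}) :=
    (measurableSet_slab T).inter (measurable_snd (measurableSet_singleton 0).compl)
  have h2 : ContinuousOn f (slab T ∩ {z | z.2 ≠ 0}) := fun z hz =>
    (hf z hz.1 hz.2).mono inter_subset_left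
  have h3 : (volume.restrict (slab T ∩ {z | z.2 ≠ 0})) = volume.restrict (slab T) := by
    refine Measure.restrict_congr_set ?_
    have := ae_slab_ne_zero T
    rw [ae_restrict_iff' (measurableSet_slab T)] at this
    filter_upwards [this] with z hz
    exact propext ⟨fun h => h.1, fun h => ⟨h, (hz h).2⟩⟩
  rw [← h3]
  exact (h2.aemeasurable h1)

theorem aemeasurable_of_continuousOn_ne {f : E3 → ℝ} (hf : ContinuousOn f {x | x ≠ 0}) :
    AEMeasurable f := by
  have h1 : MeasurableSet {x : E3 | x ≠ 0} := (measurableSet_singleton 0).compl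
  have h3 : (volume.restrict {x : E3 | x ≠ 0}) = volume :=
    Measure.restrict_eq_self_of_ae_mem ae_ne_zero
  rw [← h3]
  exact hf.aemeasurable h1

theorem ContOff.mono {f : SpaceTime → ℝ} (hf : ContOff T f) (h : τ ≤ T) : ContOff τ f :=
  fun z hz hx => (hf z (slab_subset h hz) hx).mono (slab_subset h)

/-! ### Smooth cutoffs against sharp balls in the signed integral -/

section SignedLimit

variable {f : SpaceTime → ℝ}

/-- The integral over a truncated slab. -/
def ballIntegral (τ : ℝ) (f : SpaceTime → ℝ) (R : ℝ) : ℝ :=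
  ∫ z in Icc (0 : ℝ) τ ×ˢ Metric.ball (0 : E3) R, f z

/-- Fubini, with `step` written as the average of the indicators of s < ρ under the density `bump`:
the smoothly truncated integral is an average of integrals over the balls of radius ρL, 1 < ρ ≤ 2.
-/
theorem integral_step_eq (hint : ∀ R, IntegrableOn f (Icc (0 : ℝ) τ ×ˢ Metric.ball (0 : E3) R))
    {L : ℝ} (hL : 0 < L) :
    ∫ z in slab τ, step (‖z.2‖ / L) * f z
      = ∫ ρ in Ioc (1 : ℝ) 2, bump ρ * ballIntegral τ f (ρ * L) := by
  set S : Set SpaceTime := Icc (0 : ℝ) τ ×ˢ Metric.ball (0 : E3) (2 * L) with hS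
  have hSm : MeasurableSet S := measurableSet_Icc.prod Metric.isOpen_ball.measurableSet
  have h1 : ∫ z in slab τ, step (‖z.2‖ / L) * f z = ∫ z in S, step (‖z.2‖ / L) * f z := by
    refine setIntegral_eq_of_subset_of_forall_sdiff_eq_zero (measurableSet_slab τ)
      (prod_mono subset_rfl (subset_univ _)) fun z hz => ?_
    have : 2 ≤ ‖z.2‖ / L := by
      rw [le_div_iff₀ hL]
      by_contra! h
      exact hz.2 ⟨hz.1.1, by simpa using h⟩
    rw [step_eq_zero this, zero_mul]
  have h2 : ∫ z in S, step (‖z.2‖ / L) * f z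
      = ∫ z in S, ∫ ρ in Ioc (1 : ℝ) 2, bump ρ * ((if ‖z.2‖ / L < ρ then 1 else 0) * f z) := by
    refine integral_congr_ae (Eventually.of_forall fun z => ?_)
    simp only [← mul_assoc]
    rw [integral_mul_const, ← step_eq_integral]
  have hb : Integrable bump (volume.restrict (Ioc (1 : ℝ) 2)) :=
    (continuous_bump.integrableOn_Icc (a := 1) (b := 2)).mono_set Ioc_subset_Icc_self
  have hset : MeasurableSet {p : SpaceTime × ℝ | ‖p.1.2‖ / L < p.2} :=
    measurableSet_lt (by fun_prop) (by fun_prop)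
  have h3 : Integrable (Function.uncurry fun (z : SpaceTime) (ρ : ℝ) =>
      bump ρ * ((if ‖z.2‖ / L < ρ then 1 else 0) * f z))
      ((volume.restrict S).prod (volume.restrict (Ioc (1 : ℝ) 2))) := by
    have hf := hint (2 * L)
    refine ((Integrable.mul_prod hf.norm hb)).mono' ?_ (Eventually.of_forall fun p => ?_)
    · refine (continuous_bump.comp continuous_snd).aestronglyMeasurable.mul
        (AEStronglyMeasurable.mul ?_ hf.aestronglyMeasurable.comp_fst)
      exact (Measurable.ite hset measurable_const measurable_const).aestronglyMeasurable
    · simp only [Function.uncurry, norm_mul, Real.norm_of_nonneg (bump_nonneg _)]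
      rw [mul_comm]
      gcongr
      · exact bump_nonneg _
      · split_ifs <;> simp
  rw [h1, h2, integral_integral_swap h3]
  refine setIntegral_congr_fun measurableSet_Ioc fun ρ hρ => ?_
  rw [integral_const_mul]
  congr 1
  have h4 : ∀ z : SpaceTime, (if ‖z.2‖ / L < ρ then 1 else 0) * f z
      = ({z : SpaceTime | ‖z.2‖ < ρ * L}).indicator f z := fun z => by
    simp only [indicator, mem_ofPred_eq, div_lt_iff₀ hL, ite_mul, one_mul, zero_mul]
  have h5 : MeasurableSet {z : SpaceTime | ‖z.2‖ < ρ * L} :=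
    measurableSet_lt (by fun_prop) (by fun_prop)
  simp only [h4]
  rw [setIntegral_indicator h5, ballIntegral]
  congr 2
  ext z
  simp only [hS, mem_inter_iff, mem_prod, Metric.mem_ball, dist_zero_right, mem_ofPred_eq]
  constructor
  · exact fun h => ⟨h.1.1, h.2⟩
  · exact fun h => ⟨⟨h.1, h.2.trans_le (by have := hρ.2; gcongr)⟩, h.2⟩

/-- The inner cutoff lives on r ≤ 2/L; since f is integrable on the unit cylinder, dominated
convergence makes its contribution vanish. -/
theorem tendsto_integral_step_mul (hint : ∀ R, IntegrableOn f (Icc (0 : ℝ) τ ×ˢ Metric.ball (0 : E3) R)) :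
    Tendsto (fun n : ℕ => ∫ z in slab τ, step (((n : ℝ) + 2) * ‖z.2‖) * f z) atTop (𝓝 0) := by
  have hint2 : IntegrableOn f (Icc (0 : ℝ) τ ×ˢ Metric.closedBall (0 : E3) 1) :=
    (hint 2).mono_set (prod_mono subset_rfl (Metric.closedBall_subset_ball (by norm_num)))
  have h1 : ∀ n : ℕ, ∫ z in slab τ, step (((n : ℝ) + 2) * ‖z.2‖) * f z
      = ∫ z in Icc (0 : ℝ) τ ×ˢ Metric.closedBall (0 : E3) 1, step (((n : ℝ) + 2) * ‖z.2‖) * f z := by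
    intro n
    refine setIntegral_eq_of_subset_of_forall_sdiff_eq_zero (measurableSet_slab τ)
      (prod_mono subset_rfl (subset_univ _)) fun z hz => ?_
    have h2 : 1 < ‖z.2‖ := by
      by_contra! h
      exact hz.2 ⟨hz.1.1, by simpa using h⟩
    rw [step_eq_zero (by nlinarith [n.cast_nonneg (α := ℝ)]), zero_mul]
  simp only [h1]
  suffices h : Tendsto (fun n : ℕ => ∫ z in Icc (0 : ℝ) τ ×ˢ Metric.closedBall (0 : E3) 1,
      step (((n : ℝ) + 2) * ‖z.2‖) * f z) atTop
      (𝓝 (∫ _z : SpaceTime in Icc (0 : ℝ) τ ×ˢ Metric.closedBall (0 : E3) 1, (0 : ℝ))) by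
    simpa using h
  refine tendsto_integral_of_dominated_convergence (fun z => ‖f z‖) (fun n => ?_) hint2.norm
    (fun n => Eventually.of_forall fun z => ?_) ?_
  · exact (Continuous.aestronglyMeasurable (contDiff_step.continuous.comp (by fun_prop))).mul
      hint2.aestronglyMeasurable
  · rw [norm_mul, Real.norm_of_nonneg (step_nonneg _)]
    exact mul_le_of_le_one_left (norm_nonneg _) (step_le_one _)
  · have hsub : Icc (0 : ℝ) τ ×ˢ Metric.closedBall (0 : E3) 1 ⊆ slab τ :=
      prod_mono subset_rfl (subset_univ _)
    have := ae_restrict_of_ae_restrict_of_subset hsub (ae_slab_ne_zero τ)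
    filter_upwards [this] with z hz
    have hr : 0 < ‖z.2‖ := by simpa using hz.2
    refine tendsto_const_nhds.congr' ?_
    have h : Tendsto (fun n : ℕ => (n : ℝ) + 2) atTop atTop :=
      tendsto_atTop_add_const_right _ _ tendsto_natCast_atTop_atTop
    filter_upwards [h.eventually_ge_atTop (2 / ‖z.2‖)] with n hn
    rw [div_le_iff₀ hr] at hn
    rw [step_eq_zero hn, zero_mul]

/-- `cutP` is an outer cutoff minus an inner one. The outer integral averages ball integrals of
large radius, each below a by definition of the limsup; the inner one is eventually below b. -/
theorem eventually_ofReal_integral_cut_le (hf : ContOff τ f)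
    (hint : ∀ R, IntegrableOn f (Icc (0 : ℝ) τ ×ˢ Metric.ball (0 : E3) R)) {a b : ℝ≥0∞}
    (ha : absIntegral τ f < a) (hb : 0 < b) :
    ∀ᶠ n : ℕ in atTop,
      ENNReal.ofReal (∫ z in slab τ, cutP ((n : ℝ) + 2) ‖z.2‖ * f z) ≤ a + b := by
  rcases eq_or_ne a ∞ with rfl | hat
  · simp
  have h1 : ∀ᶠ R : ℝ in atTop, ‖ballIntegral τ f R‖ₑ < a := eventually_lt_of_limsup_lt ha
  obtain ⟨R0, hR0⟩ := eventually_atTop.1 h1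
  have h2 : ∀ᶠ n : ℕ in atTop, ‖∫ z in slab τ, step (((n : ℝ) + 2) * ‖z.2‖) * f z‖ₑ < b := by
    have := (tendsto_integral_step_mul hint).enorm
    rw [enorm_zero] at this
    exact this.eventually_lt_const hb
  have hN : Tendsto (fun n : ℕ => (n : ℝ) + 2) atTop atTop :=
    tendsto_atTop_add_const_right _ _ tendsto_natCast_atTop_atTop
  filter_upwards [h2, hN.eventually_ge_atTop R0] with n hn hn2
  have hL0 : (0 : ℝ) < (n : ℝ) + 2 := by positivity
  set L := (n : ℝ) + 2
  have hL : 2 ≤ L := by linarith [n.cast_nonneg (α := ℝ), show L = n + 2 from rfl]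
  have hi : IntegrableOn (fun z => step (L * ‖z.2‖) * f z) (slab τ) := by
    have h3 : IntegrableOn (fun z => step (L * ‖z.2‖) * f z)
        (Icc (0 : ℝ) τ ×ˢ Metric.ball (0 : E3) 2) := by
      refine (hint 2).norm.mono' ((Continuous.aestronglyMeasurable
        (contDiff_step.continuous.comp (by fun_prop))).mul (hint 2).aestronglyMeasurable)
        (Eventually.of_forall fun z => ?_)
      rw [norm_mul, Real.norm_of_nonneg (step_nonneg _)]
      exact mul_le_of_le_one_left (norm_nonneg _) (step_le_one _)
    refine h3.of_forall_sdiff_eq_zero (measurableSet_slab τ) fun z hz => ?_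
    have h2 : 2 ≤ ‖z.2‖ := by
      by_contra! h
      exact hz.2 ⟨hz.1.1, by simpa using h⟩
    rw [step_eq_zero (by nlinarith), zero_mul]
  have hic := hf.integrableOn_cut hL le_rfl
  have e1 : ∫ z in slab τ, cutP L ‖z.2‖ * f z = (∫ z in slab τ, step (‖z.2‖ / L) * f z)
      - ∫ z in slab τ, step (L * ‖z.2‖) * f z := by
    rw [eq_sub_iff_add_eq, ← integral_add hic hi]
    refine integral_congr_ae (Eventually.of_forall fun z => ?_)
    simp only [cutP]; ring
  -- All radii ρL exceed `R0`, and `bump` has total mass one on (1, 2].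
  have e2 : ‖∫ z in slab τ, step (‖z.2‖ / L) * f z‖ₑ ≤ a := by
    rw [integral_step_eq hint hL0, ← ENNReal.ofReal_toReal hat, ← ofReal_norm]
    refine ENNReal.ofReal_le_ofReal ?_
    have hb1 : ∫ ρ in Ioc (1 : ℝ) 2, bump ρ * a.toReal = a.toReal := by
      rw [integral_mul_const, ← intervalIntegral.integral_of_le (by norm_num), integral_bump,
        one_mul]
    rw [← hb1]
    refine norm_integral_le_of_norm_le ?_ ?_
    · exact ((continuous_bump.mul continuous_const).integrableOn_Icc (a := 1) (b := 2)).mono_set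
        Ioc_subset_Icc_self
    · filter_upwards [ae_restrict_mem measurableSet_Ioc] with ρ hρ
      rw [norm_mul, Real.norm_of_nonneg (bump_nonneg _)]
      refine mul_le_mul_of_nonneg_left ?_ (bump_nonneg _)
      have h4 := (hR0 (ρ * L) (by nlinarith [hρ.1])).le
      rw [← toReal_enorm]
      exact ENNReal.toReal_mono hat h4
  calc ENNReal.ofReal (∫ z in slab τ, cutP L ‖z.2‖ * f z)
      ≤ ‖∫ z in slab τ, cutP L ‖z.2‖ * f z‖ₑ := by
        rw [← ofReal_norm]
        exact ENNReal.ofReal_le_ofReal (le_abs_self _)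
    _ ≤ ‖∫ z in slab τ, step (‖z.2‖ / L) * f z‖ₑ
        + ‖∫ z in slab τ, step (L * ‖z.2‖) * f z‖ₑ := by
        rw [e1]; exact enorm_sub_le
    _ ≤ a + b := add_le_add e2 hn.le

end SignedLimit

/-! ### Removal of the cutoff -/

section Fatou

variable {α : Type*} [MeasurableSpace α] {μ : Measure α}

/-- Fatou's lemma: at each point with r > 0 the cutoff equals one for all large n. -/
theorem lintegral_le_of_cut {F : α → ℝ} {r : α → ℝ} (hF : AEMeasurable F μ) (hr : Measurable r)
    (hr0 : ∀ᵐ x ∂μ, 0 < r x) {K : ℝ≥0∞} {e : ℕ → ℝ≥0∞} (he : Tendsto e atTop (𝓝 0))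
    (h : ∀ᶠ n : ℕ in atTop,
      ∫⁻ x, ENNReal.ofReal (cutP ((n : ℝ) + 2) (r x) * F x) ∂μ ≤ K + e n) :
    ∫⁻ x, ENNReal.ofReal (F x) ∂μ ≤ K := by
  have h1 : ∫⁻ x, ENNReal.ofReal (F x) ∂μ
      ≤ ∫⁻ x, liminf (fun n : ℕ => ENNReal.ofReal (cutP ((n : ℝ) + 2) (r x) * F x)) atTop ∂μ := by
    refine lintegral_mono_ae ?_
    filter_upwards [hr0] with x hx
    refine le_of_eq (Eq.symm (Tendsto.liminf_eq (tendsto_const_nhds.congr' ?_)))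
    filter_upwards [eventually_cutP_eq_one hx] with n hn
    rw [hn.1, one_mul]
  refine h1.trans ((lintegral_liminf_le' fun n => ?_).trans ?_)
  · exact (((contDiff_cutP _).continuous.measurable.comp hr).aemeasurable.mul hF).ennreal_ofReal
  · refine (liminf_le_liminf h).trans ?_
    have h2 : Tendsto (fun n => K + e n) atTop (𝓝 (K + 0)) := tendsto_const_nhds.add he
    rw [h2.liminf_eq, add_zero]

/-- Dominated convergence: each point with r > 0 eventually leaves the transition region. -/
theorem tendsto_lintegral_cutI {F : α → ℝ} {r : α → ℝ} (hF : AEMeasurable F μ) (hr : Measurable r)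
    (hr0 : ∀ᵐ x ∂μ, 0 < r x) (hfin : ∫⁻ x, ENNReal.ofReal (F x) ∂μ ≠ ∞) :
    Tendsto (fun n : ℕ => ∫⁻ x, ENNReal.ofReal (cutI ((n : ℝ) + 2) (r x) * F x) ∂μ) atTop
      (𝓝 0) := by
  have h := tendsto_lintegral_of_dominated_convergence' (μ := μ)
    (F := fun n : ℕ => fun x => ENNReal.ofReal (cutI ((n : ℝ) + 2) (r x) * F x)) (f := fun _ => 0)
    (fun x => ENNReal.ofReal (F x)) (fun n => ?_) (fun n => Eventually.of_forall fun x =>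
      ofReal_mul_le_of_le_one cutI_nonneg cutI_le_one) hfin ?_
  · simpa using h
  · refine (AEMeasurable.mul ?_ hF).ennreal_ofReal
    refine (Measurable.ite ?_ measurable_const measurable_const).aemeasurable
    exact (measurableSet_le hr measurable_const).union (measurableSet_le measurable_const hr)
  · filter_upwards [hr0] with x hx
    refine tendsto_const_nhds.congr' ?_
    filter_upwards [eventually_cutP_eq_one hx] with n hn
    rw [hn.2, zero_mul, ENNReal.ofReal_zero]

end Fatou

/-! ### The abstract energy estimate -/

/-- Integrated form of a divergence inequality for a current that is `C¹` away from the spatial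
origin, with a possibly signed source `f`. -/
theorem energy_estimate (hT : 0 < T) (hτ : τ ∈ Icc 0 T) {P : Fin 4 → SpaceTime → ℝ}
    (hP : ∀ α, C1Off T (P α)) {f B : SpaceTime → ℝ} (hf : ContOff T f) (hB : ContOff T B)
    (hB0 : ∀ z ∈ slab T, z.2 ≠ 0 → 0 ≤ B z) {E : E3 → ℝ} (hE : ContinuousOn E {x | x ≠ 0})
    (hE0 : ∀ x, x ≠ 0 → 0 ≤ E x) {D H F : SpaceTime → ℝ} {G K : E3 → ℝ}
    (hdiv : ∀ z ∈ slab T, z.2 ≠ 0 → B z + ∑ α, pd T α (P α) z - f z ≤ D z)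
    (hEτ : ∀ x, x ≠ 0 → E x - P 0 (τ, x) ≤ K x) (h0 : ∀ x, x ≠ 0 → P 0 (0, x) ≤ G x)
    (hflux : ∀ z ∈ slab T, z.2 ≠ 0 → |radialFlux P z| ≤ ‖z.2‖ * (H z + F z))
    (hFm : AEMeasurable F (volume.restrict (slab T)))
    (hF : ∫⁻ z in slab T, ENNReal.ofReal (F z) ≠ ∞)
    (hint : ∀ R, IntegrableOn f (Icc (0 : ℝ) τ ×ˢ Metric.ball (0 : E3) R)) :
    ∀ Q, Q = (∫⁻ x, ENNReal.ofReal (G x)) + (∫⁻ x, ENNReal.ofReal (K x)) + absIntegral τ f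
        + (∫⁻ z in slab τ, ENNReal.ofReal (D z)) + 6 * ∫⁻ z in slab τ, ENNReal.ofReal (H z) →
      ∫⁻ x, ENNReal.ofReal (E x) ≤ Q ∧ ∫⁻ z in slab τ, ENNReal.ofReal (B z) ≤ Q := by
  intro Q hQ
  have hsub := slab_subset hτ.2
  have hτT : τ ≤ T := hτ.2
  have h0T : (0 : ℝ) ∈ Icc 0 T := ⟨le_rfl, hT.le⟩
  have hae := ae_slab_ne_zero τ
  -- The error made by the cutoff on the integrable part F of the flux; the factor 6 is the one in
  -- `abs_cutD_mul_le`.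
  set e : ℕ → ℝ≥0∞ := fun n =>
    6 * ∫⁻ z in slab τ, ENNReal.ofReal (cutI ((n : ℝ) + 2) ‖z.2‖ * F z) with he
  have he0 : Tendsto e atTop (𝓝 0) := by
    have hr0 : ∀ᵐ z ∂(volume.restrict (slab τ)), 0 < ‖(z : SpaceTime).2‖ := by
      filter_upwards [hae] with z hz using by simpa using hz.2
    have := tendsto_lintegral_cutI (hFm.mono_measure (Measure.restrict_mono hsub le_rfl))
      (by fun_prop : Measurable fun z : SpaceTime => ‖z.2‖) hr0
      (ne_top_of_le_ne_top hF (lintegral_mono_set hsub))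
    simpa using ENNReal.Tendsto.const_mul (a := 6) this (Or.inr (by norm_num))
  have key : ∀ n : ℕ, (∫⁻ x, ENNReal.ofReal (cutP ((n : ℝ) + 2) ‖x‖ * E x))
      + (∫⁻ z in slab τ, ENNReal.ofReal (cutP ((n : ℝ) + 2) ‖z.2‖ * B z))
      ≤ (∫⁻ x, ENNReal.ofReal (G x)) + (∫⁻ x, ENNReal.ofReal (K x))
        + ENNReal.ofReal (∫ z in slab τ, cutP ((n : ℝ) + 2) ‖z.2‖ * f z)
        + (∫⁻ z in slab τ, ENNReal.ofReal (D z)) + (6 * (∫⁻ z in slab τ, ENNReal.ofReal (H z))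
        + e n) := by
    intro n
    have hL : (2 : ℝ) ≤ (n : ℝ) + 2 := by linarith [n.cast_nonneg (α := ℝ)]
    simp only [he]
    generalize (n : ℝ) + 2 = L at hL
    have hc0 : ∀ {r : ℝ}, 0 ≤ r → 0 ≤ cutP L r := fun hr => cutP_nonneg hL hr
    have iE := integrable_cut_slice hE hL
    have iP := integrable_cut_slice ((hP 0).contOff.continuousOn_slice hτ) hL
    have iP0 := integrable_cut_slice ((hP 0).contOff.continuousOn_slice h0T) hL
    have iB := hB.integrableOn_cut hL hτT
    have if' := hf.integrableOn_cut hL hτT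
    have iD := (ContOff.sum fun α (_ : α ∈ Finset.univ) =>
      (hP α).contOff_pd hT α).integrableOn_cut hL hτT
    have hRF : ContOff T (radialFlux P) := ContOff.sum fun i _ =>
      ContOff.mul (fun z _ hx => ContinuousAt.continuousWithinAt
        (ContinuousAt.div (by fun_prop) (by fun_prop) (by simpa using hx))) (hP i.succ).contOff
    have iR := hRF.integrableOn_cutD hL hτT
    have hdivI := integral_div_cut hT hτ hP hL
    rw [integral_add iD iR, integral_sub iP iP0] at hdivI
    have e1 : ∫ x, (cutP L ‖x‖ * (E x - P 0 (τ, x)))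
        = (∫ x, cutP L ‖x‖ * E x) - ∫ x, cutP L ‖x‖ * P 0 (τ, x) := by
      rw [← integral_sub iE iP]; simp only [mul_sub]
    have e2 : ∫ z in slab τ, (cutP L ‖z.2‖ * (B z + ∑ α, pd T α (P α) z - f z))
        = (∫ z in slab τ, cutP L ‖z.2‖ * B z)
          + (∫ z in slab τ, cutP L ‖z.2‖ * ∑ α, pd T α (P α) z)
          - ∫ z in slab τ, cutP L ‖z.2‖ * f z := by
      have hBD : Integrable (fun z => cutP L ‖z.2‖ * B z + cutP L ‖z.2‖ * ∑ α, pd T α (P α) z)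
        (volume.restrict (slab τ)) := iB.add iD
      rw [← integral_add iB iD, ← integral_sub hBD if']
      refine integral_congr_ae (Eventually.of_forall fun z => ?_)
      ring
    -- The energy balance in a form where every term on the right is bounded above by one of the
    -- hypotheses.
    have e3 : (∫ x, cutP L ‖x‖ * E x) + (∫ z in slab τ, cutP L ‖z.2‖ * B z)
        = (∫ x, cutP L ‖x‖ * P 0 (0, x)) + (∫ x, (cutP L ‖x‖ * (E x - P 0 (τ, x))))
          + (∫ z in slab τ, cutP L ‖z.2‖ * f z)
          + (∫ z in slab τ, (cutP L ‖z.2‖ * (B z + ∑ α, pd T α (P α) z - f z)))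
          + ∫ z in slab τ, cutD L ‖z.2‖ * radialFlux P z := by
      linarith
    have nE : 0 ≤ᵐ[volume] fun x => cutP L ‖x‖ * E x := by
      filter_upwards [ae_ne_zero] with x hx
      exact mul_nonneg (hc0 (norm_nonneg _)) (hE0 x hx)
    have nB : 0 ≤ᵐ[volume.restrict (slab τ)] fun z => cutP L ‖z.2‖ * B z := by
      filter_upwards [hae] with z hz
      exact mul_nonneg (hc0 (norm_nonneg _)) (hB0 z (hsub hz.1) hz.2)
    rw [← ofReal_integral_eq_lintegral_ofReal iE nE, ← ofReal_integral_eq_lintegral_ofReal iB nB,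
      ← ENNReal.ofReal_add (integral_nonneg_of_ae nE) (integral_nonneg_of_ae nB), e3]
    refine ENNReal.ofReal_add_le.trans (add_le_add (ENNReal.ofReal_add_le.trans (add_le_add
      (ENNReal.ofReal_add_le.trans (add_le_add (ENNReal.ofReal_add_le.trans
        (add_le_add ?_ ?_)) le_rfl)) ?_)) ?_)
    · refine (ofReal_integral_le_lintegral _).trans (lintegral_mono_ae ?_)
      filter_upwards [ae_ne_zero] with x hx
      exact (ofReal_mul_le_of_le_one (hc0 (norm_nonneg _)) (cutP_le_one _ _)).trans
        (ENNReal.ofReal_le_ofReal (h0 x hx))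
    · refine (ofReal_integral_le_lintegral _).trans (lintegral_mono_ae ?_)
      filter_upwards [ae_ne_zero] with x hx
      exact (ofReal_mul_le_of_le_one (hc0 (norm_nonneg _)) (cutP_le_one _ _)).trans
        (ENNReal.ofReal_le_ofReal (hEτ x hx))
    · refine (ofReal_integral_le_lintegral _).trans (lintegral_mono_ae ?_)
      filter_upwards [hae] with z hz
      exact (ofReal_mul_le_of_le_one (hc0 (norm_nonneg _)) (cutP_le_one _ _)).trans
        (ENNReal.ofReal_le_ofReal (hdiv z (hsub hz.1) hz.2))
    · refine (ofReal_integral_le_lintegral _).trans ?_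
      -- The indicator is kept on F, where it gives a vanishing error, and dropped on H, whose
      -- integral need not be finite.
      have h6 : ∀ᵐ z ∂(volume.restrict (slab τ)),
          ENNReal.ofReal (cutD L ‖z.2‖ * radialFlux P z)
            ≤ 6 * ENNReal.ofReal (cutI L ‖z.2‖ * F z) + 6 * ENNReal.ofReal (H z) := by
        filter_upwards [hae] with z hz
        have hr : 0 < ‖z.2‖ := by simpa using hz.2
        have hfl := hflux z (hsub hz.1) hz.2
        -- H and F are not individually signed; the flux bound with r > 0 forces their sum to be
        -- nonnegative.
        have hHF : 0 ≤ H z + F z := by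
          by_contra! h
          nlinarith [abs_nonneg (radialFlux P z)]
        have h7 : cutD L ‖z.2‖ * radialFlux P z
            ≤ 6 * (cutI L ‖z.2‖ * F z) + 6 * (cutI L ‖z.2‖ * H z) := by
          calc cutD L ‖z.2‖ * radialFlux P z ≤ |cutD L ‖z.2‖| * |radialFlux P z| := by
                rw [← abs_mul]; exact le_abs_self _
            _ ≤ |cutD L ‖z.2‖| * (‖z.2‖ * (H z + F z)) := by gcongr
            _ = |cutD L ‖z.2‖| * ‖z.2‖ * (H z + F z) := by ring
            _ ≤ 6 * cutI L ‖z.2‖ * (H z + F z) := by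
                exact mul_le_mul_of_nonneg_right (abs_cutD_mul_le hL hr.le) hHF
            _ = _ := by ring
        refine (ENNReal.ofReal_le_ofReal h7).trans (ENNReal.ofReal_add_le.trans ?_)
        have h8 : ENNReal.ofReal 6 = 6 := by norm_num
        rw [ENNReal.ofReal_mul (by norm_num), ENNReal.ofReal_mul (p := 6) (by norm_num), h8]
        exact add_le_add le_rfl (mul_le_mul_right (ofReal_mul_le_of_le_one cutI_nonneg cutI_le_one) _)
      refine (lintegral_mono_ae h6).trans ?_
      have hm : AEMeasurable (fun z : SpaceTime => 6 * ENNReal.ofReal (cutI L ‖z.2‖ * F z))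
          (volume.restrict (slab τ)) := by
        refine AEMeasurable.const_mul (AEMeasurable.ennreal_ofReal (AEMeasurable.mul ?_
          (hFm.mono_measure (Measure.restrict_mono hsub le_rfl)))) _
        refine (Measurable.ite ?_ measurable_const measurable_const).aemeasurable
        have hn : Measurable fun z : SpaceTime => ‖z.2‖ := by fun_prop
        exact (measurableSet_le hn measurable_const).union (measurableSet_le measurable_const hn)
      rw [lintegral_add_left' hm, lintegral_const_mul' _ _ (by norm_num),
        lintegral_const_mul' _ _ (by norm_num), add_comm]
  have hQ' : ∀ a b : ℝ≥0∞, absIntegral τ f < a → 0 < b →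
      ∀ᶠ n : ℕ in atTop, (∫⁻ x, ENNReal.ofReal (cutP ((n : ℝ) + 2) ‖x‖ * E x))
      + (∫⁻ z in slab τ, ENNReal.ofReal (cutP ((n : ℝ) + 2) ‖z.2‖ * B z))
      ≤ ((∫⁻ x, ENNReal.ofReal (G x)) + (∫⁻ x, ENNReal.ofReal (K x)) + (a + b)
        + (∫⁻ z in slab τ, ENNReal.ofReal (D z)) + 6 * ∫⁻ z in slab τ, ENNReal.ofReal (H z))
        + e n := by
    intro a b ha hb
    filter_upwards [eventually_ofReal_integral_cut_le (hf.mono hτT) hint ha hb] with n hn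
    refine (key n).trans ?_
    rw [← add_assoc]
    gcongr
  -- A strict majorant of the limsup and an extra b > 0 were needed above; with ε/2 for each excess,
  -- ε → 0 removes them.
  have hfin : ∀ X : ℝ≥0∞, (∀ a b : ℝ≥0∞, absIntegral τ f < a → 0 < b →
      X ≤ (∫⁻ x, ENNReal.ofReal (G x)) + (∫⁻ x, ENNReal.ofReal (K x)) + (a + b)
        + (∫⁻ z in slab τ, ENNReal.ofReal (D z)) + 6 * ∫⁻ z in slab τ, ENNReal.ofReal (H z)) →
      X ≤ Q := by
    intro X hX
    rw [hQ]
    rcases eq_or_ne (absIntegral τ f) ∞ with hA | hA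
    · simp [hA]
    refine ENNReal.le_of_forall_pos_le_add fun ε hε _ => ?_
    have hε2 : (0 : ℝ≥0∞) < ((ε / 2 : ℝ≥0) : ℝ≥0∞) := by
      rw [ENNReal.coe_pos]; positivity
    refine (hX (absIntegral τ f + (ε / 2 : ℝ≥0)) (ε / 2 : ℝ≥0)
      (ENNReal.lt_add_right hA hε2.ne') hε2).trans (le_of_eq ?_)
    rw [add_assoc (absIntegral τ f), ← ENNReal.coe_add, add_halves]
    ring
  refine ⟨hfin _ fun a b ha hb => ?_, hfin _ fun a b ha hb => ?_⟩
  · refine lintegral_le_of_cut (aemeasurable_of_continuousOn_ne hE) measurable_norm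
      (ae_ne_zero.mono fun x hx => by simpa using hx) he0 ?_
    filter_upwards [hQ' a b ha hb] with n hn using le_self_add.trans hn
  · refine lintegral_le_of_cut (hB.mono hτT).aemeasurable
      (by fun_prop : Measurable fun z : SpaceTime => ‖z.2‖)
      (hae.mono fun z hz => by simpa using hz.2) he0 ?_
    filter_upwards [hQ' a b ha hb] with n hn using le_add_self.trans hn

/-! ### The ghost weight -/

section Weight

variable {U : ℝ}

/-- The derivative of `sig U`. -/
def sigD (U s : ℝ) : ℝ := U / (U + |s|) ^ 2

/-- The modulus is not differentiable at 0, but there the difference quotient of σ_U is 1/(U + |s|),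
which is continuous. -/
theorem hasDerivAt_sig (hU : 0 < U) (s : ℝ) : HasDerivAt (sig U) (sigD U s) s := by
  have hp : U + |s| ≠ 0 := by positivity
  rcases lt_trichotomy s 0 with hs | rfl | hs
  · refine ((hasDerivAt_id s).div ((hasDerivAt_abs_neg hs).const_add U) hp).congr_deriv ?_
    simp only [sigD, id, abs_of_neg hs]; ring
  · rw [hasDerivAt_iff_tendsto_slope]
    have h1 : Tendsto (fun s : ℝ => (U + |s|)⁻¹) (𝓝[≠] 0) (𝓝 (sigD U 0)) := by
      have h2 : ContinuousAt (fun s : ℝ => (U + |s|)⁻¹) 0 :=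
        ContinuousAt.inv₀ (by fun_prop) hp
      have h3 : sigD U 0 = (U + |0|)⁻¹ := by simp [sigD]; field_simp
      rw [h3]
      exact h2.tendsto.mono_left nhdsWithin_le_nhds
    refine h1.congr' ?_
    filter_upwards [self_mem_nhdsWithin] with y hy
    have hy : y ≠ 0 := hy
    have : U + |y| ≠ 0 := by positivity
    simp only [slope, sig, vsub_eq_sub, sub_zero, smul_eq_mul, zero_div]
    field_simp
  · refine ((hasDerivAt_id s).div ((hasDerivAt_abs_pos hs).const_add U) hp).congr_deriv ?_
    simp only [sigD, id, abs_of_pos hs]; ring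

theorem continuous_sigD (hU : 0 < U) : Continuous (sigD U) :=
  Continuous.div continuous_const (by fun_prop) fun s => by positivity

theorem sigD_nonneg (hU : 0 < U) (s : ℝ) : 0 ≤ sigD U s := by unfold sigD; positivity

/-- U (3 + |s|) ≤ 3 (U + |s|)² when U ≥ 1. The bound is uniform in U, so the error from the weight
is one fixed integral. -/
theorem sigD_le (hU : 1 ≤ U) (s : ℝ) : sigD U s ≤ 3 * (jb s)⁻¹ := by
  have hs := abs_nonneg s
  rw [sigD, jb, ← div_eq_mul_inv, div_le_div_iff₀ (by positivity) (by positivity)]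
  nlinarith

theorem abs_sig_le (hU : 0 < U) (s : ℝ) : |sig U s| ≤ 1 := by
  have hs := abs_nonneg s
  rw [sig, abs_div, abs_of_pos (by positivity : 0 < U + |s|), div_le_one (by positivity)]
  linarith

/-- The ghost weight. -/
def ghost (U s : ℝ) : ℝ := Real.exp (-sig U s)

theorem hasDerivAt_ghost (hU : 0 < U) (s : ℝ) :
    HasDerivAt (ghost U) (-(sigD U s * ghost U s)) s :=
  (hasDerivAt_sig hU s).neg.exp.congr_deriv (by simp only [ghost, Pi.neg_apply]; ring)

theorem ghost_pos (U s : ℝ) : 0 < ghost U s := Real.exp_pos _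

theorem ghost_le (hU : 0 < U) (s : ℝ) : ghost U s ≤ 3 := by
  have h1 : -sig U s ≤ 1 := by linarith [(abs_le.1 (abs_sig_le hU s)).1]
  have h2 := Real.exp_le_exp.2 h1
  have h3 := Real.exp_one_lt_d9
  unfold ghost
  linarith

theorem le_ghost (hU : 0 < U) (s : ℝ) : 1 / 3 ≤ ghost U s := by
  have h1 : -1 ≤ -sig U s := by linarith [(abs_le.1 (abs_sig_le hU s)).2]
  have h2 := Real.exp_le_exp.2 h1
  have h3 := Real.exp_one_lt_d9
  have h4 : (1 : ℝ) / 3 ≤ Real.exp (-1) := by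
    rw [Real.exp_neg, ← one_div]
    exact one_div_le_one_div_of_le (Real.exp_pos 1) (by linarith)
  unfold ghost
  linarith

theorem contDiff_of_hasDerivAt {f f' : ℝ → ℝ} (h : ∀ s, HasDerivAt f (f' s) s)
    (hc : Continuous f') : ContDiff ℝ 1 f := by
  rw [contDiff_one_iff_deriv]
  refine ⟨fun s => (h s).differentiableAt, ?_⟩
  rwa [show deriv f = f' from funext fun s => (h s).deriv]

theorem contDiff_ghost (hU : 0 < U) : ContDiff ℝ 1 (ghost U) := by
  have hc : Continuous (ghost U) :=
    continuous_iff_continuousAt.2 fun s => (hasDerivAt_ghost hU s).continuousAt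
  exact contDiff_of_hasDerivAt (hasDerivAt_ghost hU) ((continuous_sigD hU).mul hc).neg

end Weight

/-! ### C¹ regularity of the currents off the origin -/

section Regularity

variable {T : ℝ} {w : SpaceTime → ℝ} {f g : SpaceTime → ℝ}

theorem C1Off.mul (hf : C1Off T f) (hg : C1Off T g) : C1Off T fun z => f z * g z :=
  fun z hz hx => (hf z hz hx).mul (hg z hz hx)

theorem C1Off.add (hf : C1Off T f) (hg : C1Off T g) : C1Off T fun z => f z + g z :=
  fun z hz hx => (hf z hz hx).add (hg z hz hx)

theorem C1Off.sub (hf : C1Off T f) (hg : C1Off T g) : C1Off T fun z => f z - g z :=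
  fun z hz hx => (hf z hz hx).sub (hg z hz hx)

theorem C1Off.pow (hf : C1Off T f) (n : ℕ) : C1Off T fun z => f z ^ n :=
  fun z hz hx => (hf z hz hx).pow n

theorem C1Off.sum {ι : Type*} {s : Finset ι} {f : ι → SpaceTime → ℝ}
    (hf : ∀ i ∈ s, C1Off T (f i)) : C1Off T fun z => ∑ i ∈ s, f i z :=
  fun z hz hx => ContDiffWithinAt.sum fun i hi => hf i hi z hz hx

theorem C1Off.const (c : ℝ) : C1Off T fun _ => c := fun _ _ _ => contDiffWithinAt_const

theorem C1Off.of_contDiffOn (hf : ContDiffOn ℝ 1 f (slab T)) : C1Off T f := fun z hz _ => hf z hz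

theorem C1Off.norm : C1Off T fun z => ‖z.2‖ := fun _ _ hx =>
  (contDiffWithinAt_snd).norm ℝ hx

theorem C1Off.inv_norm : C1Off T fun z => ‖z.2‖⁻¹ := fun z hz hx =>
  (C1Off.norm z hz hx).inv (by simpa using hx)

theorem C1Off.outVec (γ : Fin 4) : C1Off T (outVec γ) := by
  have h : ∀ i : Fin 3, C1Off T fun z => z.2 i := fun i =>
    .of_contDiffOn (ContDiff.contDiffOn
      (((EuclideanSpace.proj i : E3 →L[ℝ] ℝ).contDiff).comp contDiff_snd))
  fin_cases γ
  · exact C1Off.norm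
  · exact h 0
  · exact h 1
  · exact h 2

theorem C1Off.retarded {g : ℝ → ℝ} (hg : ContDiff ℝ 1 g) : C1Off T fun z => g (z.1 - ‖z.2‖) :=
  fun z hz hx => hg.contDiffAt.comp_contDiffWithinAt z
    (contDiffWithinAt_fst.sub (C1Off.norm z hz hx))

theorem C1Off.comp_norm {g : ℝ → ℝ} (hg : ∀ r, 0 < r → ContDiffAt ℝ 1 g r) :
    C1Off T fun z => g ‖z.2‖ :=
  fun z hz hx => (hg ‖z.2‖ (by simpa using hx)).comp_contDiffWithinAt z (C1Off.norm z hz hx)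

theorem C1Off.pd (hT : 0 < T) (hw : ContDiffOn ℝ 2 w (slab T)) (α : Fin 4) : C1Off T (pd T α w) :=
  .of_contDiffOn (contDiffOn_pd hT hw (by norm_num) α)

theorem C1Off.of_contDiffOn_two (hw : ContDiffOn ℝ 2 w (slab T)) : C1Off T w :=
  .of_contDiffOn (hw.of_le (by norm_num))

theorem C1Off.outR (hT : 0 < T) (hw : ContDiffOn ℝ 2 w (slab T)) : C1Off T (outR T w) :=
  (C1Off.sum fun γ _ => (C1Off.outVec γ).mul (.pd hT hw γ)).add (.of_contDiffOn_two hw)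

theorem C1Off.xGrad (hT : 0 < T) (hw : ContDiffOn ℝ 2 w (slab T)) : C1Off T (xGrad T w) :=
  C1Off.sum fun i _ => (C1Off.of_contDiffOn (ContDiff.contDiffOn
      (((EuclideanSpace.proj i : E3 →L[ℝ] ℝ).contDiff).comp contDiff_snd))).mul (.pd hT hw i.succ)

theorem C1Off.boxCurrent (hT : 0 < T) (hw : ContDiffOn ℝ 2 w (slab T)) {g : ℝ → ℝ}
    (hg : ContDiff ℝ 1 g) (α : Fin 4) : C1Off T (boxCurrent T g w α) := by
  have hR := C1Off.outR hT hw
  have hS := C1Off.xGrad hT hw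
  have hQ : C1Off T fun z => ∑ i : Fin 3, GhostWave.pd T i.succ w z ^ 2 :=
    C1Off.sum fun i _ => (C1Off.pd hT hw i.succ).pow 2
  have hG : C1Off T fun z => g (z.1 - ‖z.2‖) := .retarded hg
  have hi : C1Off T fun z => ‖z.2‖⁻¹ := .inv_norm
  unfold GhostWave.boxCurrent
  split_ifs
  · exact hG.mul ((C1Off.const _).mul ((((hR.pow 2).mul hi).add (C1Off.norm.mul hQ)).sub
      ((hS.pow 2).mul hi)))
  · exact hG.mul (((C1Off.const _).mul ((C1Off.outVec α).mul ((hQ.sub ((hS.pow 2).mul (hi.pow 2))).sub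
      ((hR.pow 2).mul (hi.pow 2))))).sub (hR.mul ((C1Off.pd hT hw α).sub ((C1Off.outVec α).mul
        (hS.mul (hi.pow 2))))))

theorem C1Off.pertCurrent {M : ℕ} {h : Pert M} {w : Fin M → SpaceTime → ℝ} (hT : 0 < T)
    (hh : Admissible T h) (hw : ∀ I, ContDiffOn ℝ 2 (w I) (slab T)) {g : ℝ → ℝ}
    (hg : ContDiff ℝ 1 g) (α : Fin 4) : C1Off T (pertCurrent T g h w α) := by
  have hG : C1Off T fun z => g (z.1 - ‖z.2‖) := .retarded hg
  have hH := fun I J α β => C1Off.of_contDiffOn (hh.contDiff I J α β)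
  exact ((C1Off.const _).mul ((C1Off.outVec α).mul (hG.mul (C1Off.sum fun I _ => C1Off.sum fun J _ =>
    C1Off.sum fun α _ => C1Off.sum fun β _ => (hH I J α β).mul ((C1Off.pd hT (hw J) β).mul
      (C1Off.pd hT (hw I) α)))))).sub (C1Off.sum fun I _ => C1Off.sum fun J _ => C1Off.sum fun β _ =>
        hG.mul ((hH I J α β).mul ((C1Off.pd hT (hw J) β).mul (C1Off.outR hT (hw I)))))

theorem C1Off.outCurrent {ψ ℓ : ℝ → ℝ} (hw : ContDiffOn ℝ 2 w (slab T)) (hψ : ContDiff ℝ 1 ψ)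
    (hl : ∀ r, 0 < r → ContDiffAt ℝ 1 ℓ r) (α : Fin 4) : C1Off T (outCurrent ψ ℓ w α) :=
  ((C1Off.retarded hψ).mul ((C1Off.comp_norm hl).mul
    (((C1Off.of_contDiffOn_two hw).pow 2).mul .inv_norm))).mul (.outVec α)

end Regularity

/-! ### Densities and radial fluxes of the currents -/

section Fluxes

variable {T : ℝ} {w : SpaceTime → ℝ} {z : SpaceTime}

/-- The energy density `V² + |∇̸w|²` with `V = r⁻¹ (∂_t + ∂_r)(r w)`. -/
def eDen (T : ℝ) (w : SpaceTime → ℝ) (z : SpaceTime) : ℝ :=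
  (outR T w z / ‖z.2‖) ^ 2 + angSq T w z

theorem angSq_nonneg : 0 ≤ angSq T w z := Finset.sum_nonneg fun _ _ => sq_nonneg _

theorem eDen_nonneg : 0 ≤ eDen T w z := add_nonneg (sq_nonneg _) angSq_nonneg

theorem boxCurrent_zero (hx : z.2 ≠ 0) (g : ℝ → ℝ) :
    boxCurrent T g w 0 z = g (z.1 - ‖z.2‖) * (1 / 2 * (‖z.2‖ * eDen T w z)) := by
  have h0 : ‖z.2‖ ≠ 0 := by simpa using hx
  rw [boxCurrent, if_pos rfl, eDen, angSq_eq hx]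
  field_simp
  ring

theorem sum_div_mul (hx : z.2 ≠ 0) : ∑ i : Fin 3, z.2 i / ‖z.2‖ * outVec i.succ z = ‖z.2‖ := by
  have h0 : ‖z.2‖ ≠ 0 := by simpa using hx
  have h2 := norm_sq_eq z.2
  simp only [outVec, Fin.sum_univ_three, Matrix.cons_val, Fin.succ_zero_eq_one,
    Fin.succ_one_eq_two, show (2 : Fin 3).succ = 3 from rfl]
  field_simp
  linarith

/-- The angular energy flows outwards and V² inwards. What matters is that the flux is at most r
times the energy density, a quantity integrable on the slab. -/
theorem radialFlux_boxCurrent (hx : z.2 ≠ 0) (g : ℝ → ℝ) :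
    radialFlux (boxCurrent T g w) z = g (z.1 - ‖z.2‖)
      * (1 / 2 * (‖z.2‖ * (angSq T w z - (outR T w z / ‖z.2‖) ^ 2))) := by
  have h0 : ‖z.2‖ ≠ 0 := by simpa using hx
  have h1 := sum_div_mul hx
  have h2 : ∑ i : Fin 3, z.2 i / ‖z.2‖ * pd T i.succ w z = xGrad T w z / ‖z.2‖ := by
    simp only [xGrad, Finset.sum_div]
    exact Finset.sum_congr rfl fun i _ => by ring
  rw [angSq_eq hx]
  have e : radialFlux (boxCurrent T g w) z = g (z.1 - ‖z.2‖) *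
      (1 / 2 * ((∑ i : Fin 3, pd T i.succ w z ^ 2
      - xGrad T w z ^ 2 * (‖z.2‖⁻¹) ^ 2 - outR T w z ^ 2 * (‖z.2‖⁻¹) ^ 2)
        * ∑ i : Fin 3, z.2 i / ‖z.2‖ * outVec i.succ z)
      - outR T w z * (∑ i : Fin 3, z.2 i / ‖z.2‖ * pd T i.succ w z
        - (xGrad T w z * (‖z.2‖⁻¹) ^ 2) * ∑ i : Fin 3, z.2 i / ‖z.2‖ * outVec i.succ z)) := by
    simp only [radialFlux, boxCurrent, Fin.succ_ne_zero, if_false]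
    simp only [Fin.sum_univ_three]
    ring
  rw [e, h1, h2]
  field_simp
  ring

theorem outCurrent_zero (hx : z.2 ≠ 0) (ψ ℓ : ℝ → ℝ) :
    outCurrent ψ ℓ w 0 z = ψ (z.1 - ‖z.2‖) * (ℓ ‖z.2‖ * w z ^ 2) := by
  have h0 : ‖z.2‖ ≠ 0 := by simpa using hx
  simp only [outCurrent, outVec, Matrix.cons_val]
  field_simp

theorem radialFlux_outCurrent (hx : z.2 ≠ 0) (ψ ℓ : ℝ → ℝ) :
    radialFlux (outCurrent ψ ℓ w) z = ψ (z.1 - ‖z.2‖) * (ℓ ‖z.2‖ * w z ^ 2) := by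
  have h0 : ‖z.2‖ ≠ 0 := by simpa using hx
  have e : radialFlux (outCurrent ψ ℓ w) z = ψ (z.1 - ‖z.2‖) * (ℓ ‖z.2‖ * (w z ^ 2 * ‖z.2‖⁻¹))
      * ∑ i : Fin 3, z.2 i / ‖z.2‖ * outVec i.succ z := by
    simp only [radialFlux, outCurrent, Fin.sum_univ_three]; ring
  rw [e, sum_div_mul hx]
  field_simp

theorem abs_coord_div_le (hx : z.2 ≠ 0) (i : Fin 3) : |z.2 i / ‖z.2‖| ≤ 1 := by
  have h0 : 0 < ‖z.2‖ := by simpa using hx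
  rw [abs_div, abs_norm, div_le_one h0]
  exact EuclideanSpace.norm_eq z.2 ▸ PiLp.norm_apply_le z.2 i

variable {M : ℕ} {h : Pert M} {v : Fin M → SpaceTime → ℝ} {D O : ℝ}

theorem hAbs_nonneg (h : Pert M) (z : SpaceTime) : 0 ≤ hAbs h z :=
  Finset.sum_nonneg fun _ _ => Finset.sum_nonneg fun _ _ => Finset.sum_nonneg fun _ _ =>
    Finset.sum_nonneg fun _ _ => abs_nonneg _

theorem abs_pertForm_le (hD : ∀ I α, |pd T α (v I) z| ≤ D) (hD0 : 0 ≤ D) :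
    |pertForm T h v z| ≤ hAbs h z * D ^ 2 := by
  simp only [pertForm, hAbs, Finset.sum_mul]
  refine (Finset.abs_sum_le_sum_abs _ _).trans (Finset.sum_le_sum fun I _ => ?_)
  refine (Finset.abs_sum_le_sum_abs _ _).trans (Finset.sum_le_sum fun J _ => ?_)
  refine (Finset.abs_sum_le_sum_abs _ _).trans (Finset.sum_le_sum fun α _ => ?_)
  refine (Finset.abs_sum_le_sum_abs _ _).trans (Finset.sum_le_sum fun β _ => ?_)
  rw [abs_mul, abs_mul, sq]
  have := hD J β
  have := hD I α
  gcongr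

theorem abs_pertTerm_le {G : ℝ} (hG : 0 ≤ G) (hD : ∀ I α, |pd T α (v I) z| ≤ D) (hD0 : 0 ≤ D)
    (hO : ∀ I, |outR T (v I) z| ≤ O) (α : Fin 4) :
    |∑ I, ∑ J, ∑ β, G * (h I J α β z * (pd T β (v J) z * outR T (v I) z))|
      ≤ G * ((∑ I, ∑ J, ∑ β, |h I J α β z|) * (D * O)) := by
  simp only [Finset.sum_mul, Finset.mul_sum]
  refine (Finset.abs_sum_le_sum_abs _ _).trans (Finset.sum_le_sum fun I _ => ?_)
  refine (Finset.abs_sum_le_sum_abs _ _).trans (Finset.sum_le_sum fun J _ => ?_)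
  refine (Finset.abs_sum_le_sum_abs _ _).trans (Finset.sum_le_sum fun β _ => ?_)
  rw [abs_mul, abs_mul, abs_mul, abs_of_nonneg hG]
  have := hD J β
  have := hO I
  gcongr

theorem sum_abs_eq_hAbs : ∑ α, ∑ I, ∑ J, ∑ β, |h I J α β z| = hAbs h z := by
  rw [hAbs, Finset.sum_comm]
  exact Finset.sum_congr rfl fun I _ => Finset.sum_comm

theorem abs_pertCurrent_zero_le {g : ℝ → ℝ} (hg : 0 ≤ g (z.1 - ‖z.2‖))
    (hD : ∀ I α, |pd T α (v I) z| ≤ D) (hD0 : 0 ≤ D) (hO : ∀ I, |outR T (v I) z| ≤ O)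
    (hO0 : 0 ≤ O) :
    |pertCurrent T g h v 0 z| ≤ g (z.1 - ‖z.2‖)
      * (1 / 2 * (‖z.2‖ * (hAbs h z * D ^ 2)) + hAbs h z * (D * O)) := by
  have h1 := abs_pertTerm_le (h := h) hg hD hD0 hO 0
  have h2 := abs_pertForm_le (h := h) hD hD0
  have h3 : ∑ I, ∑ J, ∑ β, |h I J 0 β z| ≤ hAbs h z := by
    rw [← sum_abs_eq_hAbs]
    exact Finset.single_le_sum (f := fun α => ∑ I, ∑ J, ∑ β, |h I J α β z|)
      (fun α _ => Finset.sum_nonneg fun _ _ => Finset.sum_nonneg fun _ _ =>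
        Finset.sum_nonneg fun _ _ => abs_nonneg _) (Finset.mem_univ 0)
  rw [pertCurrent, mul_add]
  refine (abs_sub _ _).trans (add_le_add ?_ (h1.trans (by gcongr)))
  rw [abs_mul, abs_mul, abs_mul, abs_of_nonneg hg, abs_of_nonneg (by norm_num : (0 : ℝ) ≤ 1 / 2)]
  calc 1 / 2 * (|outVec 0 z| * (g (z.1 - ‖z.2‖) * |pertForm T h v z|))
      ≤ 1 / 2 * (‖z.2‖ * (g (z.1 - ‖z.2‖) * (hAbs h z * D ^ 2))) := by
        gcongr
        simp [outVec]
    _ = _ := by ring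

theorem abs_radialFlux_pertCurrent_le (hx : z.2 ≠ 0) {g : ℝ → ℝ} (hg : 0 ≤ g (z.1 - ‖z.2‖))
    (hD : ∀ I α, |pd T α (v I) z| ≤ D) (hD0 : 0 ≤ D) (hO : ∀ I, |outR T (v I) z| ≤ O)
    (hO0 : 0 ≤ O) :
    |radialFlux (pertCurrent T g h v) z| ≤ g (z.1 - ‖z.2‖)
      * (1 / 2 * (‖z.2‖ * (hAbs h z * D ^ 2)) + hAbs h z * (D * O)) := by
  have h1 := abs_pertTerm_le (h := h) hg hD hD0 hO
  have h2 := abs_pertForm_le (h := h) hD hD0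
  have e : radialFlux (pertCurrent T g h v) z = 1 / 2 * (g (z.1 - ‖z.2‖) * pertForm T h v z)
      * (∑ i : Fin 3, z.2 i / ‖z.2‖ * outVec i.succ z)
      - ∑ i : Fin 3, z.2 i / ‖z.2‖ * ∑ I, ∑ J, ∑ β, g (z.1 - ‖z.2‖)
        * (h I J i.succ β z * (pd T β (v J) z * outR T (v I) z)) := by
    simp only [radialFlux, pertCurrent, Fin.sum_univ_three]
    ring
  have h3 : ∑ i : Fin 3, ∑ I, ∑ J, ∑ β, |h I J i.succ β z| ≤ hAbs h z := by
    rw [← sum_abs_eq_hAbs, Fin.sum_univ_succ (fun α => ∑ I, ∑ J, ∑ β, |h I J α β z|)]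
    exact le_add_of_nonneg_left (Finset.sum_nonneg fun _ _ => Finset.sum_nonneg fun _ _ =>
        Finset.sum_nonneg fun _ _ => abs_nonneg _)
  rw [e, sum_div_mul hx, mul_add]
  refine (abs_sub _ _).trans (add_le_add ?_ ?_)
  · rw [abs_mul, abs_mul, abs_mul, abs_of_nonneg hg, abs_of_nonneg (by norm_num : (0 : ℝ) ≤ 1 / 2),
      abs_norm]
    calc 1 / 2 * (g (z.1 - ‖z.2‖) * |pertForm T h v z|) * ‖z.2‖
        ≤ 1 / 2 * (g (z.1 - ‖z.2‖) * (hAbs h z * D ^ 2)) * ‖z.2‖ := by gcongr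
      _ = _ := by ring
  · refine (Finset.abs_sum_le_sum_abs _ _).trans ?_
    calc _ ≤ ∑ i : Fin 3, g (z.1 - ‖z.2‖) * ((∑ I, ∑ J, ∑ β, |h I J i.succ β z|) * (D * O)) := by
          refine Finset.sum_le_sum fun i _ => ?_
          rw [abs_mul]
          exact (mul_le_of_le_one_left (abs_nonneg _) (abs_coord_div_le hx i)).trans (h1 i.succ)
      _ = g (z.1 - ‖z.2‖) * ((∑ i : Fin 3, ∑ I, ∑ J, ∑ β, |h I J i.succ β z|) * (D * O)) := by
          rw [← Finset.mul_sum, ← Finset.sum_mul]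
      _ ≤ _ := by gcongr

end Fluxes

/-! ### The ghost weight estimate for a finite family -/

section MainEstimate

variable {T τ U : ℝ} {ι : Type*} {s : Finset ι} {M : ℕ} {w : ι → Fin M → SpaceTime → ℝ}
  {h : Pert M} {Zf Of Af : SpaceTime → ℝ}

/-- The sum of the energy densities of a finite family. -/
def eSum (T : ℝ) (s : Finset ι) (w : ι → Fin M → SpaceTime → ℝ) (z : SpaceTime) : ℝ :=
  ∑ μ ∈ s, ∑ I, eDen T (w μ I) z

/-- The sum of the squares of `r⁻¹ (∂_t + ∂_r)(r w)` over a finite family. -/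
def vSum (T : ℝ) (s : Finset ι) (w : ι → Fin M → SpaceTime → ℝ) (z : SpaceTime) : ℝ :=
  ∑ μ ∈ s, ∑ I, (outR T (w μ I) z / ‖z.2‖) ^ 2

/-- The product of `□_h w` with the multiplier. -/
def pairSum (T : ℝ) (s : Finset ι) (h : Pert M) (w : ι → Fin M → SpaceTime → ℝ) (U : ℝ)
    (z : SpaceTime) : ℝ :=
  ghost U (z.1 - ‖z.2‖) * ∑ μ ∈ s, ∑ I,
    (pd T 0 (pd T 0 (w μ I)) z - ∑ i : Fin 3, pd T i.succ (pd T i.succ (w μ I)) z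
      - ∑ J, ∑ α, ∑ β, h I J α β z * pd T α (pd T β (w μ J)) z) * outR T (w μ I) z

/-- The energy current of the perturbed wave operator, summed over a finite family. -/
def mainCurrent (T : ℝ) (s : Finset ι) (h : Pert M) (w : ι → Fin M → SpaceTime → ℝ) (U : ℝ)
    (α : Fin 4) (z : SpaceTime) : ℝ :=
  ∑ μ ∈ s, ((∑ I, boxCurrent T (ghost U) (w μ I) α z) + pertCurrent T (ghost U) h (w μ) α z)

theorem eSum_nonneg (z : SpaceTime) : 0 ≤ eSum T s w z :=
  Finset.sum_nonneg fun _ _ => Finset.sum_nonneg fun _ _ => eDen_nonneg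

theorem vSum_nonneg (z : SpaceTime) : 0 ≤ vSum T s w z :=
  Finset.sum_nonneg fun _ _ => Finset.sum_nonneg fun _ _ => sq_nonneg _

theorem C1Off.mainCurrent (hT : 0 < T) (hU : 0 < U) (hh : Admissible T h)
    (hw : ∀ μ ∈ s, ∀ I, ContDiffOn ℝ 2 (w μ I) (slab T)) (α : Fin 4) :
    C1Off T (mainCurrent T s h w U α) :=
  C1Off.sum fun μ hμ => (C1Off.sum fun I _ => .boxCurrent hT (hw μ hμ I) (contDiff_ghost hU) α).add
    (.pertCurrent hT hh (hw μ hμ) (contDiff_ghost hU) α)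

theorem abs_outR_le {v : SpaceTime → ℝ} {z : SpaceTime} {D A : ℝ} (hD : ∀ α, |pd T α v z| ≤ D)
    (hA : |v z| ≤ A) : |outR T v z| ≤ 4 * ‖z.2‖ * D + A := by
  have hx1 : ∀ i, |z.2 i| ≤ ‖z.2‖ := fun i => EuclideanSpace.norm_eq z.2 ▸ PiLp.norm_apply_le z.2 i
  have h1 : ∀ γ, |outVec γ z| ≤ ‖z.2‖ := fun γ => by
    fin_cases γ
    · simp [outVec]
    · exact hx1 0
    · exact hx1 1
    · exact hx1 2
  refine (abs_add_le _ _).trans (add_le_add ?_ hA)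
  calc _ ≤ ∑ γ, |outVec γ z * pd T γ v z| := Finset.abs_sum_le_sum_abs _ _
    _ ≤ ∑ _γ : Fin 4, ‖z.2‖ * D := by
        refine Finset.sum_le_sum fun γ _ => ?_
        rw [abs_mul]
        exact mul_le_mul (h1 γ) (hD γ) (abs_nonneg _) (norm_nonneg _)
    _ = _ := by simp; ring

/-- Sum of the flat and perturbed identities; the derivative of the weight is -σ_U' times the
weight, so both bulk terms carry the favourable sign. -/
theorem mainCurrent_identity (hT : 0 < T) (hU : 0 < U) (hh : Admissible T h)
    (hw : ∀ μ ∈ s, ∀ I, ContDiffOn ℝ 2 (w μ I) (slab T)) {z : SpaceTime} (hz : z ∈ slab T)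
    (hx : z.2 ≠ 0) :
    ∑ α, pd T α (mainCurrent T s h w U α) z = pairSum T s h w U z
      - ghost U (z.1 - ‖z.2‖) * (1 / 2 * eSum T s w z
        + sigD U (z.1 - ‖z.2‖) * ‖z.2‖ * vSum T s w z)
      + ∑ μ ∈ s, ∑ I, ∑ J, ∑ α, ∑ β, pertRem T (ghost U (z.1 - ‖z.2‖))
        (retardedD (-(sigD U (z.1 - ‖z.2‖) * ghost U (z.1 - ‖z.2‖))) z) h (w μ) z I J α β := by
  have hg := hasDerivAt_ghost hU (z.1 - ‖z.2‖)
  have hcd := contDiff_ghost hU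
  have e1 : ∀ α, pd T α (mainCurrent T s h w U α) z
      = ∑ μ ∈ s, ((∑ I, pd T α (boxCurrent T (ghost U) (w μ I) α) z)
        + pd T α (pertCurrent T (ghost U) h (w μ) α) z) := fun α => by
    have hH : HasPD T (mainCurrent T s h w U α) z (fun α' => ∑ μ ∈ s,
        ((∑ I, pd T α' (boxCurrent T (ghost U) (w μ I) α) z)
          + pd T α' (pertCurrent T (ghost U) h (w μ) α) z)) := by
      refine HasPD.sum fun μ hμ => (HasPD.sum fun I _ => ?_).add ?_
      · exact .of_differentiableWithinAt (((C1Off.boxCurrent hT (hw μ hμ I) hcd α) z hz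
          hx).differentiableWithinAt (by norm_num))
      · exact .of_differentiableWithinAt (((C1Off.pertCurrent hT hh (hw μ hμ) hcd α) z hz
          hx).differentiableWithinAt (by norm_num))
    exact hH.pd_eq hT hz α
  simp only [e1]
  rw [Finset.sum_comm]
  rw [pairSum, eSum, vSum]
  simp only [Finset.mul_sum, ← Finset.sum_sub_distrib, ← Finset.sum_add_distrib]
  refine Finset.sum_congr rfl fun μ hμ => ?_
  rw [Finset.sum_add_distrib, Finset.sum_comm, pert_identity hT hh (hw μ hμ) hz hx hg]
  simp only [box_identity hT (hw μ hμ _) hz hx hg]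
  rw [Finset.mul_sum, ← Finset.sum_neg_distrib, ← add_assoc, ← Finset.sum_add_distrib,
    ← Finset.sum_add_distrib]
  refine Finset.sum_congr rfl fun I _ => ?_
  simp only [eDen]
  ring

theorem continuousOn_outR (hT : 0 < T) {v : SpaceTime → ℝ} (hv : ContDiffOn ℝ 2 v (slab T)) :
    ContinuousOn (outR T v) (slab T) := by
  have h : ∀ γ, Continuous (outVec γ) := fun γ => by
    fin_cases γ
    · exact continuous_norm.comp continuous_snd
    · exact (EuclideanSpace.proj (0 : Fin 3) : E3 →L[ℝ] ℝ).continuous.comp continuous_snd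
    · exact (EuclideanSpace.proj (1 : Fin 3) : E3 →L[ℝ] ℝ).continuous.comp continuous_snd
    · exact (EuclideanSpace.proj (2 : Fin 3) : E3 →L[ℝ] ℝ).continuous.comp continuous_snd
  exact (continuousOn_finsetSum _ fun γ _ => (h γ).continuousOn.mul
    (contDiffOn_pd hT hv (m := 1) (by norm_num) γ).continuousOn).add hv.continuousOn

theorem continuousOn_pairSum (hT : 0 < T) (hU : 0 < U) (hh : Admissible T h)
    (hw : ∀ μ ∈ s, ∀ I, ContDiffOn ℝ 2 (w μ I) (slab T)) :
    ContinuousOn (pairSum T s h w U) (slab T) := by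
  have h2 : ∀ μ ∈ s, ∀ I α β, ContinuousOn (pd T α (pd T β (w μ I))) (slab T) :=
    fun μ hμ I α β => (contDiffOn_pd hT (contDiffOn_pd hT (hw μ hμ I) (m := 1) (by norm_num) β)
      (m := 0) (by norm_num) α).continuousOn
  refine ContinuousOn.mul ((contDiff_ghost hU).continuous.comp (by fun_prop)).continuousOn
    (continuousOn_finsetSum _ fun μ hμ => continuousOn_finsetSum _ fun I _ => ContinuousOn.mul
      (((h2 μ hμ I 0 0).sub (continuousOn_finsetSum _ fun i _ => h2 μ hμ I i.succ i.succ)).sub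
        (continuousOn_finsetSum _ fun J _ => continuousOn_finsetSum _ fun α _ =>
          continuousOn_finsetSum _ fun β _ => (hh.contDiff I J α β).continuousOn.mul
            (h2 μ hμ J α β))) (continuousOn_outR hT (hw μ hμ I)))

theorem contOff_eDen (hT : 0 < T) {v : SpaceTime → ℝ} (hv : ContDiffOn ℝ 2 v (slab T)) :
    ContOff T (eDen T v) := by
  have hR := (C1Off.outR hT hv).contOff
  have hA : ContOff T (angSq T v) := by
    refine ContOff.sum fun i _ => ContOff.pow ?_ 2
    have hc : ∀ j : Fin 3, ContOff T fun z => z.2 j / ‖z.2‖ := fun j z _ hx =>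
      ContinuousAt.continuousWithinAt
        (ContinuousAt.div (by fun_prop) (by fun_prop) (by simpa using hx))
    have hp := fun j : Fin 3 => (C1Off.pd hT hv j.succ).contOff
    exact (hp i).sub ((hc i).mul (ContOff.sum fun j _ => (hc j).mul (hp j)))
  exact ((hR.mul .inv_norm).pow 2).add hA

theorem contOff_vSum (hT : 0 < T) (hw : ∀ μ ∈ s, ∀ I, ContDiffOn ℝ 2 (w μ I) (slab T)) :
    ContOff T (vSum T s w) :=
  ContOff.sum fun μ hμ => ContOff.sum fun I _ =>
    ((C1Off.outR hT (hw μ hμ I)).contOff.mul .inv_norm).pow 2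

theorem contOff_eSum (hT : 0 < T) (hw : ∀ μ ∈ s, ∀ I, ContDiffOn ℝ 2 (w μ I) (slab T)) :
    ContOff T (eSum T s w) :=
  ContOff.sum fun μ hμ => ContOff.sum fun I _ => contOff_eDen hT (hw μ hμ I)

/-- The energy estimate for the perturbed wave operator with the ghost weight. -/
theorem main_estimate (hT : 0 < T) (hτ : τ ∈ Icc 0 T) (hU : 1 ≤ U) (hh : Admissible T h)
    (hw : ∀ μ ∈ s, ∀ I, ContDiffOn ℝ 2 (w μ I) (slab T))
    (hZ : ∀ z ∈ slab T, z.2 ≠ 0 → ∀ μ ∈ s, ∀ I α, |pd T α (w μ I) z| ≤ Zf z) (hZ0 : ∀ z, 0 ≤ Zf z)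
    (hO : ∀ z ∈ slab T, z.2 ≠ 0 → ∀ μ ∈ s, ∀ I, |outR T (w μ I) z| ≤ Of z) (hO0 : ∀ z, 0 ≤ Of z)
    (hA : ∀ z ∈ slab T, z.2 ≠ 0 → ∀ μ ∈ s, ∀ I, |w μ I z| ≤ Af z) (hA0 : ∀ z, 0 ≤ Af z)
    (hfin : ∫⁻ z in slab T, ENNReal.ofReal (eSum T s w z) ≠ ∞) :
    ∀ Q, Q = (∫⁻ x, ENNReal.ofReal (3 / 2 * (‖x‖ * eSum T s w (0, x))
          + s.card * (14 * (‖x‖ * hAbs h (0, x) * Zf (0, x) * (Zf (0, x) + Af (0, x) / ‖x‖)))))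
        + (∫⁻ x, ENNReal.ofReal
          (s.card * (14 * (‖x‖ * hAbs h (τ, x) * Zf (τ, x) * (Zf (τ, x) + Af (τ, x) / ‖x‖)))))
        + absIntegral τ (pairSum T s h w U)
        + (∫⁻ z in slab τ, ENNReal.ofReal (s.card *
          (3 * (hGrad T h z * (Zf z * Of z)) + 9 * (hAbs h z * (jb (z.1 - ‖z.2‖))⁻¹ * (Zf z * Of z))
            + 14 * ((‖z.2‖ * hOut T h z + hAbs h z) * Zf z ^ 2))))
        + 6 * ∫⁻ z in slab τ, ENNReal.ofReal (s.card *
          (14 * (hAbs h z * Zf z ^ 2) + 3 * (hAbs h z * Zf z * (Af z / ‖z.2‖)))) →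
      ∫⁻ x, ENNReal.ofReal (1 / 6 * (‖x‖ * eSum T s w (τ, x))) ≤ Q ∧
      ∫⁻ z in slab τ, ENNReal.ofReal (1 / 6 * (eSum T s w z
        + sigD U (z.1 - ‖z.2‖) * ‖z.2‖ * vSum T s w z)) ≤ Q := by
  have hU0 : 0 < U := by linarith
  have hpc := continuousOn_pairSum hT hU0 hh hw
  have hgz : ∀ z : SpaceTime, 0 ≤ ghost U (z.1 - ‖z.2‖) := fun z => (ghost_pos _ _).le
  have hg3 : ∀ z : SpaceTime, ghost U (z.1 - ‖z.2‖) ≤ 3 := fun z => ghost_le hU0 _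
  have hg1 : ∀ z : SpaceTime, 1 / 3 ≤ ghost U (z.1 - ‖z.2‖) := fun z => le_ghost hU0 _
  -- R is bounded in two ways: by `Of` in the bulk, where the good derivative matters, and by this
  -- crude bound in boundary and flux terms.
  have hR : ∀ z ∈ slab T, z.2 ≠ 0 → ∀ μ ∈ s, ∀ I,
      |outR T (w μ I) z| ≤ 4 * ‖z.2‖ * Zf z + Af z := fun z hz hx μ hμ I =>
    abs_outR_le (hZ z hz hx μ hμ I) (hA z hz hx μ hμ I)
  have hR0 : ∀ z : SpaceTime, 0 ≤ 4 * ‖z.2‖ * Zf z + Af z := fun z => by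
    have := hZ0 z
    have := hA0 z
    positivity
  -- the boundary terms of the perturbation
  have hq : ∀ z : SpaceTime, z.2 ≠ 0 → ghost U (z.1 - ‖z.2‖)
      * (1 / 2 * (‖z.2‖ * (hAbs h z * Zf z ^ 2)) + hAbs h z * (Zf z * (4 * ‖z.2‖ * Zf z + Af z)))
      ≤ 14 * (‖z.2‖ * hAbs h z * Zf z * (Zf z + Af z / ‖z.2‖)) := fun z hx => by
    have hr : 0 < ‖z.2‖ := by simpa using hx
    have h1 := hZ0 z
    have h2 := hA0 z
    have h3 := hAbs_nonneg h z
    calc _ ≤ 3 * (1 / 2 * (‖z.2‖ * (hAbs h z * Zf z ^ 2))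
          + hAbs h z * (Zf z * (4 * ‖z.2‖ * Zf z + Af z))) := by
          gcongr
          exact hg3 z
      _ = 27 / 2 * (‖z.2‖ * hAbs h z * Zf z ^ 2) + 3 * (hAbs h z * Zf z * Af z) := by ring
      _ ≤ 14 * (‖z.2‖ * hAbs h z * Zf z ^ 2) + 14 * (hAbs h z * Zf z * Af z) := by
          gcongr <;> norm_num
      _ = _ := by field_simp
  have hP0 : ∀ z ∈ slab T, z.2 ≠ 0 → |mainCurrent T s h w U 0 z
      - ghost U (z.1 - ‖z.2‖) * (1 / 2 * (‖z.2‖ * eSum T s w z))|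
      ≤ s.card * (14 * (‖z.2‖ * hAbs h z * Zf z * (Zf z + Af z / ‖z.2‖))) := fun z hz hx => by
    have e : mainCurrent T s h w U 0 z - ghost U (z.1 - ‖z.2‖) * (1 / 2 * (‖z.2‖ * eSum T s w z))
        = ∑ μ ∈ s, pertCurrent T (ghost U) h (w μ) 0 z := by
      simp only [mainCurrent, boxCurrent_zero hx, Finset.sum_add_distrib, eSum, Finset.mul_sum]
      ring
    rw [e]
    refine (Finset.abs_sum_le_sum_abs _ _).trans ?_
    rw [← nsmul_eq_mul]
    refine Finset.sum_le_card_nsmul _ _ _ fun μ hμ => ?_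
    exact (abs_pertCurrent_zero_le (hgz z) (hZ z hz hx μ hμ) (hZ0 z) (hR z hz hx μ hμ)
      (hR0 z)).trans (hq z hx)
  have hcE := contOff_eSum hT hw
  have hcV := contOff_vSum hT hw
  have hcr : ContOff T fun z => ‖z.2‖ := C1Off.norm.contOff
  have hcs : ContOff T fun z => sigD U (z.1 - ‖z.2‖) :=
    .of_continuous ((continuous_sigD hU0).comp (by fun_prop))
  have hB : ContOff T fun z => 1 / 6 * (eSum T s w z
      + sigD U (z.1 - ‖z.2‖) * ‖z.2‖ * vSum T s w z) :=
    (C1Off.const _).contOff.mul (hcE.add ((hcs.mul hcr).mul hcV))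
  have hE : ContinuousOn (fun x => 1 / 6 * (‖x‖ * eSum T s w (τ, x))) {x | x ≠ 0} :=
    ((C1Off.const (1 / 6)).contOff.mul (hcr.mul hcE)).continuousOn_slice hτ
  -- F bounds the flat flux divided by r: weight at most 3, times ½.
  refine energy_estimate hT hτ (C1Off.mainCurrent hT hU0 hh hw) (ContOff.of_continuousOn hpc) hB
    (fun z _ _ => ?_) hE (fun x _ => ?_) (F := fun z => 3 / 2 * eSum T s w z)
    (fun z hz hx => ?_) (fun x hx => ?_) (fun x hx => ?_) (fun z hz hx => ?_) ?_ ?_ (fun R => ?_)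
  · have h1 := eSum_nonneg (T := T) (s := s) (w := w) z
    have h2 := vSum_nonneg (T := T) (s := s) (w := w) z
    have h3 := sigD_nonneg hU0 (z.1 - ‖z.2‖)
    positivity
  · have h1 := eSum_nonneg (T := T) (s := s) (w := w) (τ, x)
    positivity
  · rw [mainCurrent_identity hT hU0 hh hw hz hx]
    have h1 := eSum_nonneg (T := T) (s := s) (w := w) z
    have h2 := vSum_nonneg (T := T) (s := s) (w := w) z
    have h3 := sigD_nonneg hU0 (z.1 - ‖z.2‖)
    -- The weight is at most 3, and |h| |∂w|² occurs with 3 · 3/2 + 3 · 3 = 27/2, rounded up to 14.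
    have hrem : ∑ μ ∈ s, ∑ I, ∑ J, ∑ α, ∑ β, pertRem T (ghost U (z.1 - ‖z.2‖))
        (retardedD (-(sigD U (z.1 - ‖z.2‖) * ghost U (z.1 - ‖z.2‖))) z) h (w μ) z I J α β
        ≤ s.card * (3 * (hGrad T h z * (Zf z * Of z))
          + 9 * (hAbs h z * (jb (z.1 - ‖z.2‖))⁻¹ * (Zf z * Of z))
            + 14 * ((‖z.2‖ * hOut T h z + hAbs h z) * Zf z ^ 2)) := by
      rw [← nsmul_eq_mul]
      refine Finset.sum_le_card_nsmul _ _ _ fun μ hμ => ?_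
      refine (le_abs_self _).trans ((abs_sum_pertRem_le hx (hgz z) (hZ z hz hx μ hμ)
        (hO z hz hx μ hμ) (hZ0 z) (hO0 z)).trans ?_)
      have k1 := hAbs_nonneg h z
      have k2 : 0 ≤ hOut T h z := Finset.sum_nonneg fun _ _ => Finset.sum_nonneg fun _ _ =>
        Finset.sum_nonneg fun _ _ => Finset.sum_nonneg fun _ _ => abs_nonneg _
      have k3 : 0 ≤ hGrad T h z := Finset.sum_nonneg fun _ _ => Finset.sum_nonneg fun _ _ =>
        Finset.sum_nonneg fun _ _ => Finset.sum_nonneg fun _ _ => Finset.sum_nonneg fun _ _ =>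
          abs_nonneg _
      have k4 := hZ0 z
      have k5 := hO0 z
      have k6 : |-(sigD U (z.1 - ‖z.2‖) * ghost U (z.1 - ‖z.2‖))| ≤ 9 * (jb (z.1 - ‖z.2‖))⁻¹ := by
        rw [abs_neg, abs_of_nonneg (mul_nonneg h3 (hgz z))]
        calc _ ≤ 3 * (jb (z.1 - ‖z.2‖))⁻¹ * 3 :=
              mul_le_mul (sigD_le hU _) (hg3 z) (hgz z) (h3.trans (sigD_le hU _))
          _ = _ := by ring
      calc _ ≤ 3 * ((3 / 2 * hAbs h z + 1 / 2 * (‖z.2‖ * hOut T h z)) * Zf z ^ 2)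
            + 3 * (hGrad T h z * (Zf z * Of z)) + 3 * (hAbs h z * (3 * Zf z ^ 2))
            + 9 * (jb (z.1 - ‖z.2‖))⁻¹ * (hAbs h z * (Zf z * Of z)) := by
            gcongr <;> exact hg3 z
        _ = 3 * (hGrad T h z * (Zf z * Of z))
          + 9 * (hAbs h z * (jb (z.1 - ‖z.2‖))⁻¹ * (Zf z * Of z))
            + (3 / 2 * (‖z.2‖ * hOut T h z) + 27 / 2 * hAbs h z) * Zf z ^ 2 := by ring
        _ ≤ 3 * (hGrad T h z * (Zf z * Of z))
          + 9 * (hAbs h z * (jb (z.1 - ‖z.2‖))⁻¹ * (Zf z * Of z))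
            + (14 * (‖z.2‖ * hOut T h z) + 14 * hAbs h z) * Zf z ^ 2 := by
            gcongr <;> norm_num
        _ = _ := by ring
    -- 1/6 is the lower bound 1/3 of the weight times the ½ in the bulk term.
    have hB1 : 1 / 6 * (eSum T s w z + sigD U (z.1 - ‖z.2‖) * ‖z.2‖ * vSum T s w z)
        ≤ ghost U (z.1 - ‖z.2‖) * (1 / 2 * eSum T s w z
          + sigD U (z.1 - ‖z.2‖) * ‖z.2‖ * vSum T s w z) := by
      have k7 : 0 ≤ sigD U (z.1 - ‖z.2‖) * ‖z.2‖ * vSum T s w z := by positivity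
      calc _ ≤ 1 / 3 * (1 / 2 * eSum T s w z
          + sigD U (z.1 - ‖z.2‖) * ‖z.2‖ * vSum T s w z) := by linarith
        _ ≤ _ := mul_le_mul_of_nonneg_right (hg1 z) (by positivity)
    linarith
  · have h1 := hP0 (τ, x) ⟨hτ, mem_univ _⟩ hx
    have h2 := eSum_nonneg (T := T) (s := s) (w := w) (τ, x)
    have h3 : 1 / 3 * (1 / 2 * (‖x‖ * eSum T s w (τ, x)))
        ≤ ghost U (τ - ‖x‖) * (1 / 2 * (‖x‖ * eSum T s w (τ, x))) :=
      mul_le_mul_of_nonneg_right (hg1 (τ, x)) (by positivity)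
    have h4 := (abs_le.1 h1).1
    simp only at h4
    linarith
  · have h1 := hP0 (0, x) ⟨⟨le_rfl, hT.le⟩, mem_univ _⟩ hx
    have h2 := eSum_nonneg (T := T) (s := s) (w := w) (0, x)
    have h3 : ghost U (0 - ‖x‖) * (1 / 2 * (‖x‖ * eSum T s w (0, x)))
        ≤ 3 * (1 / 2 * (‖x‖ * eSum T s w (0, x))) :=
      mul_le_mul_of_nonneg_right (hg3 (0, x)) (by positivity)
    have h4 := (abs_le.1 h1).2
    simp only at h4
    linarith
  · have hr : 0 < ‖z.2‖ := by simpa using hx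
    have e : radialFlux (mainCurrent T s h w U) z
        = (∑ μ ∈ s, ∑ I, radialFlux (boxCurrent T (ghost U) (w μ I)) z)
          + ∑ μ ∈ s, radialFlux (pertCurrent T (ghost U) h (w μ)) z := by
      simp only [radialFlux, mainCurrent]
      simp only [Fin.sum_univ_three, Finset.sum_add_distrib, mul_add, ← Finset.mul_sum]
    have h1 : |∑ μ ∈ s, ∑ I, radialFlux (boxCurrent T (ghost U) (w μ I)) z|
        ≤ ‖z.2‖ * (3 / 2 * eSum T s w z) := by
      simp only [eSum, Finset.mul_sum]
      refine (Finset.abs_sum_le_sum_abs _ _).trans (Finset.sum_le_sum fun μ _ => ?_)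
      refine (Finset.abs_sum_le_sum_abs _ _).trans (Finset.sum_le_sum fun I _ => ?_)
      rw [radialFlux_boxCurrent hx, abs_mul, abs_of_nonneg (hgz z), abs_mul, abs_mul, abs_norm,
        abs_of_nonneg (by norm_num : (0 : ℝ) ≤ 1 / 2)]
      have h2 : |angSq T (w μ I) z - (outR T (w μ I) z / ‖z.2‖) ^ 2| ≤ eDen T (w μ I) z := by
        have k1 := angSq_nonneg (T := T) (w := w μ I) (z := z)
        have k2 := sq_nonneg (outR T (w μ I) z / ‖z.2‖)
        rw [eDen, abs_le]
        constructor <;> linarith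
      have h3 := eDen_nonneg (T := T) (w := w μ I) (z := z)
      calc _ ≤ 3 * (1 / 2 * (‖z.2‖ * eDen T (w μ I) z)) := by
            gcongr
            exact hg3 z
        _ = _ := by ring
    have h2 : |∑ μ ∈ s, radialFlux (pertCurrent T (ghost U) h (w μ)) z|
        ≤ ‖z.2‖ * (s.card * (14 * (hAbs h z * Zf z ^ 2)
          + 3 * (hAbs h z * Zf z * (Af z / ‖z.2‖)))) := by
      refine (Finset.abs_sum_le_sum_abs _ _).trans ?_
      rw [mul_left_comm, ← nsmul_eq_mul]
      refine Finset.sum_le_card_nsmul _ _ _ fun μ hμ => ?_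
      refine (abs_radialFlux_pertCurrent_le hx (hgz z) (hZ z hz hx μ hμ) (hZ0 z) (hR z hz hx μ hμ)
        (hR0 z)).trans ?_
      have k1 := hAbs_nonneg h z
      have k2 := hZ0 z
      have k3 := hA0 z
      calc _ ≤ 3 * (1 / 2 * (‖z.2‖ * (hAbs h z * Zf z ^ 2))
            + hAbs h z * (Zf z * (4 * ‖z.2‖ * Zf z + Af z))) := by
            gcongr
            exact hg3 z
        _ = 27 / 2 * (‖z.2‖ * (hAbs h z * Zf z ^ 2)) + 3 * (hAbs h z * Zf z * Af z) := by ring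
        _ ≤ 14 * (‖z.2‖ * (hAbs h z * Zf z ^ 2)) + 3 * (hAbs h z * Zf z * Af z) := by
            gcongr; norm_num
        _ = _ := by field_simp
    rw [e]
    refine (abs_add_le _ _).trans ((add_le_add h1 h2).trans (le_of_eq ?_))
    ring
  · exact ((C1Off.const _).contOff.mul hcE).aemeasurable
  · simp only [ENNReal.ofReal_mul (by norm_num : (0 : ℝ) ≤ 3 / 2)]
    rw [lintegral_const_mul' _ _ ENNReal.ofReal_ne_top]
    exact ENNReal.mul_ne_top ENNReal.ofReal_ne_top hfin
  · have hc : IntegrableOn (pairSum T s h w U) (Icc 0 τ ×ˢ Metric.closedBall (0 : E3) R) :=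
      (hpc.mono (prod_mono (Icc_subset_Icc_right hτ.2) (subset_univ _))).integrableOn_compact
        (isCompact_Icc.prod (isCompact_closedBall _ _))
    exact hc.mono_set (prod_mono subset_rfl Metric.ball_subset_closedBall)

end MainEstimate

/-! ### Hardy's inequality and finiteness of the energy on the slab -/

section Hardy

variable {T t : ℝ} {w : SpaceTime → ℝ}

/-- In polar coordinates the area factor r² cancels, leaving 1/(1 + r³) ≤ 2/(1 + r²). -/
theorem integrable_inv_norm_sq_mul :
    Integrable fun x : E3 => (‖x‖ ^ 2 * (1 + ‖x‖ ^ 3))⁻¹ := by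
  have h := integrable_fun_norm_addHaar (volume : Measure E3) (F := ℝ)
    (f := fun y : ℝ => (y ^ 2 * (1 + y ^ 3))⁻¹)
  rw [h]
  have h2 : IntegrableOn (fun y : ℝ => 2 * (1 + y ^ 2)⁻¹) (Ioi 0) :=
    (integrable_inv_one_add_sq.const_mul 2).integrableOn
  refine Integrable.mono' h2 (by fun_prop) ?_
  filter_upwards [ae_restrict_mem measurableSet_Ioi] with y hy
  have hy : 0 < y := hy
  simp only [finrank_euclideanSpace, Fintype.card_fin, smul_eq_mul, Real.norm_eq_abs]
  rw [abs_of_nonneg (by positivity)]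
  have e : y ^ (3 - 1) * (y ^ 2 * (1 + y ^ 3))⁻¹ = 1 / (1 + y ^ 3) := by
    simp only [Nat.add_one_sub_one]
    field_simp
  rw [e, ← div_eq_mul_inv, div_le_div_iff₀ (by positivity) (by positivity)]
  nlinarith [sq_nonneg (y - 1), mul_nonneg hy.le (sq_nonneg (y - 1))]

/-- Continuity on a ball and decay outside make (1 + r³) f² bounded, so f²/r² is dominated by a
multiple of 1/(r² (1 + r³)). This a priori finiteness is needed to remove the cutoff in Hardy's
inequality. -/
theorem lintegral_sq_div_ne_top {f : E3 → ℝ} (hf : Continuous f)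
    (hd : Tendsto (fun x => ‖x‖ ^ (3 / 2 : ℝ) * f x) (cocompact E3) (𝓝 0)) :
    ∫⁻ x, ENNReal.ofReal (f x ^ 2 / ‖x‖ ^ 2) ≠ ∞ := by
  have hev : ∀ᶠ x in cocompact E3, |‖x‖ ^ (3 / 2 : ℝ) * f x| ≤ 1 := by
    have := hd.abs
    rw [abs_zero] at this
    exact this.eventually_le_const one_pos
  obtain ⟨K, hK, hKc⟩ := mem_cocompact.1 hev
  have hpow : ∀ x : E3, (‖x‖ ^ (3 / 2 : ℝ)) ^ 2 = ‖x‖ ^ 3 := fun x => by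
    rw [← Real.rpow_natCast, ← Real.rpow_mul (norm_nonneg _), ← Real.rpow_natCast]
    norm_num
  obtain ⟨R, hR0, hR⟩ : ∃ R : ℝ, 1 ≤ R ∧ K ⊆ Metric.closedBall 0 R := by
    obtain ⟨R, hR⟩ := hK.isBounded.subset_closedBall 0
    exact ⟨max R 1, le_max_right _ _, hR.trans (Metric.closedBall_subset_closedBall (le_max_left _ _))⟩
  obtain ⟨B, hB⟩ := (isCompact_closedBall (0 : E3) R).exists_bound_of_continuousOn
    (f := fun x => (1 + ‖x‖ ^ 3) * f x ^ 2) (by fun_prop)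
  have hall : ∀ x, (1 + ‖x‖ ^ 3) * f x ^ 2 ≤ max B 2 := fun x => by
    by_cases hx : x ∈ Metric.closedBall (0 : E3) R
    · exact ((le_abs_self _).trans (hB x hx)).trans (le_max_left _ _)
    · have h1 : |‖x‖ ^ (3 / 2 : ℝ) * f x| ≤ 1 := hKc fun h => hx (hR h)
      have h2 : ‖x‖ ^ 3 * f x ^ 2 ≤ 1 := by
        rw [← hpow, ← mul_pow, ← sq_abs]
        exact pow_le_one₀ (abs_nonneg _) h1
      have h3 : 1 ≤ ‖x‖ := by
        rw [mem_closedBall_zero_iff] at hx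
        linarith
      have h4 : f x ^ 2 ≤ ‖x‖ ^ 3 * f x ^ 2 :=
        le_mul_of_one_le_left (sq_nonneg _) (one_le_pow₀ h3)
      refine le_trans ?_ (le_max_right _ _)
      linarith
  have hi := (integrable_inv_norm_sq_mul.const_mul (max B 2)).lintegral_lt_top
  refine (lt_of_le_of_lt (lintegral_mono fun x => ENNReal.ofReal_le_ofReal ?_) hi).ne
  rcases eq_or_ne x 0 with rfl | hx
  · simp
  have hr : 0 < ‖x‖ := by simpa using hx
  rw [← div_eq_mul_inv, div_le_div_iff₀ (by positivity) (by positivity)]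
  have := mul_le_mul_of_nonneg_right (hall x) (by positivity : 0 ≤ ‖x‖ ^ 2)
  linarith

/-- The divergence of x w²/r² is w²/r² + 2w (x·∇w)/r², and its flux is r · w²/r², so the assumed
finiteness kills the cutoff error. Completing a square leaves ½ w²/r² ≤ 2 |∇w|² plus the divergence,
hence the factor 4. -/
theorem hardy_slice (hT : 0 < T) (ht : t ∈ Icc 0 T) (hw : ContDiffOn ℝ 2 w (slab T))
    (hfin : ∫⁻ x, ENNReal.ofReal (w (t, x) ^ 2 / ‖x‖ ^ 2) ≠ ∞) :
    ∫⁻ x, ENNReal.ofReal (w (t, x) ^ 2 / ‖x‖ ^ 2)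
      ≤ 4 * ∫⁻ x, ENNReal.ofReal (∑ i : Fin 3, pd T i.succ w (t, x) ^ 2) := by
  have hw1 : ContDiffOn ℝ 1 w (slab T) := hw.of_le (by norm_num)
  have hl : ∀ r : ℝ, 0 < r → ContDiffAt ℝ 1 (fun r : ℝ => r⁻¹) r := fun r hr =>
    contDiffAt_inv ℝ hr.ne'
  have hP := C1Off.outCurrent (ψ := fun _ => 1) hw contDiff_const hl
  have hz : ∀ x : E3, (t, x) ∈ slab T := fun x => ⟨ht, mem_univ _⟩
  have hdiv : ∀ x : E3, x ≠ 0 →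
      ∑ i : Fin 3, pd T i.succ (outCurrent (fun _ => 1) (fun r => r⁻¹) w i.succ) (t, x)
        = w (t, x) ^ 2 / ‖x‖ ^ 2 + 2 * w (t, x) * xGrad T w (t, x) / ‖x‖ ^ 2 := fun x hx => by
    have hr : ‖x‖ ≠ 0 := by simpa using hx
    have h1 := out_identity hT hw1 (hz x) hx (ψ := fun _ => 1) (hasDerivAt_const _ _)
      (hasDerivAt_inv hr)
    rw [Fin.sum_univ_succ] at h1
    have hr' : ‖((t, x) : SpaceTime).2‖ ≠ 0 := hr
    have hi := (HasPD.radius (T := T) (z := (t, x)) hx).inv hr'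
    have hP0 : HasPD T (outCurrent (fun _ => 1) (fun r => r⁻¹) w 0) (t, x) _ :=
      ((HasPD.const 1).mul (hi.mul ((HasPD.of_contDiffOn hw1 le_rfl (hz x)).sq.mul hi))).mul
        (hasPD_outVec hx 0)
    have h2 := hP0.pd_eq hT (hz x) 0
    simp only [Matrix.cons_val, outVec, outVecD, if_true, mul_zero, add_zero, zero_add, one_mul] at h2
    have h3 : outR T w (t, x) = ‖x‖ * pd T 0 w (t, x) + xGrad T w (t, x) + w (t, x) := outR_eq'
    rw [h2, h3] at h1
    simp only at h1
    field_simp at h1 ⊢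
    linear_combination h1
  have hwc : Continuous fun x => w (t, x) :=
    hw.continuousOn.comp_continuous (by fun_prop) hz
  have hpc : ∀ α, Continuous fun x => pd T α w (t, x) := fun α =>
    (contDiffOn_pd hT hw (m := 1) (by norm_num) α).continuousOn.comp_continuous (by fun_prop) hz
  set F : E3 → ℝ := fun x => w (t, x) ^ 2 / ‖x‖ ^ 2 with hF
  set G : E3 → ℝ := fun x => ∑ i : Fin 3, pd T i.succ w (t, x) ^ 2 with hG
  have hGc : Continuous G := by fun_prop
  have hFc : ContinuousOn F {x | x ≠ 0} :=
    ContinuousOn.div (hwc.pow 2).continuousOn (by fun_prop) fun x hx => by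
      have hx : x ≠ 0 := hx
      positivity
  have hFm : AEMeasurable F := aemeasurable_of_continuousOn_ne hFc
  have hF0 : ∀ x, 0 ≤ F x := fun x => by positivity
  have hG0 : ∀ x, 0 ≤ G x := fun x => Finset.sum_nonneg fun _ _ => sq_nonneg _
  have hpos : ∀ᵐ x : E3, 0 < ‖x‖ := ae_ne_zero.mono fun x hx => norm_pos_iff.2 hx
  have key : ∫⁻ x, ENNReal.ofReal (1 / 2 * F x) ≤ ∫⁻ x, ENNReal.ofReal (2 * G x) := by
    refine lintegral_le_of_cut (hFm.const_mul _) measurable_norm hpos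
      (e := fun n => 6 * ∫⁻ x, ENNReal.ofReal (cutI ((n : ℝ) + 2) ‖x‖ * F x)) ?_
      (Eventually.of_forall fun n => ?_)
    · have := ENNReal.Tendsto.const_mul (tendsto_lintegral_cutI hFm measurable_norm hpos hfin)
        (a := 6) (Or.inr (by norm_num))
      simpa using this
    have hL : (2 : ℝ) ≤ (n : ℝ) + 2 := by linarith [n.cast_nonneg (α := ℝ)]
    set L : ℝ := (n : ℝ) + 2
    have hflux : ∀ x : E3, x ≠ 0 →
        radialFlux (outCurrent (fun _ => 1) (fun r => r⁻¹) w) (t, x) = ‖x‖ * F x := fun x hx => by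
      have hr : ‖x‖ ≠ 0 := by simpa using hx
      rw [radialFlux_outCurrent hx]
      simp only [hF]
      field_simp
    have hfc : ContinuousOn (fun x => ‖x‖ * F x) {x | x ≠ 0} :=
      continuous_norm.continuousOn.mul hFc
    have hdc : ContinuousOn (fun x => ∑ i : Fin 3,
        pd T i.succ (outCurrent (fun _ => 1) (fun r => r⁻¹) w i.succ) (t, x)) {x | x ≠ 0} :=
      (ContOff.sum fun i _ => (hP i.succ).contOff_pd hT i.succ).continuousOn_slice ht
    have i1 : Integrable fun x => cutP L ‖x‖ * (1 / 2 * F x) :=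
      integrable_cut_slice (hFc.const_smul (1 / 2 : ℝ)) hL
    have i2 : Integrable fun x => cutP L ‖x‖ * (2 * G x) :=
      integrable_cut_slice (hGc.continuousOn.const_smul (2 : ℝ)) hL
    have i3 := integrable_cut_slice hdc hL
    have i4 := integrable_cutD_slice hfc hL
    have h0 := integral_div_cut_slice hT ht hP hL
    have h0' : ∫ x, (cutP L ‖x‖ * (∑ i : Fin 3,
        pd T i.succ (outCurrent (fun _ => 1) (fun r => r⁻¹) w i.succ) (t, x))
        + cutD L ‖x‖ * (‖x‖ * F x)) = 0 := by
      rw [← h0]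
      refine integral_congr_ae ?_
      filter_upwards [ae_ne_zero] with x hx
      rw [hflux x hx]
    have hle : ∫ x, cutP L ‖x‖ * (1 / 2 * F x)
        ≤ ∫ x, (cutP L ‖x‖ * (2 * G x) + |cutD L ‖x‖ * (‖x‖ * F x)|) := by
      have i5 : Integrable fun x => cutP L ‖x‖ * (2 * G x) + |cutD L ‖x‖ * (‖x‖ * F x)| :=
        i2.add i4.abs
      have i6 : Integrable fun x => cutP L ‖x‖ * (∑ i : Fin 3,
          pd T i.succ (outCurrent (fun _ => 1) (fun r => r⁻¹) w i.succ) (t, x))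
          + cutD L ‖x‖ * (‖x‖ * F x) := i3.add i4
      -- Adding the vanishing integral of the truncated divergence makes the comparison pointwise.
      have hsum : ∫ x, (cutP L ‖x‖ * (2 * G x) + |cutD L ‖x‖ * (‖x‖ * F x)|)
          = ∫ x, ((cutP L ‖x‖ * (2 * G x) + |cutD L ‖x‖ * (‖x‖ * F x)|)
            + (cutP L ‖x‖ * (∑ i : Fin 3,
        pd T i.succ (outCurrent (fun _ => 1) (fun r => r⁻¹) w i.succ) (t, x))
        + cutD L ‖x‖ * (‖x‖ * F x))) := by
        rw [integral_add i5 i6, h0', add_zero]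
      rw [hsum]
      refine integral_mono_ae i1 (i5.add i6) ?_
      filter_upwards [ae_ne_zero] with x hx
      have hr : 0 < ‖x‖ := by simpa using hx
      simp only [hdiv x hx]
      have h1 : 0 ≤ |cutD L ‖x‖ * (‖x‖ * F x)| + cutD L ‖x‖ * (‖x‖ * F x) := by
        linarith [neg_abs_le (cutD L ‖x‖ * (‖x‖ * F x))]
      have h2 : xGrad T w (t, x) ^ 2 / ‖x‖ ^ 2 ≤ G x := by
        have := angSq_nonneg (T := T) (w := w) (z := (t, x))
        rw [angSq_eq hx] at this
        simp only [hG]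
        simp only at this ⊢
        linarith
      -- Expand (w + 2 x·∇w)² ≥ 0 and use |∂_r w|² ≤ |∇w|².
      have h3 : 1 / 2 * F x ≤ 2 * G x
          + (w (t, x) ^ 2 / ‖x‖ ^ 2 + 2 * w (t, x) * xGrad T w (t, x) / ‖x‖ ^ 2) := by
        have h4 : 0 ≤ 1 / 2 * ((w (t, x) + 2 * xGrad T w (t, x)) ^ 2 / ‖x‖ ^ 2) := by positivity
        have h5 : 1 / 2 * ((w (t, x) + 2 * xGrad T w (t, x)) ^ 2 / ‖x‖ ^ 2)
            = 1 / 2 * (w (t, x) ^ 2 / ‖x‖ ^ 2) + 2 * w (t, x) * xGrad T w (t, x) / ‖x‖ ^ 2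
              + 2 * (xGrad T w (t, x) ^ 2 / ‖x‖ ^ 2) := by ring
        simp only [hF]
        linarith
      have h6 := mul_le_mul_of_nonneg_left h3 (cutP_nonneg hL hr.le)
      rw [mul_add] at h6
      linarith
    have hpi : ENNReal.ofReal (∫ x, cutP L ‖x‖ * (1 / 2 * F x))
        = ∫⁻ x, ENNReal.ofReal (cutP L ‖x‖ * (1 / 2 * F x)) :=
      ofReal_integral_eq_lintegral_ofReal i1 (Eventually.of_forall fun x =>
        mul_nonneg (cutP_nonneg hL (norm_nonneg _)) (mul_nonneg (by norm_num) (hF0 x)))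
    rw [← hpi]
    refine (ENNReal.ofReal_le_ofReal hle).trans ((ofReal_integral_le_lintegral _).trans ?_)
    have e6 : 6 * ∫⁻ x, ENNReal.ofReal (cutI L ‖x‖ * F x)
        = ∫⁻ x, 6 * ENNReal.ofReal (cutI L ‖x‖ * F x) :=
      (lintegral_const_mul' _ _ (by norm_num)).symm
    rw [e6, ← lintegral_add_left (by fun_prop)]
    refine lintegral_mono fun x => ?_
    rw [← ENNReal.ofReal_ofNat 6, ← ENNReal.ofReal_mul (by norm_num),
      ← ENNReal.ofReal_add (mul_nonneg (by norm_num) (hG0 x))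
        (mul_nonneg (by norm_num) (mul_nonneg cutI_nonneg (hF0 x)))]
    refine ENNReal.ofReal_le_ofReal (add_le_add ?_ ?_)
    · exact mul_le_of_le_one_left (mul_nonneg (by norm_num) (hG0 x)) (cutP_le_one _ _)
    · rw [abs_mul, abs_of_nonneg (mul_nonneg (norm_nonneg x) (hF0 x)), ← mul_assoc, ← mul_assoc]
      exact mul_le_mul_of_nonneg_right (abs_cutD_mul_le hL (norm_nonneg _)) (hF0 x)
  have e1 : ∫⁻ x, ENNReal.ofReal (F x) = 2 * ∫⁻ x, ENNReal.ofReal (1 / 2 * F x) := by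
    rw [← lintegral_const_mul' _ _ (by norm_num)]
    refine lintegral_congr fun x => ?_
    rw [← ENNReal.ofReal_ofNat 2, ← ENNReal.ofReal_mul (by norm_num)]
    congr 1
    ring
  have e2 : ∫⁻ x, ENNReal.ofReal (2 * G x) = 2 * ∫⁻ x, ENNReal.ofReal (G x) := by
    rw [← lintegral_const_mul' _ _ (by norm_num)]
    refine lintegral_congr fun x => ?_
    rw [← ENNReal.ofReal_ofNat 2, ← ENNReal.ofReal_mul (by norm_num)]
  rw [e1]
  refine (mul_le_mul_right key 2).trans (le_of_eq ?_)
  rw [e2, ← mul_assoc, show (2 * 2 : ℝ≥0∞) = 4 by norm_num]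

theorem lintegral_slab_le {f : SpaceTime → ℝ} {S : ℝ≥0∞} (hf : ContOff T f)
    (hS : ∀ t ∈ Icc 0 T, ∫⁻ x, ENNReal.ofReal (f (t, x)) ≤ S) :
    ∫⁻ z in slab T, ENNReal.ofReal (f z) ≤ ENNReal.ofReal T * S := by
  have hv : (volume : Measure SpaceTime).restrict (slab T)
      = ((volume : Measure ℝ).restrict (Icc 0 T)).prod (volume : Measure E3) := by
    rw [slab, Measure.volume_eq_prod, ← Measure.prod_restrict, Measure.restrict_univ]
  have hm := hf.aemeasurable.ennreal_ofReal
  rw [hv] at hm ⊢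
  rw [lintegral_prod _ hm]
  calc _ ≤ ∫⁻ _t in Icc 0 T, S := setLIntegral_mono' measurableSet_Icc hS
    _ = _ := by rw [setLIntegral_const, Real.volume_Icc, sub_zero, mul_comm]

theorem eDen_le {z : SpaceTime} (hx : z.2 ≠ 0) :
    eDen T w z ≤ 3 * ∑ α, pd T α w z ^ 2 + 3 * (w z ^ 2 / ‖z.2‖ ^ 2) := by
  have hr : ‖z.2‖ ≠ 0 := by simpa using hx
  have h1 := angSq_nonneg (T := T) (w := w) (z := z)
  rw [eDen]
  rw [angSq_eq hx] at h1 ⊢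
  rw [outR_eq', Fin.sum_univ_succ (fun α => pd T α w z ^ 2)]
  have e : (‖z.2‖ * pd T 0 w z + xGrad T w z + w z) / ‖z.2‖
      = pd T 0 w z + xGrad T w z / ‖z.2‖ + w z / ‖z.2‖ := by field_simp
  rw [e]
  have e2 : w z ^ 2 / ‖z.2‖ ^ 2 = (w z / ‖z.2‖) ^ 2 := by ring
  rw [e2]
  set a := pd T 0 w z
  set b := xGrad T w z / ‖z.2‖ with hb
  set c := w z / ‖z.2‖
  have e3 : xGrad T w z ^ 2 / ‖z.2‖ ^ 2 = b ^ 2 := (div_pow _ _ _).symm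
  rw [e3] at h1 ⊢
  have h3 : (a + b + c) ^ 2 ≤ 3 * (a ^ 2 + b ^ 2 + c ^ 2) := by
    nlinarith [sq_nonneg (a - b), sq_nonneg (a - c), sq_nonneg (b - c)]
  linarith

/-- Hardy on each slice bounds w²/r² by the uniform gradient bound S; since T is finite the slab
integrals are finite. The bound depends on T, but only its finiteness is used. -/
theorem lintegral_slab_ne_top (hT : 0 < T) (hw : ContDiffOn ℝ 2 w (slab T))
    (hd : ∀ t ∈ Icc 0 T,
      Tendsto (fun x => ‖x‖ ^ (3 / 2 : ℝ) * w (t, x)) (cocompact E3) (𝓝 0))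
    {S : ℝ≥0∞} (hS : S ≠ ∞)
    (hE : ∀ t ∈ Icc 0 T, ∫⁻ x, ENNReal.ofReal (∑ α, pd T α w (t, x) ^ 2) ≤ S) :
    ∫⁻ z in slab T, ENNReal.ofReal (w z ^ 2 / ‖z.2‖ ^ 2) ≠ ∞ ∧
      ∫⁻ z in slab T, ENNReal.ofReal (eDen T w z) ≠ ∞ := by
  have hpd : ∀ α, ContOff T (pd T α w) := fun α => (C1Off.pd hT hw α).contOff
  have hF : ContOff T fun z => w z ^ 2 / ‖z.2‖ ^ 2 := by
    have := ((C1Off.of_contDiffOn_two hw).contOff.pow 2).mul (ContOff.inv_norm.pow 2)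
    simpa only [div_eq_mul_inv, inv_pow] using this
  have h1 : ∫⁻ z in slab T, ENNReal.ofReal (w z ^ 2 / ‖z.2‖ ^ 2) ≠ ∞ := by
    refine ne_top_of_le_ne_top (b := ENNReal.ofReal T * (4 * S)) (by finiteness)
      (lintegral_slab_le hF fun t ht => ?_)
    have hwc : Continuous fun x => w (t, x) :=
      hw.continuousOn.comp_continuous (by fun_prop) fun x => ⟨ht, mem_univ _⟩
    refine (hardy_slice hT ht hw (lintegral_sq_div_ne_top hwc (hd t ht))).trans ?_
    refine mul_le_mul_right ((lintegral_mono fun x => ENNReal.ofReal_le_ofReal ?_).trans (hE t ht)) 4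
    rw [Fin.sum_univ_succ (fun α => pd T α w (t, x) ^ 2)]
    exact le_add_of_nonneg_left (sq_nonneg _)
  refine ⟨h1, ?_⟩
  have h2 : ∫⁻ z in slab T, ENNReal.ofReal (∑ α, pd T α w z ^ 2) ≠ ∞ :=
    ne_top_of_le_ne_top (b := ENNReal.ofReal T * S) (by finiteness)
      (lintegral_slab_le (ContOff.sum fun α _ => (hpd α).pow 2) hE)
  have h3 : ∫⁻ z in slab T, (3 * ENNReal.ofReal (∑ α, pd T α w z ^ 2)
      + 3 * ENNReal.ofReal (w z ^ 2 / ‖z.2‖ ^ 2)) ≠ ∞ := by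
    rw [lintegral_add_right' _ (hF.aemeasurable.ennreal_ofReal.const_mul _),
      lintegral_const_mul' _ _ (by norm_num), lintegral_const_mul' _ _ (by norm_num)]
    finiteness
  refine ne_top_of_le_ne_top h3 (lintegral_mono_ae ?_)
  filter_upwards [ae_slab_ne_zero T] with z hz
  have h4 : 0 ≤ ∑ α, pd T α w z ^ 2 := Finset.sum_nonneg fun _ _ => sq_nonneg _
  rw [← ENNReal.ofReal_ofNat 3, ← ENNReal.ofReal_mul (by norm_num),
    ← ENNReal.ofReal_mul (by norm_num), ← ENNReal.ofReal_add (by positivity) (by positivity)]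
  exact ENNReal.ofReal_le_ofReal (eDen_le hz.2)

end Hardy

/-! ### Estimates for w from estimates for V -/

section OutgoingEstimates

variable {T τ U : ℝ} {w : SpaceTime → ℝ}

theorem absIntegral_zero (τ : ℝ) : absIntegral τ (fun _ => 0) = 0 := by
  simp [absIntegral]

/-- With ψ = 1 and ℓ = 1/r the divergence is 2wV/r - w²/r² = V² - (V - w/r)², and V - w/r = (∂_t +
∂_r)w. So V² alone pays for the slice term and the outgoing derivative. -/
theorem lintegral_out_le (hT : 0 < T) (hτ : τ ∈ Icc 0 T) (hw : ContDiffOn ℝ 2 w (slab T))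
    (hF : ∫⁻ z in slab T, ENNReal.ofReal (w z ^ 2 / ‖z.2‖ ^ 2) ≠ ∞) :
    ∀ Q, Q = (∫⁻ x, ENNReal.ofReal (w (0, x) ^ 2 / ‖x‖))
      + ∫⁻ z in slab τ, ENNReal.ofReal ((outR T w z / ‖z.2‖) ^ 2) →
    ∫⁻ x, ENNReal.ofReal (w (τ, x) ^ 2 / ‖x‖) ≤ Q ∧
      ∫⁻ z in slab τ, ENNReal.ofReal (((outR T w z - w z) / ‖z.2‖) ^ 2) ≤ Q := by
  have hw1 : ContDiffOn ℝ 1 w (slab T) := hw.of_le (by norm_num)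
  have hl : ∀ r : ℝ, 0 < r → ContDiffAt ℝ 1 (fun r : ℝ => r⁻¹) r := fun r hr =>
    contDiffAt_inv ℝ hr.ne'
  have hcw : ContOff T w := (C1Off.of_contDiffOn_two hw).contOff
  have hB : ContOff T fun z => ((outR T w z - w z) / ‖z.2‖) ^ 2 := by
    simpa only [div_eq_mul_inv] using
      (((C1Off.outR hT hw).contOff.sub hcw).mul .inv_norm).pow 2
  have hFm : ContOff T fun z => w z ^ 2 / ‖z.2‖ ^ 2 := by
    simpa only [div_eq_mul_inv, inv_pow] using (hcw.pow 2).mul (ContOff.inv_norm.pow 2)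
  have hE : ContOff T fun z => w z ^ 2 / ‖z.2‖ := by
    simpa only [div_eq_mul_inv, inv_pow] using (hcw.pow 2).mul ContOff.inv_norm
  intro Q hQ
  refine energy_estimate hT hτ (C1Off.outCurrent (ψ := fun _ => 1) hw contDiff_const hl)
    (f := fun _ => 0) (C1Off.const 0).contOff hB (fun z _ _ => sq_nonneg _)
    (hE.continuousOn_slice hτ) (fun x _ => by positivity)
    (D := fun z => (outR T w z / ‖z.2‖) ^ 2) (H := fun _ => 0)
    (F := fun z => w z ^ 2 / ‖z.2‖ ^ 2) (G := fun x => w (0, x) ^ 2 / ‖x‖) (K := fun _ => 0)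
    (fun z hz hx => ?_) (fun x hx => ?_) (fun x hx => ?_) (fun z hz hx => ?_)
    hFm.aemeasurable hF (fun R => by simp) Q ?_
  · have hr : ‖z.2‖ ≠ 0 := by simpa using hx
    rw [out_identity hT hw1 hz hx (ψ := fun _ => 1) (hasDerivAt_const _ _) (hasDerivAt_inv hr)]
    refine le_of_eq ?_
    field_simp
    ring
  · rw [outCurrent_zero hx]
    refine le_of_eq ?_
    simp only
    ring
  · rw [outCurrent_zero hx]
    refine le_of_eq ?_
    simp only
    ring
  · have hr : 0 < ‖z.2‖ := by simpa using hx
    rw [radialFlux_outCurrent hx]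
    have e : (1 : ℝ) * (‖z.2‖⁻¹ * w z ^ 2) = ‖z.2‖ * (0 + w z ^ 2 / ‖z.2‖ ^ 2) := by field_simp; ring
    simp only [e]
    rw [abs_of_nonneg (by positivity)]
  · rw [hQ, absIntegral_zero]
    simp

/-- A smooth substitute for the characteristic function of the dyadic region `|s| ∼ U`. -/
def lorentz (U s : ℝ) : ℝ := U / (U ^ 2 + s ^ 2)

theorem lorentz_nonneg (hU : 0 < U) (s : ℝ) : 0 ≤ lorentz U s := by unfold lorentz; positivity

theorem lorentz_le_one (hU : 1 ≤ U) (s : ℝ) : lorentz U s ≤ 1 := by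
  have : 0 < U ^ 2 + s ^ 2 := by positivity
  rw [lorentz, div_le_one this]
  nlinarith [sq_nonneg s]

/-- (U + |s|)² ≤ 2 (U² + s²); this lets the ghost weight bulk term absorb ψ r V². -/
theorem lorentz_le_sigD (hU : 0 < U) (s : ℝ) : lorentz U s ≤ 2 * sigD U s := by
  have hs := abs_nonneg s
  rw [lorentz, sigD, ← sq_abs s, mul_div_assoc', div_le_div_iff₀ (by positivity) (by positivity)]
  nlinarith [mul_nonneg hU.le (sq_nonneg (U - |s|))]

theorem abs_mul_lorentz_le (hU : 0 < U) (s : ℝ) : |s| * lorentz U s ≤ 1 := by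
  have hs := abs_nonneg s
  rw [lorentz, ← sq_abs s, mul_div_assoc', div_le_one (by positivity)]
  nlinarith [sq_nonneg (U - |s|)]

theorem contDiff_lorentz (hU : 0 < U) : ContDiff ℝ 1 (lorentz U) :=
  contDiff_const.div (by fun_prop) fun s => by positivity

theorem one_le_log_jb (r : ℝ) : 1 ≤ Real.log (jb r) := by
  rw [Real.le_log_iff_exp_le (by unfold jb; positivity)]
  have := Real.exp_one_lt_d9
  have := abs_nonneg r
  unfold jb
  linarith

/-- With ψ = U/(U² + (t-r)²) and ℓ = 1/log(3 + r), the derivative ℓ' yields -ψ w²/((3 + r) log²).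
Half of it absorbs the cross term 2ψℓwV at the price 2ψ (3 + r) V², where ψ ≤ 1 and ψ ≤ 2σ_U'. At t
= 0, rψ ≤ 1 bounds the density by w²/r. -/
theorem lintegral_log_le (hT : 0 < T) (hτ : τ ∈ Icc 0 T) (hU : 1 ≤ U)
    (hw : ContDiffOn ℝ 2 w (slab T))
    (hF : ∫⁻ z in slab T, ENNReal.ofReal (w z ^ 2 / ‖z.2‖ ^ 2) ≠ ∞) :
    ∫⁻ z in slab τ, ENNReal.ofReal (1 / 2 * (lorentz U (z.1 - ‖z.2‖) * (w z ^ 2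
        / (jb ‖z.2‖ * Real.log (jb ‖z.2‖) ^ 2))))
      ≤ (∫⁻ x, ENNReal.ofReal (w (0, x) ^ 2 / ‖x‖))
        + ∫⁻ z in slab τ, ENNReal.ofReal (6 * (outR T w z / ‖z.2‖) ^ 2
          + 4 * (sigD U (z.1 - ‖z.2‖) * ‖z.2‖ * (outR T w z / ‖z.2‖) ^ 2)) := by
  have hU0 : 0 < U := by linarith
  have hw1 : ContDiffOn ℝ 1 w (slab T) := hw.of_le (by norm_num)
  have hlog : ∀ r : ℝ, 0 < r → 1 ≤ Real.log (3 + r) := fun r hr => by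
    have := one_le_log_jb r
    rwa [jb, abs_of_pos hr] at this
  have hld : ∀ r : ℝ, 0 < r → HasDerivAt (fun r : ℝ => (Real.log (3 + r))⁻¹)
      (-((3 + r)⁻¹ / Real.log (3 + r) ^ 2)) r := fun r hr => by
    have h1 : (0 : ℝ) < 3 + r := by linarith
    have h2 := hlog r hr
    refine ((((hasDerivAt_id r).const_add 3).log h1.ne').fun_inv (by simp only [id]; linarith)).congr_deriv ?_
    simp only [id]
    ring
  have hl : ∀ r : ℝ, 0 < r → ContDiffAt ℝ 1 (fun r : ℝ => (Real.log (3 + r))⁻¹) r :=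
    fun r hr => by
      have h1 : (0 : ℝ) < 3 + r := by linarith
      have h2 := hlog r hr
      exact ((contDiffAt_const.add contDiffAt_id).log h1.ne').inv (by simp only [id]; linarith)
  have hcw : ContOff T w := (C1Off.of_contDiffOn_two hw).contOff
  have hcψ := contDiff_lorentz hU0
  have hB : ContOff T fun z => 1 / 2 * (lorentz U (z.1 - ‖z.2‖) * (w z ^ 2
        / (jb ‖z.2‖ * Real.log (jb ‖z.2‖) ^ 2))) := by
    have hj : ContOff T fun z => (jb ‖z.2‖ * Real.log (jb ‖z.2‖) ^ 2)⁻¹ := by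
      refine ContOff.of_continuous ?_
      have hjc : Continuous fun z : SpaceTime => jb ‖z.2‖ := by unfold jb; fun_prop
      have hjp : ∀ z : SpaceTime, 0 < jb ‖z.2‖ := fun z => by unfold jb; positivity
      refine (hjc.mul ((hjc.log fun z => (hjp z).ne').pow 2)).inv₀ fun z => ?_
      have h1 : 0 < Real.log (jb ‖z.2‖) := zero_lt_one.trans_le (one_le_log_jb ‖z.2‖)
      have h2 := hjp z
      exact (mul_pos h2 (pow_pos h1 2)).ne'
    simpa only [div_eq_mul_inv, Function.comp_apply] using (C1Off.const (1 / 2)).contOff.mul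
      ((ContOff.of_continuous (hcψ.continuous.comp (by fun_prop))).mul ((hcw.pow 2).mul hj))
  have hFm : ContOff T fun z => (T + 1) * (w z ^ 2 / ‖z.2‖ ^ 2) := by
    simpa only [div_eq_mul_inv, inv_pow] using
      (C1Off.const (T + 1)).contOff.mul ((hcw.pow 2).mul (ContOff.inv_norm.pow 2))
  refine (energy_estimate hT hτ (C1Off.outCurrent hw hcψ hl)
    (f := fun _ => 0) (C1Off.const 0).contOff hB (fun z _ _ => ?_)
    (E := fun _ => 0) continuousOn_const (fun x _ => le_rfl)
    (D := fun z => 6 * (outR T w z / ‖z.2‖) ^ 2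
          + 4 * (sigD U (z.1 - ‖z.2‖) * ‖z.2‖ * (outR T w z / ‖z.2‖) ^ 2)) (H := fun _ => 0)
    (F := fun z => (T + 1) * (w z ^ 2 / ‖z.2‖ ^ 2)) (G := fun x => w (0, x) ^ 2 / ‖x‖)
    (K := fun _ => 0)
    (fun z hz hx => ?_) (fun x hx => ?_) (fun x hx => ?_) (fun z hz hx => ?_)
    hFm.aemeasurable ?_ (fun R => by simp) _ ?_).2
  · have h1 := lorentz_nonneg hU0 (z.1 - ‖z.2‖)
    have h2 : 0 < jb ‖z.2‖ := by unfold jb; positivity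
    positivity
  · have hr : 0 < ‖z.2‖ := by simpa using hx
    rw [out_identity hT hw1 hz hx ((hcψ.differentiable one_ne_zero _).hasDerivAt) (hld _ hr)]
    have h1 := lorentz_nonneg hU0 (z.1 - ‖z.2‖)
    have h2 := hlog _ hr
    have h3 := lorentz_le_one hU (z.1 - ‖z.2‖)
    have h4 := lorentz_le_sigD hU0 (z.1 - ‖z.2‖)
    rw [jb, abs_norm, sub_zero]
    set ℓ := Real.log (3 + ‖z.2‖)
    set V := outR T w z / ‖z.2‖
    set ψ := lorentz U (z.1 - ‖z.2‖)
    set r := ‖z.2‖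
    have hb : 0 < 3 + r := by linarith
    -- The completed square behind the absorption of the cross term.
    have e : ψ * (2 * (3 + r) * V ^ 2) - (1 / 2 * (ψ * (w z ^ 2 / ((3 + r) * ℓ ^ 2)))
        + ψ * (2 * w z * ℓ⁻¹ * V + -((3 + r)⁻¹ / ℓ ^ 2) * w z ^ 2))
        = ψ * (1 / 2 * ((w z / ℓ - 2 * (3 + r) * V) ^ 2 / (3 + r))) := by
      field_simp
      ring
    have h5 : 0 ≤ ψ * (1 / 2 * ((w z / ℓ - 2 * (3 + r) * V) ^ 2 / (3 + r))) := by positivity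
    have h6 : ψ * (6 * V ^ 2) ≤ 1 * (6 * V ^ 2) := by gcongr
    have h7 : ψ * (2 * r * V ^ 2) ≤ 2 * sigD U (z.1 - r) * (2 * r * V ^ 2) := by gcongr
    linarith
  · rw [outCurrent_zero hx]
    have hr : 0 < ‖x‖ := by simpa using hx
    have h1 := lorentz_nonneg hU0 (τ - ‖x‖)
    have h2 := hlog _ hr
    have : 0 ≤ lorentz U (τ - ‖x‖) * ((Real.log (3 + ‖x‖))⁻¹ * w (τ, x) ^ 2) := by positivity
    simp only
    linarith
  · rw [outCurrent_zero hx]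
    have hr : 0 < ‖x‖ := by simpa using hx
    have h1 := lorentz_nonneg hU0 (0 - ‖x‖)
    have h2 := hlog _ hr
    have h3 := abs_mul_lorentz_le hU0 (0 - ‖x‖)
    rw [zero_sub, abs_neg, abs_norm] at h3
    simp only [zero_sub] at h1 ⊢
    rw [le_div_iff₀ hr]
    calc lorentz U (-‖x‖) * ((Real.log (3 + ‖x‖))⁻¹ * w (0, x) ^ 2) * ‖x‖
        = (‖x‖ * lorentz U (-‖x‖)) * ((Real.log (3 + ‖x‖))⁻¹ * w (0, x) ^ 2) := by ring
      _ ≤ 1 * (1 * w (0, x) ^ 2) := by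
          gcongr
          exact inv_le_one_of_one_le₀ h2
      _ = _ := by ring
  · rw [radialFlux_outCurrent hx]
    have hr : 0 < ‖z.2‖ := by simpa using hx
    have h1 := lorentz_nonneg hU0 (z.1 - ‖z.2‖)
    have h2 := hlog _ hr
    have h3 := abs_mul_lorentz_le hU0 (z.1 - ‖z.2‖)
    have h4 := lorentz_le_one hU (z.1 - ‖z.2‖)
    -- The flux needs an integrable majorant only, so dependence on T is harmless here: r ≤ T + |t -
    -- r|.
    have h5 : ‖z.2‖ * lorentz U (z.1 - ‖z.2‖) ≤ T + 1 := by
      have hz1 : 0 ≤ z.1 ∧ z.1 ≤ T := hz.1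
      have h6 : ‖z.2‖ ≤ T + |z.1 - ‖z.2‖| := by
        have := neg_abs_le (z.1 - ‖z.2‖)
        linarith
      calc _ ≤ (T + |z.1 - ‖z.2‖|) * lorentz U (z.1 - ‖z.2‖) := by gcongr
        _ = T * lorentz U (z.1 - ‖z.2‖) + |z.1 - ‖z.2‖| * lorentz U (z.1 - ‖z.2‖) := by ring
        _ ≤ T * 1 + 1 := by gcongr
        _ = _ := by ring
    rw [abs_of_nonneg (by positivity), zero_add]
    have e : ‖z.2‖ * ((T + 1) * (w z ^ 2 / ‖z.2‖ ^ 2)) = (T + 1) * w z ^ 2 / ‖z.2‖ := by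
      field_simp
    rw [e, le_div_iff₀ hr]
    calc lorentz U (z.1 - ‖z.2‖) * ((Real.log (3 + ‖z.2‖))⁻¹ * w z ^ 2) * ‖z.2‖
        = (‖z.2‖ * lorentz U (z.1 - ‖z.2‖)) * ((Real.log (3 + ‖z.2‖))⁻¹ * w z ^ 2) := by ring
      _ ≤ (T + 1) * (1 * w z ^ 2) := by
          gcongr
          exact inv_le_one_of_one_le₀ h2
      _ = _ := by ring
  · simp only [ENNReal.ofReal_mul (by linarith : 0 ≤ T + 1)]
    rw [lintegral_const_mul' _ _ ENNReal.ofReal_ne_top]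
    exact ENNReal.mul_ne_top ENNReal.ofReal_ne_top hF
  · rw [absIntegral_zero]
    simp

end OutgoingEstimates

/-! ### Regularity of Z^μ u -/

section VectorFields

variable {F : Type*} [NormedAddCommGroup F] [NormedSpace ℝ F] {T : ℝ} {v : SpaceTime → F}

theorem contDiff_coord (j : Fin 3) {n : WithTop ℕ∞} : ContDiff ℝ n fun z : SpaceTime => z.2 j :=
  ((EuclideanSpace.proj j : E3 →L[ℝ] ℝ).contDiff).comp contDiff_snd

theorem contDiffOn_Z (hT : 0 < T) (m : ℕ) (i : Fin 8)
    (hv : ContDiffOn ℝ ((m + 1 : ℕ) : WithTop ℕ∞) v (slab T)) :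
    ContDiffOn ℝ (m : WithTop ℕ∞) (Z T i v) (slab T) := by
  have hp : ∀ α, ContDiffOn ℝ (m : WithTop ℕ∞) (pd T α v) (slab T) := fun α =>
    contDiffOn_pd hT hv (by norm_cast) α
  have hr : ∀ i, ContDiffOn ℝ (m : WithTop ℕ∞) (rot T i v) (slab T) := fun i =>
    ((contDiff_coord (i + 1)).contDiffOn.smul (hp _)).sub
      ((contDiff_coord (i + 2)).contDiffOn.smul (hp _))
  fin_cases i
  · exact hp 0
  · exact hp 1
  · exact hp 2
  · exact hp 3
  · exact hr 0
  · exact hr 1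
  · exact hr 2
  · exact (contDiff_fst.contDiffOn.smul (hp 0)).add
      (ContDiffOn.sum fun i _ => (contDiff_coord i).contDiffOn.smul (hp i.succ))

theorem contDiffOn_Z_iterate (hT : 0 < T) (m k : ℕ) (i : Fin 8)
    (hv : ContDiffOn ℝ ((m + k : ℕ) : WithTop ℕ∞) v (slab T)) :
    ContDiffOn ℝ (m : WithTop ℕ∞) ((Z T i)^[k] v) (slab T) := by
  induction k generalizing m with
  | zero => exact hv
  | succ k ih =>
    rw [Function.iterate_succ_apply']
    exact contDiffOn_Z hT m i (ih (m + 1) (by rwa [add_assoc, add_comm 1]))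

theorem contDiffOn_Z_foldr (hT : 0 < T) (m : ℕ) (μ : Fin 8 → ℕ) (l : List (Fin 8))
    (hv : ContDiffOn ℝ ((m + (l.map μ).sum : ℕ) : WithTop ℕ∞) v (slab T)) :
    ContDiffOn ℝ (m : WithTop ℕ∞) (l.foldr (fun i v => (Z T i)^[μ i] v) v) (slab T) := by
  induction l generalizing m with
  | nil => simpa using hv
  | cons i l ih =>
    rw [List.foldr_cons]
    refine contDiffOn_Z_iterate hT m (μ i) i (ih (m + μ i) ?_)
    rwa [List.map_cons, List.sum_cons, ← add_assoc] at hv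

/-- Each field costs one derivative and has smooth coefficients; at most N of the N + 2 derivatives
are spent. -/
theorem contDiffOn_Zpow (hT : 0 < T) {N : ℕ} {μ : Fin 8 → ℕ} (hμ : μ ∈ multiIdx N)
    (hv : ContDiffOn ℝ ((N + 2 : ℕ) : WithTop ℕ∞) v (slab T)) :
    ContDiffOn ℝ 2 (Zpow T μ v) (slab T) := by
  refine contDiffOn_Z_foldr hT 2 μ _ (hv.of_le ?_)
  have h1 := (Finset.mem_filter.1 hμ).2
  rw [Fin.sum_univ_def] at h1
  norm_cast
  omega

end VectorFields

/-! ### Passing to scalar components -/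

section Components

variable {M : ℕ} {T : ℝ} {W : SpaceTime → Vec M} {z : SpaceTime}

theorem pd_congr {F : Type*} [NormedAddCommGroup F] [NormedSpace ℝ F] {f g : SpaceTime → F}
    (h : EqOn f g (slab T)) (hz : z ∈ slab T) (α : Fin 4) : pd T α f z = pd T α g z := by
  rw [pd, pd, fderivWithin_congr h (h hz)]

theorem pd_component (hT : 0 < T) (hW : DifferentiableWithinAt ℝ W (slab T) z) (hz : z ∈ slab T)
    (α : Fin 4) (I : Fin M) : pd T α W z I = pd T α (fun z => W z I) z := by
  have h := ((EuclideanSpace.proj I : Vec M →L[ℝ] ℝ).hasFDerivAt.comp_hasFDerivWithinAt z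
    hW.hasFDerivWithinAt).fderivWithin (uniqueDiffOn_slab hT z hz)
  have e : (fun z => W z I) = (EuclideanSpace.proj I : Vec M →L[ℝ] ℝ) ∘ W := rfl
  rw [pd, pd, e, h]
  rfl

theorem outD_component (hT : 0 < T) (hW : DifferentiableWithinAt ℝ W (slab T) z)
    (hz : z ∈ slab T) (I : Fin M) : outD T W z I = outD T (fun z => W z I) z := by
  simp [outD, dr, pd_component hT hW hz, Fin.sum_univ_three]

theorem ang_component (hT : 0 < T) (hW : DifferentiableWithinAt ℝ W (slab T) z)
    (hz : z ∈ slab T) (i : Fin 3) (I : Fin M) : ang T i W z I = ang T i (fun z => W z I) z := by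
  simp [ang, dr, pd_component hT hW hz, Fin.sum_univ_three, mul_add]

theorem contDiffOn_component {n : WithTop ℕ∞} (hW : ContDiffOn ℝ n W (slab T)) (I : Fin M) :
    ContDiffOn ℝ n (fun z => W z I) (slab T) :=
  (EuclideanSpace.proj I : Vec M →L[ℝ] ℝ).contDiff.comp_contDiffOn hW

theorem pd_pd_component (hT : 0 < T) (hW : ContDiffOn ℝ 2 W (slab T)) (hz : z ∈ slab T)
    (α β : Fin 4) (I : Fin M) :
    pd T α (pd T β W) z I = pd T α (pd T β fun z => W z I) z := by
  rw [pd_component hT ((contDiffOn_pd hT hW (m := 1) (by norm_num) β).differentiableOn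
    one_ne_zero z hz) hz]
  exact pd_congr (fun y hy => pd_component hT (hW.differentiableOn two_ne_zero y hy) hy β I) hz α

/-- Product rule with (∂_t + ∂_r) r = 1, valid off the origin where r is differentiable. -/
theorem outD_rmul_component (hT : 0 < T) (hW : ContDiffOn ℝ 2 W (slab T)) (hz : z ∈ slab T)
    (hx : z.2 ≠ 0) (I : Fin M) :
    outD T (rmul W) z I = outR T (fun z => W z I) z := by
  have hr : ‖z.2‖ ≠ 0 := by simpa using hx
  have hd : DifferentiableWithinAt ℝ (rmul W) (slab T) z :=
    ((C1Off.norm (T := T) z hz hx).differentiableWithinAt one_ne_zero).smul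
      (hW.differentiableOn two_ne_zero z hz)
  rw [outD_component hT hd hz, outR_eq hx]
  have hw := HasPD.of_contDiffOn (contDiffOn_component hW I) (by norm_num) hz
  have h : HasPD T (fun z => rmul W z I) z fun α => ‖z.2‖ * pd T α (fun z => W z I) z
      + W z I * ![0, z.2 0 / ‖z.2‖, z.2 1 / ‖z.2‖, z.2 2 / ‖z.2‖] α := (HasPD.radius hx).mul hw
  have hp := h.pd_eq hT hz
  have h2 := norm_sq_eq z.2
  simp only [outD, dr, hp, Fin.sum_univ_three, smul_eq_mul, Fin.succ_zero_eq_one,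
    Fin.succ_one_eq_two, show (2 : Fin 3).succ = 3 from rfl, Matrix.cons_val]
  field_simp
  linear_combination (-W z I) * h2

end Components

/-! ### Sums of lengths against sums of squares of components -/

section Comparison

/-- The components of `Z^μ u`. -/
def zComp {M : ℕ} (T : ℝ) (u : SpaceTime → Vec M) (μ : Fin 8 → ℕ) (I : Fin M) (z : SpaceTime) : ℝ :=
  Zpow T μ u z I

theorem abs_component_le {M : ℕ} (v : Vec M) (I : Fin M) : |v I| ≤ ‖v‖ := PiLp.norm_apply_le v I

variable {N M : ℕ} {T : ℝ} {u : SpaceTime → Vec M} {h : Pert M} {z : SpaceTime}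

theorem zAbs_nonneg (z : SpaceTime) : 0 ≤ zAbs T N u z := Finset.sum_nonneg fun _ _ => norm_nonneg _

theorem zGrad_nonneg (z : SpaceTime) : 0 ≤ zGrad T N u z :=
  Finset.sum_nonneg fun _ _ => Real.sqrt_nonneg _

theorem zGood_nonneg (z : SpaceTime) : 0 ≤ zGood T N u z :=
  Finset.sum_nonneg fun _ _ => Real.sqrt_nonneg _

theorem zAng_nonneg (z : SpaceTime) : 0 ≤ zAng T N u z :=
  Finset.sum_nonneg fun _ _ => Real.sqrt_nonneg _

theorem zOut_nonneg (z : SpaceTime) : 0 ≤ zOut T N u z := Finset.sum_nonneg fun _ _ => norm_nonneg _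

theorem abs_zComp_le {μ : Fin 8 → ℕ} (hμ : μ ∈ multiIdx N) (I : Fin M) :
    |zComp T u μ I z| ≤ zAbs T N u z :=
  (abs_component_le _ I).trans
    (Finset.single_le_sum (f := fun μ => ‖Zpow T μ u z‖) (fun _ _ => norm_nonneg _) hμ)

/-- Cauchy–Schwarz over the multi-indices; its cardinality factor is where the constant acquires its
dependence on N. -/
theorem zAbs_sq_le : zAbs T N u z ^ 2
    ≤ (multiIdx N).card * ∑ μ ∈ multiIdx N, ∑ I, zComp T u μ I z ^ 2 := by
  refine (sq_sum_le_card_mul_sum_sq).trans (le_of_eq ?_)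
  simp only [EuclideanSpace.real_norm_sq_eq, zComp]

theorem contDiffOn_zComp
    (hW : ∀ μ ∈ multiIdx N, ContDiffOn ℝ 2 (Zpow T μ u) (slab T)) : ∀ μ ∈ multiIdx N, ∀ I, ContDiffOn ℝ 2 (zComp T u μ I) (slab T) :=
  fun μ hμ I => contDiffOn_component (hW μ hμ) I

theorem gradAbs_sq (hT : 0 < T)
    (hW : ∀ μ ∈ multiIdx N, ContDiffOn ℝ 2 (Zpow T μ u) (slab T)) (hz : z ∈ slab T) {μ : Fin 8 → ℕ} (hμ : μ ∈ multiIdx N) :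
    gradAbs T (Zpow T μ u) z ^ 2 = ∑ I, ∑ α, pd T α (zComp T u μ I) z ^ 2 := by
  rw [gradAbs, Real.sq_sqrt (Finset.sum_nonneg fun _ _ => sq_nonneg _), Finset.sum_comm]
  refine Finset.sum_congr rfl fun α _ => ?_
  rw [EuclideanSpace.real_norm_sq_eq]
  refine Finset.sum_congr rfl fun I _ => ?_
  rw [pd_component hT ((hW μ hμ).differentiableOn two_ne_zero z hz) hz]
  rfl

theorem goodAbs_sq (hT : 0 < T)
    (hW : ∀ μ ∈ multiIdx N, ContDiffOn ℝ 2 (Zpow T μ u) (slab T)) (hz : z ∈ slab T) {μ : Fin 8 → ℕ} (hμ : μ ∈ multiIdx N) :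
    goodAbs T (Zpow T μ u) z ^ 2
      = ∑ I, (outD T (zComp T u μ I) z ^ 2 + angSq T (zComp T u μ I) z) := by
  have hd := (hW μ hμ).differentiableOn two_ne_zero z hz
  rw [goodAbs, Real.sq_sqrt (by positivity), Finset.sum_add_distrib]
  simp only [angSq]
  rw [Finset.sum_comm, EuclideanSpace.real_norm_sq_eq]
  simp only [EuclideanSpace.real_norm_sq_eq, outD_component hT hd hz, ang_component hT hd hz]
  rfl

theorem norm_outD_rmul_sq (hT : 0 < T)
    (hW : ∀ μ ∈ multiIdx N, ContDiffOn ℝ 2 (Zpow T μ u) (slab T)) (hz : z ∈ slab T) (hx : z.2 ≠ 0) {μ : Fin 8 → ℕ} (hμ : μ ∈ multiIdx N) :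
    ‖outD T (rmul (Zpow T μ u)) z‖ ^ 2 = ∑ I, outR T (zComp T u μ I) z ^ 2 := by
  rw [EuclideanSpace.real_norm_sq_eq]
  simp only [outD_rmul_component hT (hW μ hμ) hz hx]
  rfl

theorem sum_pd_sq_le (hT : 0 < T)
    (hW : ∀ μ ∈ multiIdx N, ContDiffOn ℝ 2 (Zpow T μ u) (slab T)) (hz : z ∈ slab T) :
    ∑ μ ∈ multiIdx N, ∑ I, ∑ α, pd T α (zComp T u μ I) z ^ 2 ≤ zGrad T N u z ^ 2 := by
  rw [← Finset.sum_congr rfl fun μ hμ => gradAbs_sq hT hW hz hμ]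
  exact Finset.sum_sq_le_sq_sum_of_nonneg fun _ _ => Real.sqrt_nonneg _

theorem sum_pd_sq_le_single (hT : 0 < T)
    (hW : ∀ μ ∈ multiIdx N, ContDiffOn ℝ 2 (Zpow T μ u) (slab T)) (hz : z ∈ slab T) {μ : Fin 8 → ℕ} (hμ : μ ∈ multiIdx N) (I : Fin M) :
    ∑ α, pd T α (zComp T u μ I) z ^ 2 ≤ zGrad T N u z ^ 2 := by
  refine le_trans ?_ (sum_pd_sq_le hT hW hz)
  refine le_trans ?_ (Finset.single_le_sum (f := fun μ => ∑ I, ∑ α, pd T α (zComp T u μ I) z ^ 2)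
    (fun _ _ => Finset.sum_nonneg fun _ _ => Finset.sum_nonneg fun _ _ => sq_nonneg _) hμ)
  exact Finset.single_le_sum (f := fun I => ∑ α, pd T α (zComp T u μ I) z ^ 2)
    (fun _ _ => Finset.sum_nonneg fun _ _ => sq_nonneg _) (Finset.mem_univ I)

theorem abs_pd_zComp_le (hT : 0 < T)
    (hW : ∀ μ ∈ multiIdx N, ContDiffOn ℝ 2 (Zpow T μ u) (slab T)) (hz : z ∈ slab T) {μ : Fin 8 → ℕ} (hμ : μ ∈ multiIdx N) (I : Fin M)
    (α : Fin 4) : |pd T α (zComp T u μ I) z| ≤ zGrad T N u z := by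
  refine abs_le_of_sq_le_sq ?_ (zGrad_nonneg z)
  refine le_trans ?_ (sum_pd_sq_le_single hT hW hz hμ I)
  exact Finset.single_le_sum (f := fun α => pd T α (zComp T u μ I) z ^ 2)
    (fun _ _ => sq_nonneg _) (Finset.mem_univ α)

theorem abs_outR_zComp_le (hT : 0 < T)
    (hW : ∀ μ ∈ multiIdx N, ContDiffOn ℝ 2 (Zpow T μ u) (slab T)) (hz : z ∈ slab T) (hx : z.2 ≠ 0) {μ : Fin 8 → ℕ} (hμ : μ ∈ multiIdx N)
    (I : Fin M) : |outR T (zComp T u μ I) z| ≤ zOut T N u z := by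
  have h1 : outR T (zComp T u μ I) z = outD T (rmul (Zpow T μ u)) z I :=
    (outD_rmul_component hT (hW μ hμ) hz hx I).symm
  rw [h1]
  exact (abs_component_le _ I).trans (Finset.single_le_sum
    (f := fun μ => ‖outD T (rmul (Zpow T μ u)) z‖) (fun _ _ => norm_nonneg _) hμ)

theorem zGood_sq_le (hT : 0 < T)
    (hW : ∀ μ ∈ multiIdx N, ContDiffOn ℝ 2 (Zpow T μ u) (slab T)) (hz : z ∈ slab T) : zGood T N u z ^ 2 ≤ (multiIdx N).card
    * ∑ μ ∈ multiIdx N, ∑ I, (outD T (zComp T u μ I) z ^ 2 + angSq T (zComp T u μ I) z) := by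
  rw [← Finset.sum_congr rfl fun μ hμ => goodAbs_sq hT hW hz hμ]
  exact sq_sum_le_card_mul_sum_sq

theorem sum_good_le (hT : 0 < T)
    (hW : ∀ μ ∈ multiIdx N, ContDiffOn ℝ 2 (Zpow T μ u) (slab T)) (hz : z ∈ slab T) :
    ∑ μ ∈ multiIdx N, ∑ I, (outD T (zComp T u μ I) z ^ 2 + angSq T (zComp T u μ I) z)
      ≤ zGood T N u z ^ 2 := by
  rw [← Finset.sum_congr rfl fun μ hμ => goodAbs_sq hT hW hz hμ]
  exact Finset.sum_sq_le_sq_sum_of_nonneg fun _ _ => Real.sqrt_nonneg _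

theorem zOut_sq_le (hT : 0 < T)
    (hW : ∀ μ ∈ multiIdx N, ContDiffOn ℝ 2 (Zpow T μ u) (slab T)) (hz : z ∈ slab T) (hx : z.2 ≠ 0) : zOut T N u z ^ 2 ≤ (multiIdx N).card
    * ∑ μ ∈ multiIdx N, ∑ I, outR T (zComp T u μ I) z ^ 2 := by
  rw [← Finset.sum_congr rfl fun μ hμ => norm_outD_rmul_sq hT hW hz hx hμ]
  exact sq_sum_le_card_mul_sum_sq

theorem pairDensity_eq (hT : 0 < T)
    (hW : ∀ μ ∈ multiIdx N, ContDiffOn ℝ 2 (Zpow T μ u) (slab T)) (hz : z ∈ slab T) (hx : z.2 ≠ 0) (U : ℝ) :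
    pairDensity T N h u U z = pairSum T (multiIdx N) h (zComp T u) U z := by
  rw [pairDensity, pairSum]
  congr 1
  refine Finset.sum_congr rfl fun μ hμ => Finset.sum_congr rfl fun I _ => ?_
  rw [outD_rmul_component hT (hW μ hμ) hz hx, boxh]
  simp only [pd_pd_component hT (hW μ hμ) hz]
  rfl

/-- The two integrands agree off x = 0, a null set, so all integrals over balls agree. -/
theorem absIntegral_pairDensity (hT : 0 < T)
    (hW : ∀ μ ∈ multiIdx N, ContDiffOn ℝ 2 (Zpow T μ u) (slab T)) {τ : ℝ} (hτ : τ ∈ Icc 0 T) (U : ℝ) :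
    absIntegral τ (pairDensity T N h u U) = absIntegral τ (pairSum T (multiIdx N) h (zComp T u) U) := by
  rw [absIntegral, absIntegral]
  refine congrArg (fun f => limsup f atTop) (funext fun R => ?_)
  congr 1
  refine setIntegral_congr_ae (measurableSet_Icc.prod Metric.isOpen_ball.measurableSet) ?_
  have h1 := (ae_restrict_iff' (measurableSet_slab τ)).1 (ae_slab_ne_zero τ)
  filter_upwards [h1] with z hz hzm
  have h2 := hz ⟨hzm.1, mem_univ _⟩
  exact pairDensity_eq hT hW (slab_subset hτ.2 h2.1) h2.2 U

theorem contOff_zGrad (hT : 0 < T)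
    (hW : ∀ μ ∈ multiIdx N, ContDiffOn ℝ 2 (Zpow T μ u) (slab T)) : ContOff T (zGrad T N u) := by
  refine ContOff.sum fun μ hμ => ?_
  refine ContOff.of_continuousOn (ContinuousOn.sqrt (continuousOn_finsetSum _ fun α _ => ?_))
  exact (contDiffOn_pd hT (hW μ hμ) (m := 1) (by norm_num) α).continuousOn.norm.pow 2

theorem aemeasurable_zOut (hT : 0 < T)
    (hW : ∀ μ ∈ multiIdx N, ContDiffOn ℝ 2 (Zpow T μ u) (slab T)) : AEMeasurable (zOut T N u) (volume.restrict (slab T)) := by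
  have h1 : ContOff T fun z => ∑ μ ∈ multiIdx N,
      Real.sqrt (∑ I, outR T (zComp T u μ I) z ^ 2) :=
    ContOff.sum fun μ hμ z hz hx => Real.continuous_sqrt.continuousAt.comp_continuousWithinAt
      ((ContOff.sum fun I _ => ((C1Off.outR hT (contDiffOn_zComp hW μ hμ I)).contOff.pow 2)) z hz hx)
  refine h1.aemeasurable.congr ?_
  filter_upwards [ae_slab_ne_zero T] with z hz
  refine Finset.sum_congr rfl fun μ hμ => ?_
  rw [← norm_outD_rmul_sq hT hW hz.1 hz.2 hμ, Real.sqrt_sq (norm_nonneg _)]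

end Comparison

/-! ### Bookkeeping for integrals in [0, ∞] -/

section Lintegral

variable {α : Type*} [MeasurableSpace α] {μ : Measure α} {f a b : α → ℝ} {A B : ℝ≥0∞}

/-- Additivity of the lower integral needs only one measurable summand, so `b` may be arbitrary;
unproved measurability is avoided by putting that term last. -/
theorem lintegral_le_add_of_le (ha : AEMeasurable a μ) (h : ∀ᵐ x ∂μ, f x ≤ a x + b x)
    (hA : ∫⁻ x, ENNReal.ofReal (a x) ∂μ ≤ A) (hB : ∫⁻ x, ENNReal.ofReal (b x) ∂μ ≤ B) :
    ∫⁻ x, ENNReal.ofReal (f x) ∂μ ≤ A + B := by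
  refine le_trans ?_ (add_le_add hA hB)
  rw [← lintegral_add_left' ha.ennreal_ofReal]
  refine lintegral_mono_ae (h.mono fun x hx => ?_)
  exact (ENNReal.ofReal_le_ofReal hx).trans ENNReal.ofReal_add_le

theorem lintegral_le_mul_of_le (n : ℕ) (h : ∀ᵐ x ∂μ, f x ≤ n * a x)
    (hA : ∫⁻ x, ENNReal.ofReal (a x) ∂μ ≤ A) : ∫⁻ x, ENNReal.ofReal (f x) ∂μ ≤ n * A := by
  refine le_trans ?_ (mul_le_mul_right hA n)
  rw [← lintegral_const_mul' _ _ (ENNReal.natCast_ne_top n)]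
  refine lintegral_mono_ae (h.mono fun x hx => ?_)
  rw [← ENNReal.ofReal_natCast n, ← ENNReal.ofReal_mul n.cast_nonneg]
  exact ENNReal.ofReal_le_ofReal hx

theorem lintegral_sum_le {ι : Type*} (s : Finset ι) {f : ι → α → ℝ}
    (hf : ∀ i ∈ s, AEMeasurable (f i) μ) :
    ∫⁻ x, ENNReal.ofReal (∑ i ∈ s, f i x) ∂μ ≤ ∑ i ∈ s, ∫⁻ x, ENNReal.ofReal (f i x) ∂μ := by
  classical
  induction s using Finset.induction_on with
  | empty => simp
  | insert i s hi ih =>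
    simp only [Finset.sum_insert hi]
    exact lintegral_le_add_of_le (hf i (Finset.mem_insert_self _ _))
      (Eventually.of_forall fun x => le_rfl) le_rfl
      (ih fun j hj => hf j (Finset.mem_insert_of_mem hj))

theorem lintegral_sum_sum_le {ι : Type*} (s : Finset ι) {M : ℕ} {f : ι → Fin M → α → ℝ}
    (hf : ∀ i ∈ s, ∀ I, AEMeasurable (f i I) μ)
    (hA : ∀ i ∈ s, ∀ I, ∫⁻ x, ENNReal.ofReal (f i I x) ∂μ ≤ A) :
    ∫⁻ x, ENNReal.ofReal (∑ i ∈ s, ∑ I, f i I x) ∂μ ≤ ((s.card * M : ℕ) : ℝ≥0∞) * A := by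
  refine (lintegral_sum_le s fun i hi => Finset.aemeasurable_fun_sum _ fun I _ => hf i hi I).trans ?_
  calc _ ≤ ∑ i ∈ s, ∑ _I : Fin M, A := Finset.sum_le_sum fun i hi =>
        (lintegral_sum_le _ fun I _ => hf i hi I).trans (Finset.sum_le_sum fun I _ => hA i hi I)
    _ = _ := by simp [mul_assoc]

end Lintegral

/-! ### The right-hand side of the energy estimate -/

section Sources

variable {N M : ℕ} {T τ U : ℝ} {u : SpaceTime → Vec M} {h : Pert M} {R : ℝ≥0∞}

theorem contOff_hAbs (hh : Admissible T h) : ContOff T (hAbs h) :=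
  ContOff.of_continuousOn (continuousOn_finsetSum _ fun I _ => continuousOn_finsetSum _ fun J _ =>
    continuousOn_finsetSum _ fun α _ => continuousOn_finsetSum _ fun β _ =>
      (hh.contDiff I J α β).continuousOn.abs)

theorem contOff_hGrad (hT : 0 < T) (hh : Admissible T h) : ContOff T (hGrad T h) :=
  ContOff.of_continuousOn (continuousOn_finsetSum _ fun I _ => continuousOn_finsetSum _ fun J _ =>
    continuousOn_finsetSum _ fun α _ => continuousOn_finsetSum _ fun β _ =>
      continuousOn_finsetSum _ fun γ _ =>
        (contDiffOn_pd hT (hh.contDiff I J α β) (m := 0) (by norm_num) γ).continuousOn.abs)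

theorem hOut_nonneg (h : Pert M) (z : SpaceTime) : 0 ≤ hOut T h z :=
  Finset.sum_nonneg fun _ _ => Finset.sum_nonneg fun _ _ => Finset.sum_nonneg fun _ _ =>
    Finset.sum_nonneg fun _ _ => abs_nonneg _

/-- V = (∂_t + ∂_r)w + w/r, so V² costs a factor 2, and r times the energy density is bounded by the
initial data norm. -/
theorem norm_mul_eSum_le (hT : 0 < T)
    (hW : ∀ μ ∈ multiIdx N, ContDiffOn ℝ 2 (Zpow T μ u) (slab T)) {z : SpaceTime} (hz : z ∈ slab T)
    (hx : z.2 ≠ 0) : ‖z.2‖ * eSum T (multiIdx N) (zComp T u) z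
      ≤ 2 * (‖z.2‖⁻¹ * (zAbs T N u z + ‖z.2‖ * zGood T N u z) ^ 2) := by
  have hr : 0 < ‖z.2‖ := by simpa using hx
  have h1 := sum_good_le hT hW hz
  have h2 : ∑ μ ∈ multiIdx N, ∑ I, zComp T u μ I z ^ 2 ≤ zAbs T N u z ^ 2 := by
    have : ∀ μ, ∑ I, zComp T u μ I z ^ 2 = ‖Zpow T μ u z‖ ^ 2 := fun μ =>
      (EuclideanSpace.real_norm_sq_eq _).symm
    simp only [this]
    exact Finset.sum_sq_le_sq_sum_of_nonneg fun _ _ => norm_nonneg _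
  have h3 : eSum T (multiIdx N) (zComp T u) z ≤ 2 * (∑ μ ∈ multiIdx N, ∑ I,
      (outD T (zComp T u μ I) z ^ 2 + angSq T (zComp T u μ I) z))
      + 2 / ‖z.2‖ ^ 2 * ∑ μ ∈ multiIdx N, ∑ I, zComp T u μ I z ^ 2 := by
    simp only [eSum, Finset.mul_sum, ← Finset.sum_add_distrib]
    refine Finset.sum_le_sum fun μ _ => Finset.sum_le_sum fun I _ => ?_
    have h4 := angSq_nonneg (T := T) (w := zComp T u μ I) (z := z)
    have e : outR T (zComp T u μ I) z / ‖z.2‖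
        = outD T (zComp T u μ I) z + zComp T u μ I z / ‖z.2‖ := by
      rw [outR_eq hx]; field_simp
    have e2 : 2 / ‖z.2‖ ^ 2 * zComp T u μ I z ^ 2 = 2 * (zComp T u μ I z / ‖z.2‖) ^ 2 := by ring
    rw [eDen, e, e2]
    nlinarith [sq_nonneg (outD T (zComp T u μ I) z - zComp T u μ I z / ‖z.2‖)]
  have h5 := zAbs_nonneg (T := T) (N := N) (u := u) z
  have h6 := zGood_nonneg (T := T) (N := N) (u := u) z
  calc _ ≤ ‖z.2‖ * (2 * zGood T N u z ^ 2 + 2 / ‖z.2‖ ^ 2 * zAbs T N u z ^ 2) := by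
        refine mul_le_mul_of_nonneg_left (h3.trans ?_) hr.le
        gcongr
    _ = 2 * (‖z.2‖⁻¹ * (zAbs T N u z ^ 2 + (‖z.2‖ * zGood T N u z) ^ 2)) := by field_simp; ring
    _ ≤ _ := by
        gcongr
        have : 0 ≤ zAbs T N u z * (‖z.2‖ * zGood T N u z) := by positivity
        linarith [add_sq (zAbs T N u z) (‖z.2‖ * zGood T N u z)]

/-- The right-hand side of the energy estimate is controlled by any common bound of the data, the
boundary terms, the signed integral and the four perturbative integrals. -/
theorem sources_le (hT : 0 < T) (hτ : τ ∈ Icc 0 T) (hh : Admissible T h)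
    (hW : ∀ μ ∈ multiIdx N, ContDiffOn ℝ 2 (Zpow T μ u) (slab T))
    (hD : ∫⁻ x, ENNReal.ofReal (‖x‖⁻¹ * (zAbs T N u (0, x) + ‖x‖ * zGood T N u (0, x)) ^ 2) ≤ R)
    (hS : ∀ t ∈ Icc 0 T, ∫⁻ x, ENNReal.ofReal (‖x‖ * hAbs h (t, x) * zGrad T N u (t, x)
      * (zGrad T N u (t, x) + zAbs T N u (t, x) / ‖x‖)) ≤ R)
    (hP : absIntegral τ (pairDensity T N h u U) ≤ R)
    (h1 : ∫⁻ z in slab T, ENNReal.ofReal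
      ((hGrad T h z + hAbs h z / ‖z.2‖) * zGrad T N u z * zOut T N u z) ≤ R)
    (h2 : ∫⁻ z in slab T, ENNReal.ofReal
      (hAbs h z * zGrad T N u z * (zAng T N u z + zAbs T N u z / ‖z.2‖)) ≤ R)
    (h3 : ∫⁻ z in slab T, ENNReal.ofReal
      (hAbs h z * (jb (z.1 - ‖z.2‖))⁻¹ * zGrad T N u z * zOut T N u z) ≤ R)
    (h4 : ∫⁻ z in slab T, ENNReal.ofReal
      (‖z.2‖ * (hOut T h z + hAbs h z / ‖z.2‖) * zGrad T N u z ^ 2) ≤ R) :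
    (∫⁻ x, ENNReal.ofReal (3 / 2 * (‖x‖ * eSum T (multiIdx N) (zComp T u) (0, x))
        + (multiIdx N).card * (14 * (‖x‖ * hAbs h (0, x) * zGrad T N u (0, x)
          * (zGrad T N u (0, x) + zAbs T N u (0, x) / ‖x‖)))))
      + (∫⁻ x, ENNReal.ofReal ((multiIdx N).card * (14 * (‖x‖ * hAbs h (τ, x) * zGrad T N u (τ, x)
          * (zGrad T N u (τ, x) + zAbs T N u (τ, x) / ‖x‖)))))
      + absIntegral τ (pairSum T (multiIdx N) h (zComp T u) U)
      + (∫⁻ z in slab τ, ENNReal.ofReal ((multiIdx N).card *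
          (3 * (hGrad T h z * (zGrad T N u z * zOut T N u z))
            + 9 * (hAbs h z * (jb (z.1 - ‖z.2‖))⁻¹ * (zGrad T N u z * zOut T N u z))
            + 14 * ((‖z.2‖ * hOut T h z + hAbs h z) * zGrad T N u z ^ 2))))
      + 6 * ∫⁻ z in slab τ, ENNReal.ofReal ((multiIdx N).card *
          (14 * (hAbs h z * zGrad T N u z ^ 2)
            + 3 * (hAbs h z * zGrad T N u z * (zAbs T N u z / ‖z.2‖))))
    ≤ ((4 + 156 * (multiIdx N).card : ℕ) : ℝ≥0∞) * R := by
  set k := (multiIdx N).card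
  have h0T : (0 : ℝ) ∈ Icc 0 T := ⟨le_rfl, hT.le⟩
  have hst : ∀ᵐ x : E3, x ≠ 0 := ae_ne_zero
  have hcZ := contOff_zGrad (N := N) hT hW
  have hmO := aemeasurable_zOut (N := N) hT hW
  have hcH := contOff_hAbs hh
  have hcE := contOff_eSum hT (contDiffOn_zComp hW)
  have hbd : ∀ t ∈ Icc 0 T, ∫⁻ x, ENNReal.ofReal (k * (14 * (‖x‖ * hAbs h (t, x)
      * zGrad T N u (t, x) * (zGrad T N u (t, x) + zAbs T N u (t, x) / ‖x‖))))
      ≤ ((14 * k : ℕ) : ℝ≥0∞) * R := fun t ht =>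
    lintegral_le_mul_of_le _ (Eventually.of_forall fun x => le_of_eq (by push_cast; ring)) (hS t ht)
  have b1 : ∫⁻ x, ENNReal.ofReal (3 / 2 * (‖x‖ * eSum T (multiIdx N) (zComp T u) (0, x))
      + k * (14 * (‖x‖ * hAbs h (0, x) * zGrad T N u (0, x)
          * (zGrad T N u (0, x) + zAbs T N u (0, x) / ‖x‖))))
      ≤ ((3 : ℕ) : ℝ≥0∞) * R + ((14 * k : ℕ) : ℝ≥0∞) * R := by
    refine lintegral_le_add_of_le (aemeasurable_of_continuousOn_ne
      (((C1Off.const (3 / 2)).contOff.mul (C1Off.norm.contOff.mul hcE)).continuousOn_slice h0T))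
      (Eventually.of_forall fun x => le_rfl) (lintegral_le_mul_of_le 3 ?_ hD) (hbd 0 h0T)
    filter_upwards [hst] with x hx
    have := norm_mul_eSum_le (N := N) hT hW (z := (0, x)) ⟨h0T, mem_univ _⟩ hx
    simp only at this
    push_cast
    linarith
  have b2 := hbd τ hτ
  have b3 : absIntegral τ (pairSum T (multiIdx N) h (zComp T u) U) ≤ R := by
    rwa [← absIntegral_pairDensity hT hW hτ]
  have hsub : (volume : Measure SpaceTime).restrict (slab τ) ≤ volume.restrict (slab T) :=
    Measure.restrict_mono (slab_subset hτ.2) le_rfl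
  have hpt := ae_slab_ne_zero T
  have b4 : ∫⁻ z in slab T, ENNReal.ofReal (k *
          (3 * (hGrad T h z * (zGrad T N u z * zOut T N u z))
            + 9 * (hAbs h z * (jb (z.1 - ‖z.2‖))⁻¹ * (zGrad T N u z * zOut T N u z))
            + 14 * ((‖z.2‖ * hOut T h z + hAbs h z) * zGrad T N u z ^ 2)))
      ≤ ((3 * k : ℕ) : ℝ≥0∞) * R + (((9 * k : ℕ) : ℝ≥0∞) * R + ((14 * k : ℕ) : ℝ≥0∞) * R) := by
    have hmj : AEMeasurable (fun z : SpaceTime => (jb (z.1 - ‖z.2‖))⁻¹)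
        (volume.restrict (slab T)) := by
      unfold jb
      fun_prop
    refine lintegral_le_add_of_le
      (a := fun z => (3 * k : ℕ) * (hGrad T h z * (zGrad T N u z * zOut T N u z)))
      (b := fun z => (9 * k : ℕ) * (hAbs h z * (jb (z.1 - ‖z.2‖))⁻¹ * zGrad T N u z * zOut T N u z)
        + (14 * k : ℕ) * (‖z.2‖ * (hOut T h z + hAbs h z / ‖z.2‖) * zGrad T N u z ^ 2))
      (((contOff_hGrad hT hh).aemeasurable.mul (hcZ.aemeasurable.mul hmO)).const_mul _) ?_
      (lintegral_le_mul_of_le _ ?_ h1)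
      (lintegral_le_add_of_le
        ((((hcH.aemeasurable.mul hmj).mul hcZ.aemeasurable).mul hmO).const_mul _)
        (Eventually.of_forall fun z => le_rfl)
        (lintegral_le_mul_of_le _ (Eventually.of_forall fun z => le_rfl) h3)
        (lintegral_le_mul_of_le _ (Eventually.of_forall fun z => le_rfl) h4))
    · filter_upwards [hpt] with z hz
      have hr : ‖z.2‖ ≠ 0 := by simpa using hz.2
      refine le_of_eq ?_
      push_cast
      field_simp
      ring
    · filter_upwards [hpt] with z hz
      have hr : 0 < ‖z.2‖ := by simpa using hz.2
      have k1 := hAbs_nonneg h z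
      have k2 := zGrad_nonneg (T := T) (N := N) (u := u) z
      have k3 := zOut_nonneg (T := T) (N := N) (u := u) z
      refine mul_le_mul_of_nonneg_left ?_ (Nat.cast_nonneg _)
      rw [mul_assoc]
      refine mul_le_mul_of_nonneg_right ?_ (mul_nonneg k2 k3)
      linarith [div_nonneg k1 hr.le]
  -- The flux errors are already among the sources: |h| |∂w|² is r (|h|/r) |∂w|², and |h| |∂w| |w|/r
  -- is part of the second perturbative integral.
  have b5 : ∫⁻ z in slab T, ENNReal.ofReal (k *
          (14 * (hAbs h z * zGrad T N u z ^ 2)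
            + 3 * (hAbs h z * zGrad T N u z * (zAbs T N u z / ‖z.2‖))))
      ≤ ((14 * k : ℕ) : ℝ≥0∞) * R + ((3 * k : ℕ) : ℝ≥0∞) * R := by
    refine lintegral_le_add_of_le
      (a := fun z => (14 * k : ℕ) * (hAbs h z * zGrad T N u z ^ 2))
      (b := fun z => (3 * k : ℕ) * (hAbs h z * zGrad T N u z * (zAbs T N u z / ‖z.2‖)))
      ((hcH.mul (hcZ.pow 2)).aemeasurable.const_mul _)
      (Eventually.of_forall fun z => le_of_eq (by push_cast; ring))
      (lintegral_le_mul_of_le _ ?_ h4) (lintegral_le_mul_of_le _ ?_ h2)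
    · filter_upwards [hpt] with z hz
      have hr : 0 < ‖z.2‖ := by simpa using hz.2
      have k1 := hOut_nonneg (T := T) h z
      gcongr
      have : ‖z.2‖ * (hOut T h z + hAbs h z / ‖z.2‖) = ‖z.2‖ * hOut T h z + hAbs h z := by
        field_simp
      rw [this]
      linarith [mul_nonneg hr.le k1]
    · filter_upwards [hpt] with z hz
      have k1 := hAbs_nonneg h z
      have k2 := zGrad_nonneg (T := T) (N := N) (u := u) z
      have k3 := zAng_nonneg (T := T) (N := N) (u := u) z
      gcongr
      linarith
  -- The count: 3 + 1 = 4, and 14 + 14 + (3 + 9 + 14) + 6 · (14 + 3) = 156.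
  calc _ ≤ (((3 : ℕ) : ℝ≥0∞) * R + ((14 * k : ℕ) : ℝ≥0∞) * R) + ((14 * k : ℕ) : ℝ≥0∞) * R + R
        + (((3 * k : ℕ) : ℝ≥0∞) * R + (((9 * k : ℕ) : ℝ≥0∞) * R + ((14 * k : ℕ) : ℝ≥0∞) * R))
        + 6 * (((14 * k : ℕ) : ℝ≥0∞) * R + ((3 * k : ℕ) : ℝ≥0∞) * R) :=
        add_le_add (add_le_add (add_le_add (add_le_add b1 b2) b3)
          ((lintegral_mono' hsub le_rfl).trans b4))
          (mul_le_mul_right ((lintegral_mono' hsub le_rfl).trans b5) 6)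
    _ = _ := by push_cast; ring

end Sources

/-! ### Squared norms as integrals -/

section Norms

theorem eLpNorm_two_sq {α : Type*} [MeasurableSpace α] {μ : Measure α} (f : α → ℝ) :
    eLpNorm f 2 μ ^ 2 = ∫⁻ x, ENNReal.ofReal (f x ^ 2) ∂μ := by
  have h := eLpNorm_nnreal_pow_eq_lintegral (f := f) (μ := μ) (p := 2) two_ne_zero
  simp only [NNReal.coe_ofNat, ENNReal.coe_ofNat, ENNReal.rpow_ofNat] at h
  rw [h]
  refine lintegral_congr fun x => ?_
  rw [Real.enorm_eq_ofReal_abs, ← ENNReal.ofReal_pow (abs_nonneg _), sq_abs]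

theorem normL2_sq (X : Set SpaceTime) (f : SpaceTime → ℝ) :
    normL2 X f ^ 2 = ∫⁻ z in X, ENNReal.ofReal (f z ^ 2) := eLpNorm_two_sq f

theorem normLinfL2_sq_le {T : ℝ} {f : SpaceTime → ℝ} {A : ℝ≥0∞}
    (h : ∀ t ∈ Icc 0 T, ∫⁻ x, ENNReal.ofReal (f (t, x) ^ 2) ≤ A) : normLinfL2 T f ^ 2 ≤ A := by
  have h2 : normLinfL2 T f ≤ A ^ (2⁻¹ : ℝ) := by
    refine iSup₂_le fun t ht => ?_
    rw [ENNReal.le_rpow_inv_iff two_pos, ENNReal.rpow_ofNat, eLpNorm_two_sq]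
    exact h t ht
  rwa [ENNReal.le_rpow_inv_iff two_pos, ENNReal.rpow_ofNat] at h2

theorem le_normLinfL2_sq {T t : ℝ} (f : SpaceTime → ℝ) (ht : t ∈ Icc 0 T) :
    ∫⁻ x, ENNReal.ofReal (f (t, x) ^ 2) ≤ normLinfL2 T f ^ 2 := by
  rw [← eLpNorm_two_sq fun x => f (t, x)]
  exact pow_le_pow_left' (le_iSup₂ (f := fun t (_ : t ∈ Icc (0 : ℝ) T) =>
    eLpNorm (fun x : E3 => f (t, x)) 2 volume) t ht) 2

theorem rpow_neg_half_sq {x : ℝ} (hx : 0 ≤ x) : (x ^ (-(1 / 2) : ℝ)) ^ 2 = x⁻¹ := by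
  rw [← Real.rpow_natCast, ← Real.rpow_mul hx]
  norm_num [Real.rpow_neg_one]

theorem rpow_half_sq {x : ℝ} (hx : 0 ≤ x) : (x ^ (1 / 2 : ℝ)) ^ 2 = x := by
  rw [← Real.rpow_natCast, ← Real.rpow_mul hx]
  norm_num

end Norms

/-! ### The regions X_U -/

section Regions

variable {T : ℝ} {j : ℕ} {z : SpaceTime}

theorem jb_pos (s : ℝ) : 0 < jb s := by unfold jb; positivity

theorem XU_subset : XU T j ⊆ slab T := by
  unfold XU
  split_ifs <;> exact fun z hz => hz.1

theorem measurableSet_XU : MeasurableSet (XU T j) := by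
  have hc : Continuous fun z : SpaceTime => z.1 - ‖z.2‖ := by fun_prop
  unfold XU
  split_ifs
  · exact (measurableSet_slab T).inter (isOpen_lt hc.abs continuous_const).measurableSet
  · exact (measurableSet_slab T).inter ((isOpen_lt continuous_const hc).inter
      (isOpen_lt hc continuous_const)).measurableSet

/-- On X_U one has |s| ≤ 2U and U ≤ 3 + |s| for s = t - r; hence 9 = (1 + 2)² and 5 = 1 + 2². -/
theorem inv_jb_le (hz : z ∈ XU T j) : (jb (z.1 - ‖z.2‖))⁻¹ ≤ 9 * sigD (2 ^ j) (z.1 - ‖z.2‖) ∧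
    (jb (z.1 - ‖z.2‖))⁻¹ ≤ 5 * lorentz (2 ^ j) (z.1 - ‖z.2‖) := by
  have hU : (1 : ℝ) ≤ 2 ^ j := one_le_pow₀ one_le_two
  have h : |z.1 - ‖z.2‖| ≤ 2 * 2 ^ j ∧ (2 ^ j : ℝ) ≤ 3 + |z.1 - ‖z.2‖| := by
    unfold XU at hz
    split_ifs at hz with hj
    · subst hj
      have := hz.2
      have := abs_nonneg (z.1 - ‖z.2‖)
      constructor <;> norm_num <;> linarith
    · have h1 := hz.2.1
      have h2 := hz.2.2
      rw [abs_of_pos (by linarith)]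
      constructor <;> linarith
  obtain ⟨h1, h2⟩ := h
  set s := z.1 - ‖z.2‖
  set U : ℝ := 2 ^ j
  have hs := abs_nonneg s
  have hU0 : 0 < U := by linarith
  have h3 : (U + |s|) ^ 2 ≤ 9 * U * (3 + |s|) := by
    calc _ ≤ (U + 2 * U) ^ 2 := by gcongr
      _ = 9 * U * U := by ring
      _ ≤ _ := by gcongr
  have h4 : U ^ 2 + s ^ 2 ≤ 5 * U * (3 + |s|) := by
    rw [← sq_abs s]
    calc _ ≤ U ^ 2 + (2 * U) ^ 2 := by gcongr
      _ = 5 * U * U := by ring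
      _ ≤ _ := by gcongr
  constructor
  · rw [jb, sigD, mul_div_assoc', inv_le_comm₀ (by positivity) (by positivity), inv_div,
      div_le_iff₀ (by positivity)]
    linarith
  · rw [jb, lorentz, mul_div_assoc', inv_le_comm₀ (by positivity) (by positivity), inv_div,
      div_le_iff₀ (by positivity)]
    linarith

end Regions

/-! ### Each term of the left-hand side -/

section Weighted

variable {N M : ℕ} {T t : ℝ} {u : SpaceTime → Vec M} {q q₁ q₂ R : ℝ≥0∞}

theorem good_le_grad {w : SpaceTime → ℝ} {z : SpaceTime} (hx : z.2 ≠ 0) :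
    outD T w z ^ 2 + angSq T w z ≤ 2 * ∑ α, pd T α w z ^ 2 := by
  have hr : ‖z.2‖ ≠ 0 := by simpa using hx
  have h1 := angSq_nonneg (T := T) (w := w) (z := z)
  have h2 : outD T w z = pd T 0 w z + xGrad T w z / ‖z.2‖ := by
    have h3 := outR_eq (T := T) (w := w) hx
    rw [outR_eq'] at h3
    field_simp
    linarith
  have e3 : xGrad T w z ^ 2 / ‖z.2‖ ^ 2 = (xGrad T w z / ‖z.2‖) ^ 2 := (div_pow _ _ _).symm
  rw [angSq_eq hx, e3] at h1 ⊢
  rw [h2, Fin.sum_univ_succ (fun α => pd T α w z ^ 2)]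
  nlinarith [sq_nonneg (pd T 0 w z - xGrad T w z / ‖z.2‖)]

theorem outD_eq {w : SpaceTime → ℝ} {z : SpaceTime} (hx : z.2 ≠ 0) :
    outD T w z = outR T w z / ‖z.2‖ - w z / ‖z.2‖ := by
  have hr : ‖z.2‖ ≠ 0 := by simpa using hx
  rw [outR_eq hx]
  field_simp
  ring

theorem norm_mul_good_le {w : SpaceTime → ℝ} {z : SpaceTime} (hx : z.2 ≠ 0) :
    ‖z.2‖ * (outD T w z ^ 2 + angSq T w z) ≤ 2 * (‖z.2‖ * eDen T w z) + 2 * (w z ^ 2 / ‖z.2‖) := by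
  have hr : 0 < ‖z.2‖ := by simpa using hx
  have h1 := angSq_nonneg (T := T) (w := w) (z := z)
  have e : w z ^ 2 / ‖z.2‖ = ‖z.2‖ * (w z / ‖z.2‖) ^ 2 := by field_simp
  rw [outD_eq hx, eDen, e]
  have h2 : (outR T w z / ‖z.2‖ - w z / ‖z.2‖) ^ 2 + angSq T w z
      ≤ 2 * ((outR T w z / ‖z.2‖) ^ 2 + angSq T w z) + 2 * (w z / ‖z.2‖) ^ 2 := by
    nlinarith [sq_nonneg (outR T w z / ‖z.2‖ + w z / ‖z.2‖)]
  have := mul_le_mul_of_nonneg_left h2 hr.le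
  linarith

theorem contOff_zComp (hW : ∀ μ ∈ multiIdx N, ContDiffOn ℝ 2 (Zpow T μ u) (slab T)) :
    ∀ μ ∈ multiIdx N, ∀ I, ContOff T (zComp T u μ I) := fun μ hμ I =>
  ContOff.of_continuousOn (contDiffOn_zComp hW μ hμ I).continuousOn

theorem contOff_sq_div (hW : ∀ μ ∈ multiIdx N, ContDiffOn ℝ 2 (Zpow T μ u) (slab T)) :
    ∀ μ ∈ multiIdx N, ∀ I, ContOff T fun z => zComp T u μ I z ^ 2 / ‖z.2‖ := fun μ hμ I => by
  simpa only [div_eq_mul_inv] using ((contOff_zComp hW μ hμ I).pow 2).mul .inv_norm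

/-- ⟨r⟩ = 3 + r: the part 3 is paid by the full gradient, the part r by the energy density and w²/r
on the slice. -/
theorem lintegral_jb_good_le (hT : 0 < T)
    (hW : ∀ μ ∈ multiIdx N, ContDiffOn ℝ 2 (Zpow T μ u) (slab T)) (ht : t ∈ Icc 0 T)
    (h1 : ∫⁻ x, ENNReal.ofReal (zGrad T N u (t, x) ^ 2) ≤ R)
    (h2 : ∫⁻ x, ENNReal.ofReal (1 / 6 * (‖x‖ * eSum T (multiIdx N) (zComp T u) (t, x))) ≤ q)
    (h3 : ∀ μ ∈ multiIdx N, ∀ I, ∫⁻ x, ENNReal.ofReal (zComp T u μ I (t, x) ^ 2 / ‖x‖) ≤ q₁) :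
    ∫⁻ x, ENNReal.ofReal ((jb ‖x‖ ^ (1 / 2 : ℝ) * zGood T N u (t, x)) ^ 2)
      ≤ ((6 * (multiIdx N).card : ℕ) : ℝ≥0∞) * R + (((12 * (multiIdx N).card : ℕ) : ℝ≥0∞) * q
        + ((2 * (multiIdx N).card : ℕ) : ℝ≥0∞) * (((multiIdx N).card * M : ℕ) * q₁)) := by
  have hz : ∀ x : E3, (t, x) ∈ slab T := fun x => ⟨ht, mem_univ _⟩
  have hcE := contOff_eSum hT (contDiffOn_zComp hW)
  set k := (multiIdx N).card with hk
  refine lintegral_le_add_of_le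
    (a := fun x => (6 * k : ℕ) * zGrad T N u (t, x) ^ 2)
    (b := fun x => (12 * k : ℕ) * (1 / 6 * (‖x‖ * eSum T (multiIdx N) (zComp T u) (t, x)))
      + (2 * k : ℕ) * ∑ μ ∈ multiIdx N, ∑ I, zComp T u μ I (t, x) ^ 2 / ‖x‖)
    (aemeasurable_of_continuousOn_ne
      (((C1Off.const _).contOff.mul ((contOff_zGrad hT hW).pow 2)).continuousOn_slice ht)) ?_
    (lintegral_le_mul_of_le _ (Eventually.of_forall fun x => le_rfl) h1)
    (lintegral_le_add_of_le (aemeasurable_of_continuousOn_ne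
      (((C1Off.const _).contOff.mul ((C1Off.const _).contOff.mul
        (C1Off.norm.contOff.mul hcE))).continuousOn_slice ht))
      (Eventually.of_forall fun x => le_rfl)
      (lintegral_le_mul_of_le _ (Eventually.of_forall fun x => le_rfl) h2)
      (lintegral_le_mul_of_le _ (Eventually.of_forall fun x => le_rfl)
        (lintegral_sum_sum_le _ (fun μ hμ I => aemeasurable_of_continuousOn_ne
          ((contOff_sq_div hW μ hμ I).continuousOn_slice ht)) h3)))
  filter_upwards [ae_ne_zero] with x hx
  have hr : 0 < ‖x‖ := by simpa using hx
  have hx' : ((t, x) : SpaceTime).2 ≠ 0 := hx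
  set S := ∑ μ ∈ multiIdx N, ∑ I,
    (outD T (zComp T u μ I) (t, x) ^ 2 + angSq T (zComp T u μ I) (t, x)) with hS
  have g1 : zGood T N u (t, x) ^ 2 ≤ k * S := zGood_sq_le hT hW (hz x)
  have g2 : S ≤ 2 * zGrad T N u (t, x) ^ 2 := by
    have := sum_pd_sq_le hT hW (hz x)
    refine le_trans ?_ (mul_le_mul_of_nonneg_left this zero_le_two)
    simp only [hS, Finset.mul_sum]
    refine Finset.sum_le_sum fun μ _ => Finset.sum_le_sum fun I _ => ?_
    have := good_le_grad (T := T) (w := zComp T u μ I) hx'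
    rwa [Finset.mul_sum] at this
  have g3 : ‖x‖ * S ≤ 2 * (‖x‖ * eSum T (multiIdx N) (zComp T u) (t, x))
      + 2 * ∑ μ ∈ multiIdx N, ∑ I, zComp T u μ I (t, x) ^ 2 / ‖x‖ := by
    simp only [hS, eSum, Finset.mul_sum, ← Finset.sum_add_distrib]
    refine Finset.sum_le_sum fun μ _ => Finset.sum_le_sum fun I _ => ?_
    have := norm_mul_good_le (T := T) (w := zComp T u μ I) hx'
    exact this
  rw [mul_pow, rpow_half_sq (jb_pos _).le, jb, abs_norm]
  push_cast
  have hk0 : (0 : ℝ) ≤ k := Nat.cast_nonneg _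
  clear_value S k
  calc (3 + ‖x‖) * zGood T N u (t, x) ^ 2 ≤ (3 + ‖x‖) * (k * S) := by gcongr
    _ = k * (3 * S + ‖x‖ * S) := by ring
    _ ≤ k * (3 * (2 * zGrad T N u (t, x) ^ 2) + (2 * (‖x‖ * eSum T (multiIdx N) (zComp T u) (t, x))
      + 2 * ∑ μ ∈ multiIdx N, ∑ I, zComp T u μ I (t, x) ^ 2 / ‖x‖)) := by gcongr
    _ = _ := by ring

/-- The map `ι` and the weight `ρ` let one statement serve time slices and space-time regions. -/
theorem lintegral_zAbs_sq_le {X : Type*} [MeasurableSpace X] {ν : Measure X} {ι : X → SpaceTime}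
    {ρ : X → ℝ} (hρ : ∀ x, 0 ≤ ρ x)
    (hm : ∀ μ ∈ multiIdx N, ∀ I, AEMeasurable (fun x => ρ x * zComp T u μ I (ι x) ^ 2) ν)
    (h : ∀ μ ∈ multiIdx N, ∀ I, ∫⁻ x, ENNReal.ofReal (ρ x * zComp T u μ I (ι x) ^ 2) ∂ν ≤ q₁) :
    ∫⁻ x, ENNReal.ofReal (ρ x * zAbs T N u (ι x) ^ 2) ∂ν
      ≤ ((multiIdx N).card : ℝ≥0∞) * (((multiIdx N).card * M : ℕ) * q₁) := by
  refine lintegral_le_mul_of_le _ (Eventually.of_forall fun x => ?_) (lintegral_sum_sum_le _ hm h)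
  simp only [← Finset.mul_sum]
  rw [mul_left_comm]
  exact mul_le_mul_of_nonneg_left zAbs_sq_le (hρ x)

theorem lintegral_good_le (hT : 0 < T)
    (hW : ∀ μ ∈ multiIdx N, ContDiffOn ℝ 2 (Zpow T μ u) (slab T))
    (h2 : ∫⁻ z in slab T, ENNReal.ofReal (eSum T (multiIdx N) (zComp T u) z) ≤ q)
    (h3 : ∀ μ ∈ multiIdx N, ∀ I, ∫⁻ z in slab T, ENNReal.ofReal
      (((outR T (zComp T u μ I) z - zComp T u μ I z) / ‖z.2‖) ^ 2) ≤ q₁) :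
    ∫⁻ z in slab T, ENNReal.ofReal (zGood T N u z ^ 2)
      ≤ ((multiIdx N).card : ℝ≥0∞) * (q + ((multiIdx N).card * M : ℕ) * q₁) := by
  have hcE := contOff_eSum hT (contDiffOn_zComp hW)
  refine lintegral_le_mul_of_le _ ?_ (lintegral_le_add_of_le hcE.aemeasurable
    (Eventually.of_forall fun x => le_rfl) h2 (lintegral_sum_sum_le _ (fun μ hμ I => ?_) h3))
  · filter_upwards [ae_slab_ne_zero T] with z hz
    refine (zGood_sq_le hT hW hz.1).trans (mul_le_mul_of_nonneg_left ?_ (Nat.cast_nonneg _))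
    simp only [eSum, ← Finset.sum_add_distrib]
    refine Finset.sum_le_sum fun μ _ => Finset.sum_le_sum fun I _ => ?_
    rw [outD_eq hz.2, eDen, sub_div]
    have := sq_nonneg (outR T (zComp T u μ I) z / ‖z.2‖)
    linarith
  · have : ContOff T fun z => ((outR T (zComp T u μ I) z - zComp T u μ I z) / ‖z.2‖) ^ 2 := by
      simpa only [div_eq_mul_inv] using
        (((C1Off.outR hT (contDiffOn_zComp hW μ hμ I)).contOff.sub
          (contOff_zComp hW μ hμ I)).mul .inv_norm).pow 2
    exact this.aemeasurable

theorem lintegral_zOut_le (hT : 0 < T)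
    (hW : ∀ μ ∈ multiIdx N, ContDiffOn ℝ 2 (Zpow T μ u) (slab T)) (j : ℕ)
    (h : ∫⁻ z in slab T, ENNReal.ofReal (1 / 6 * (eSum T (multiIdx N) (zComp T u) z
      + sigD (2 ^ j) (z.1 - ‖z.2‖) * ‖z.2‖ * vSum T (multiIdx N) (zComp T u) z)) ≤ q) :
    ∫⁻ z in XU T j, ENNReal.ofReal ((‖z.2‖ ^ (-(1 / 2) : ℝ)
        * jb (z.1 - ‖z.2‖) ^ (-(1 / 2) : ℝ) * zOut T N u z) ^ 2)
      ≤ ((54 * (multiIdx N).card : ℕ) : ℝ≥0∞) * q := by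
  refine lintegral_le_mul_of_le _ ?_ ((lintegral_mono_set XU_subset).trans h)
  have h1 : ∀ᵐ z ∂(volume.restrict (XU T j)), z ∈ slab T ∧ z.2 ≠ 0 :=
    ae_mono (Measure.restrict_mono XU_subset le_rfl) (ae_slab_ne_zero T)
  filter_upwards [h1, ae_restrict_mem measurableSet_XU] with z hz hzX
  have hr : 0 < ‖z.2‖ := by simpa using hz.2
  have hs := (inv_jb_le hzX).1
  have hk : (0 : ℝ) ≤ (multiIdx N).card := Nat.cast_nonneg _
  have hE := eSum_nonneg (T := T) (s := multiIdx N) (w := zComp T u) z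
  have hV := vSum_nonneg (T := T) (s := multiIdx N) (w := zComp T u) z
  have hO : ∑ μ ∈ multiIdx N, ∑ I, outR T (zComp T u μ I) z ^ 2
      = ‖z.2‖ ^ 2 * vSum T (multiIdx N) (zComp T u) z := by
    simp only [vSum, Finset.mul_sum]
    refine Finset.sum_congr rfl fun μ _ => Finset.sum_congr rfl fun I _ => ?_
    field_simp
  have h2 := zOut_sq_le hT hW hz.1 hz.2
  rw [hO] at h2
  rw [mul_pow, mul_pow, rpow_neg_half_sq hr.le, rpow_neg_half_sq (jb_pos _).le]
  have hj := jb_pos (z.1 - ‖z.2‖)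
  push_cast
  calc ‖z.2‖⁻¹ * (jb (z.1 - ‖z.2‖))⁻¹ * zOut T N u z ^ 2
      ≤ ‖z.2‖⁻¹ * (9 * sigD (2 ^ j) (z.1 - ‖z.2‖))
        * ((multiIdx N).card * (‖z.2‖ ^ 2 * vSum T (multiIdx N) (zComp T u) z)) := by
        have := sigD_nonneg (by positivity : (0 : ℝ) < 2 ^ j) (z.1 - ‖z.2‖)
        gcongr
    _ = 9 * ((multiIdx N).card
        * (sigD (2 ^ j) (z.1 - ‖z.2‖) * ‖z.2‖ * vSum T (multiIdx N) (zComp T u) z)) := by field_simp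
    _ ≤ 9 * ((multiIdx N).card * (eSum T (multiIdx N) (zComp T u) z
        + sigD (2 ^ j) (z.1 - ‖z.2‖) * ‖z.2‖ * vSum T (multiIdx N) (zComp T u) z)) := by
        gcongr
        linarith
    _ = _ := by ring

/-- Split 1/r = 1/(3 + r) + 3/(r (3 + r)). The first part is the logarithmic estimate; the second is
at most 3/r² with log ≥ 1 and ⟨t-r⟩ ≥ 3, so w²/r² pays for it near r = 0. -/
theorem lintegral_log_weight_le
    (hW : ∀ μ ∈ multiIdx N, ContDiffOn ℝ 2 (Zpow T μ u) (slab T)) (j : ℕ)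
    (h1 : ∀ μ ∈ multiIdx N, ∀ I, ∫⁻ z in slab T, ENNReal.ofReal (1 / 2 *
      (lorentz (2 ^ j) (z.1 - ‖z.2‖) * (zComp T u μ I z ^ 2
        / (jb ‖z.2‖ * Real.log (jb ‖z.2‖) ^ 2)))) ≤ q₁)
    (h2 : ∀ μ ∈ multiIdx N, ∀ I, ∫⁻ z in slab T, ENNReal.ofReal
      (zComp T u μ I z ^ 2 / ‖z.2‖ ^ 2) ≤ q₂) :
    ∫⁻ z in XU T j, ENNReal.ofReal ((‖z.2‖ ^ (-(1 / 2) : ℝ) * (Real.log (jb ‖z.2‖))⁻¹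
        * jb (z.1 - ‖z.2‖) ^ (-(1 / 2) : ℝ) * zAbs T N u z) ^ 2)
      ≤ ((multiIdx N).card : ℝ≥0∞) * (((multiIdx N).card * M : ℕ) * (q₂ + 10 * q₁)) := by
  have hnn : ∀ᵐ z ∂(volume.restrict (XU T j)), z ∈ slab T ∧ z.2 ≠ 0 :=
    ae_mono (Measure.restrict_mono XU_subset le_rfl) (ae_slab_ne_zero T)
  have hρ0 : ∀ z : SpaceTime, 0 ≤ ‖z.2‖⁻¹ * ((Real.log (jb ‖z.2‖))⁻¹) ^ 2 * (jb (z.1 - ‖z.2‖))⁻¹ :=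
    fun z => by
      have := jb_pos (z.1 - ‖z.2‖)
      positivity
  have hsq : ∀ z : SpaceTime, (‖z.2‖ ^ (-(1 / 2) : ℝ) * (Real.log (jb ‖z.2‖))⁻¹
        * jb (z.1 - ‖z.2‖) ^ (-(1 / 2) : ℝ) * zAbs T N u z) ^ 2
      = ‖z.2‖⁻¹ * ((Real.log (jb ‖z.2‖))⁻¹) ^ 2 * (jb (z.1 - ‖z.2‖))⁻¹ * zAbs T N u z ^ 2 :=
    fun z => by
      rw [mul_pow, mul_pow, mul_pow, rpow_neg_half_sq (norm_nonneg _),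
        rpow_neg_half_sq (jb_pos _).le]
  simp only [hsq]
  have hcm : ∀ μ ∈ multiIdx N, ∀ I, AEMeasurable (zComp T u μ I) (volume.restrict (XU T j)) :=
    fun μ hμ I => (contOff_zComp hW μ hμ I).aemeasurable.mono_measure
      (Measure.restrict_mono XU_subset le_rfl)
  refine lintegral_zAbs_sq_le (ι := fun z => z) hρ0 (fun μ hμ I => ?_) fun μ hμ I => ?_
  · refine AEMeasurable.mul ?_ ((hcm μ hμ I).pow_const 2)
    unfold jb
    fun_prop
  · refine lintegral_le_add_of_le (a := fun z => zComp T u μ I z ^ 2 / ‖z.2‖ ^ 2)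
      (b := fun z => (10 : ℕ) * (1 / 2 * (lorentz (2 ^ j) (z.1 - ‖z.2‖) * (zComp T u μ I z ^ 2
        / (jb ‖z.2‖ * Real.log (jb ‖z.2‖) ^ 2)))))
      (((hcm μ hμ I).pow_const 2).div (by fun_prop)) ?_
      ((lintegral_mono_set XU_subset).trans (h2 μ hμ I))
      (lintegral_le_mul_of_le 10 (Eventually.of_forall fun z => le_rfl)
        ((lintegral_mono_set XU_subset).trans (h1 μ hμ I)))
    filter_upwards [hnn, ae_restrict_mem measurableSet_XU] with z hz hzX
    have hr : 0 < ‖z.2‖ := by simpa using hz.2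
    have hs := (inv_jb_le hzX).2
    have hl := one_le_log_jb ‖z.2‖
    have hj := jb_pos (z.1 - ‖z.2‖)
    have hj3 : (jb (z.1 - ‖z.2‖))⁻¹ ≤ 3⁻¹ := by
      refine inv_anti₀ (by norm_num) ?_
      have := abs_nonneg (z.1 - ‖z.2‖)
      unfold jb
      linarith
    have hjr : jb ‖z.2‖ = 3 + ‖z.2‖ := by rw [jb, abs_norm]
    rw [hjr] at hl ⊢
    set ℓ := Real.log (3 + ‖z.2‖)
    set p := (jb (z.1 - ‖z.2‖))⁻¹
    have hp : 0 ≤ p := by positivity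
    set v := zComp T u μ I z
    have hl0 : 0 < ℓ := by linarith
    have e : ‖z.2‖⁻¹ * ℓ⁻¹ ^ 2 * p * v ^ 2 = p * (v ^ 2 / ((3 + ‖z.2‖) * ℓ ^ 2))
        + 3 * p * (v ^ 2 / (‖z.2‖ * (3 + ‖z.2‖) * ℓ ^ 2)) := by
      field_simp
      ring
    have h3 : p * (v ^ 2 / ((3 + ‖z.2‖) * ℓ ^ 2))
        ≤ 5 * lorentz (2 ^ j) (z.1 - ‖z.2‖) * (v ^ 2 / ((3 + ‖z.2‖) * ℓ ^ 2)) := by gcongr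
    have h4 : 3 * p * (v ^ 2 / (‖z.2‖ * (3 + ‖z.2‖) * ℓ ^ 2)) ≤ 1 * (v ^ 2 / ‖z.2‖ ^ 2) := by
      have h5 : ‖z.2‖ ^ 2 ≤ ‖z.2‖ * (3 + ‖z.2‖) * ℓ ^ 2 := by
        calc ‖z.2‖ ^ 2 = ‖z.2‖ * (0 + ‖z.2‖) * 1 ^ 2 := by ring
          _ ≤ _ := by gcongr; norm_num
      gcongr
      linarith
    rw [e]
    push_cast
    linarith

end Weighted

/-! ### Assembly of the weighted estimate -/

section Assembly

variable {N M : ℕ} {T : ℝ} {u : SpaceTime → Vec M} {h : Pert M} {R : ℝ≥0∞}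

/-- The constant of the weighted energy estimate. -/
def weightConst (N M : ℕ) : ℕ :=
  let k := (multiIdx N).card
  let c₀ := 4 + 156 * k
  let c₁ := 1 + 6 * c₀
  (6 * k + (12 * k * c₀ + 2 * k * (k * M * c₁))) + k * (k * M * c₁) + k * (6 * c₀ + k * M * c₁)
    + k * (k * M * (2 * (6 * c₀) + 2 * c₁))
    -- The final 1 keeps the constant nonzero, so that an infinite right-hand side stays infinite
    -- after multiplication.
    + (54 * k * c₀ + k * (k * M * (2 * (6 * c₀) + 2 * c₁ + 10 * (1 + 36 * c₀)))) + 1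

theorem tendsto_decay {t : ℝ} (hd : Tendsto (fun x : E3 => ‖x‖ ^ (3 / 2 : ℝ)
      * (zAbs T N u (t, x) + zGrad T N u (t, x))) (cocompact E3) (𝓝 0))
    {μ : Fin 8 → ℕ} (hμ : μ ∈ multiIdx N) (I : Fin M) :
    Tendsto (fun x => ‖x‖ ^ (3 / 2 : ℝ) * zComp T u μ I (t, x)) (cocompact E3) (𝓝 0) := by
  refine squeeze_zero_norm (fun x => ?_) hd
  have h0 : 0 ≤ ‖x‖ ^ (3 / 2 : ℝ) := by positivity
  rw [Real.norm_eq_abs, abs_mul, abs_of_nonneg h0]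
  refine mul_le_mul_of_nonneg_left ?_ h0
  exact (abs_zComp_le hμ I).trans (le_add_of_nonneg_right (zGrad_nonneg _))

/-- One finite number R bounds all sources. The order is forced: energy bounds for V and ∇̸w, then
w²/r and (∂_t + ∂_r)w, then w/r, then the logarithmic term. Finiteness of R makes the cutoff errors
vanish. -/
theorem weighted_estimate (hT : 0 < T) (hh : Admissible T h) (hR : R ≠ ∞)
    (hW : ∀ μ ∈ multiIdx N, ContDiffOn ℝ 2 (Zpow T μ u) (slab T))
    (hd : ∀ t ∈ Icc (0 : ℝ) T, Tendsto (fun x : E3 => ‖x‖ ^ (3 / 2 : ℝ)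
      * (zAbs T N u (t, x) + zGrad T N u (t, x))) (cocompact E3) (𝓝 0))
    (hD : ∫⁻ x, ENNReal.ofReal (‖x‖⁻¹ * (zAbs T N u (0, x) + ‖x‖ * zGood T N u (0, x)) ^ 2) ≤ R)
    (hS : ∀ t ∈ Icc 0 T, ∫⁻ x, ENNReal.ofReal (‖x‖ * hAbs h (t, x) * zGrad T N u (t, x)
      * (zGrad T N u (t, x) + zAbs T N u (t, x) / ‖x‖)) ≤ R)
    (hP : ∀ j : ℕ, ∀ t ∈ Icc 0 T, absIntegral t (pairDensity T N h u (2 ^ j)) ≤ R)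
    (h1 : ∫⁻ z in slab T, ENNReal.ofReal
      ((hGrad T h z + hAbs h z / ‖z.2‖) * zGrad T N u z * zOut T N u z) ≤ R)
    (h2 : ∫⁻ z in slab T, ENNReal.ofReal
      (hAbs h z * zGrad T N u z * (zAng T N u z + zAbs T N u z / ‖z.2‖)) ≤ R)
    (h3 : ∫⁻ z in slab T, ENNReal.ofReal
      (hAbs h z * (jb (z.1 - ‖z.2‖))⁻¹ * zGrad T N u z * zOut T N u z) ≤ R)
    (h4 : ∫⁻ z in slab T, ENNReal.ofReal
      (‖z.2‖ * (hOut T h z + hAbs h z / ‖z.2‖) * zGrad T N u z ^ 2) ≤ R)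
    (hE : normLinfL2 T (zGrad T N u) ^ 2 ≤ R) :
    normLinfL2 T (fun z => jb ‖z.2‖ ^ (1 / 2 : ℝ) * zGood T N u z) ^ 2
        + normLinfL2 T (fun z => ‖z.2‖ ^ (-(1 / 2) : ℝ) * zAbs T N u z) ^ 2
        + normL2 (slab T) (zGood T N u) ^ 2
        + normL2 (slab T) (fun z => ‖z.2‖⁻¹ * zAbs T N u z) ^ 2
        + (⨆ j : ℕ,
            (normL2 (XU T j) (fun z => ‖z.2‖ ^ (-(1 / 2) : ℝ)
                * jb (z.1 - ‖z.2‖) ^ (-(1 / 2) : ℝ) * zOut T N u z) ^ 2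
              + normL2 (XU T j) (fun z => ‖z.2‖ ^ (-(1 / 2) : ℝ) * (Real.log (jb ‖z.2‖))⁻¹
                * jb (z.1 - ‖z.2‖) ^ (-(1 / 2) : ℝ) * zAbs T N u z) ^ 2))
      ≤ (weightConst N M : ℝ≥0∞) * R := by
  have hw := contDiffOn_zComp hW
  have h0T : (0 : ℝ) ∈ Icc 0 T := ⟨le_rfl, hT.le⟩
  have hTT : T ∈ Icc 0 T := ⟨hT.le, le_rfl⟩
  have hgr : ∀ t ∈ Icc 0 T, ∫⁻ x, ENNReal.ofReal (zGrad T N u (t, x) ^ 2) ≤ R := fun t ht =>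
    (le_normLinfL2_sq _ ht).trans hE
  have hfin : ∀ μ ∈ multiIdx N, ∀ I,
      ∫⁻ z in slab T, ENNReal.ofReal (zComp T u μ I z ^ 2 / ‖z.2‖ ^ 2) ≠ ∞ ∧
      ∫⁻ z in slab T, ENNReal.ofReal (eDen T (zComp T u μ I) z) ≠ ∞ := fun μ hμ I =>
    lintegral_slab_ne_top hT (hw μ hμ I) (fun t ht => tendsto_decay (hd t ht) hμ I) hR fun t ht =>
      (lintegral_mono fun x => ENNReal.ofReal_le_ofReal
        (sum_pd_sq_le_single hT hW ⟨ht, mem_univ _⟩ hμ I)).trans (hgr t ht)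
  have hfinE : ∫⁻ z in slab T, ENNReal.ofReal (eSum T (multiIdx N) (zComp T u) z) ≠ ∞ := by
    have hm : ∀ μ ∈ multiIdx N, ∀ I,
        AEMeasurable (eDen T (zComp T u μ I)) (volume.restrict (slab T)) := fun μ hμ I =>
      (contOff_eDen hT (hw μ hμ I)).aemeasurable
    refine ne_top_of_le_ne_top ?_ (lintegral_sum_le _ fun μ hμ =>
      Finset.aemeasurable_fun_sum _ fun I _ => hm μ hμ I)
    refine ENNReal.sum_ne_top.2 fun μ hμ => ne_top_of_le_ne_top ?_
      (lintegral_sum_le _ fun I _ => hm μ hμ I)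
    exact ENNReal.sum_ne_top.2 fun I _ => (hfin μ hμ I).2
  set k := (multiIdx N).card with hk
  set q : ℝ≥0∞ := ((4 + 156 * k : ℕ) : ℝ≥0∞) * R with hq
  have main : ∀ (j : ℕ) (τ : ℝ), τ ∈ Icc 0 T →
      ∫⁻ x, ENNReal.ofReal (1 / 6 * (‖x‖ * eSum T (multiIdx N) (zComp T u) (τ, x))) ≤ q ∧
      ∫⁻ z in slab τ, ENNReal.ofReal (1 / 6 * (eSum T (multiIdx N) (zComp T u) z
        + sigD (2 ^ j) (z.1 - ‖z.2‖) * ‖z.2‖ * vSum T (multiIdx N) (zComp T u) z)) ≤ q :=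
    fun j τ hτ => by
      have hs := sources_le hT hτ hh hW hD hS (hP j τ hτ) h1 h2 h3 h4
      have hm := main_estimate hT hτ (one_le_pow₀ one_le_two : (1 : ℝ) ≤ 2 ^ j) hh hw
        (fun z hz _ μ hμ I α => abs_pd_zComp_le hT hW hz hμ I α) zGrad_nonneg
        (fun z hz hx μ hμ I => abs_outR_zComp_le hT hW hz hx hμ I) zOut_nonneg
        (fun z _ _ μ hμ I => abs_zComp_le hμ I) zAbs_nonneg hfinE _ rfl
      exact ⟨hm.1.trans hs, hm.2.trans hs⟩
  have hle : ∀ μ ∈ multiIdx N, ∀ I z, eDen T (zComp T u μ I) z ≤ eSum T (multiIdx N) (zComp T u) z :=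
    fun μ hμ I z => (Finset.single_le_sum (f := fun I => eDen T (zComp T u μ I) z)
      (fun _ _ => eDen_nonneg) (Finset.mem_univ I)).trans
      (Finset.single_le_sum (f := fun μ => ∑ I, eDen T (zComp T u μ I) z)
        (fun _ _ => Finset.sum_nonneg fun _ _ => eDen_nonneg) hμ)
  have hleV : ∀ μ ∈ multiIdx N, ∀ I z,
      (outR T (zComp T u μ I) z / ‖z.2‖) ^ 2 ≤ vSum T (multiIdx N) (zComp T u) z :=
    fun μ hμ I z => (Finset.single_le_sum (f := fun I => (outR T (zComp T u μ I) z / ‖z.2‖) ^ 2)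
      (fun _ _ => sq_nonneg _) (Finset.mem_univ I)).trans
      (Finset.single_le_sum (f := fun μ => ∑ I, (outR T (zComp T u μ I) z / ‖z.2‖) ^ 2)
        (fun _ _ => Finset.sum_nonneg fun _ _ => sq_nonneg _) hμ)
  have hleE : ∀ μ ∈ multiIdx N, ∀ I z,
      (outR T (zComp T u μ I) z / ‖z.2‖) ^ 2 ≤ eSum T (multiIdx N) (zComp T u) z :=
    fun μ hμ I z => (le_add_of_nonneg_right angSq_nonneg).trans (hle μ hμ I z)
  have hb : ∀ (j : ℕ) (z : SpaceTime), 0 ≤ sigD (2 ^ j) (z.1 - ‖z.2‖) * ‖z.2‖ := fun j z =>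
    mul_nonneg (sigD_nonneg (by positivity) _) (norm_nonneg _)
  have hVs : ∀ z, 0 ≤ vSum T (multiIdx N) (zComp T u) z := vSum_nonneg
  have bE : ∫⁻ z in slab T, ENNReal.ofReal (eSum T (multiIdx N) (zComp T u) z)
      ≤ ((6 : ℕ) : ℝ≥0∞) * q := by
    refine lintegral_le_mul_of_le 6 (Eventually.of_forall fun z => ?_) (main 0 T hTT).2
    refine (le_add_of_nonneg_right (mul_nonneg (hb 0 z) (hVs z))).trans (le_of_eq ?_)
    push_cast
    ring
  have bV : ∀ μ ∈ multiIdx N, ∀ I, ∫⁻ z in slab T, ENNReal.ofReal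
      ((outR T (zComp T u μ I) z / ‖z.2‖) ^ 2) ≤ ((6 : ℕ) : ℝ≥0∞) * q := fun μ hμ I =>
    (lintegral_mono fun z => ENNReal.ofReal_le_ofReal (hleE μ hμ I z)).trans bE
  have b0 : ∀ μ ∈ multiIdx N, ∀ I, ∫⁻ x, ENNReal.ofReal (zComp T u μ I (0, x) ^ 2 / ‖x‖) ≤ R :=
    fun μ hμ I => (lintegral_mono fun x => ENNReal.ofReal_le_ofReal (by
      have k1 := abs_zComp_le (T := T) (u := u) (z := (0, x)) hμ I
      have k2 := zGood_nonneg (T := T) (N := N) (u := u) (0, x)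
      rw [div_eq_inv_mul, ← sq_abs]
      gcongr
      exact k1.trans (le_add_of_nonneg_right (by positivity)))).trans hD
  set q₁ : ℝ≥0∞ := R + ((6 : ℕ) : ℝ≥0∞) * q with hq₁
  have bL : ∀ μ ∈ multiIdx N, ∀ I, ∀ τ ∈ Icc 0 T,
      ∫⁻ x, ENNReal.ofReal (zComp T u μ I (τ, x) ^ 2 / ‖x‖) ≤ q₁ ∧
      ∫⁻ z in slab τ, ENNReal.ofReal
        (((outR T (zComp T u μ I) z - zComp T u μ I z) / ‖z.2‖) ^ 2) ≤ q₁ := fun μ hμ I τ hτ => by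
    have hm := lintegral_out_le hT hτ (hw μ hμ I) (hfin μ hμ I).1 _ rfl
    have hs := add_le_add (b0 μ hμ I)
      ((lintegral_mono_set (slab_subset hτ.2)).trans (bV μ hμ I))
    exact ⟨hm.1.trans hs, hm.2.trans hs⟩
  set q₂ : ℝ≥0∞ := ((2 : ℕ) : ℝ≥0∞) * (((6 : ℕ) : ℝ≥0∞) * q) + ((2 : ℕ) : ℝ≥0∞) * q₁ with hq₂
  have bF : ∀ μ ∈ multiIdx N, ∀ I,
      ∫⁻ z in slab T, ENNReal.ofReal (zComp T u μ I z ^ 2 / ‖z.2‖ ^ 2) ≤ q₂ := fun μ hμ I => by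
    have hc : ContOff T fun z => (outR T (zComp T u μ I) z / ‖z.2‖) ^ 2 := by
      simpa only [div_eq_mul_inv] using
        ((C1Off.outR hT (hw μ hμ I)).contOff.mul .inv_norm).pow 2
    -- Uses w/r = V - (∂_t + ∂_r)w, hence w²/r² ≤ 2V² + 2 ((∂_t + ∂_r)w)².
    refine lintegral_le_add_of_le
      (a := fun z => (2 : ℕ) * (outR T (zComp T u μ I) z / ‖z.2‖) ^ 2)
      (b := fun z => (2 : ℕ) * ((outR T (zComp T u μ I) z - zComp T u μ I z) / ‖z.2‖) ^ 2)
      (hc.aemeasurable.const_mul _) (Eventually.of_forall fun z => ?_)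
      (lintegral_le_mul_of_le 2 (Eventually.of_forall fun z => le_rfl) (bV μ hμ I))
      (lintegral_le_mul_of_le 2 (Eventually.of_forall fun z => le_rfl) (bL μ hμ I T hTT).2)
    rw [← div_pow, sub_div]
    push_cast
    nlinarith [sq_nonneg (2 * (outR T (zComp T u μ I) z / ‖z.2‖) - zComp T u μ I z / ‖z.2‖)]
  set q₃ : ℝ≥0∞ := R + ((36 : ℕ) : ℝ≥0∞) * q with hq₃
  have bG : ∀ j : ℕ, ∀ μ ∈ multiIdx N, ∀ I, ∫⁻ z in slab T, ENNReal.ofReal (1 / 2 *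
      (lorentz (2 ^ j) (z.1 - ‖z.2‖) * (zComp T u μ I z ^ 2
        / (jb ‖z.2‖ * Real.log (jb ‖z.2‖) ^ 2)))) ≤ q₃ := fun j μ hμ I => by
    refine (lintegral_log_le hT hTT (one_le_pow₀ one_le_two : (1 : ℝ) ≤ 2 ^ j) (hw μ hμ I)
      (hfin μ hμ I).1).trans (add_le_add (b0 μ hμ I) ?_)
    -- 6V² + 4σ_U' r V² is at most 6 times the bulk term, and the bulk estimate carries the factor
    -- 1/6.
    refine lintegral_le_mul_of_le 36 (Eventually.of_forall fun z => ?_) (main j T hTT).2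
    have k1 := hleE μ hμ I z
    have k2 := mul_le_mul_of_nonneg_left (hleV μ hμ I z) (hb j z)
    have k3 := mul_nonneg (hb j z) (hVs z)
    push_cast
    linarith
  have c1 : normLinfL2 T (fun z => jb ‖z.2‖ ^ (1 / 2 : ℝ) * zGood T N u z) ^ 2
      ≤ ((6 * k : ℕ) : ℝ≥0∞) * R + (((12 * k : ℕ) : ℝ≥0∞) * q
        + ((2 * k : ℕ) : ℝ≥0∞) * ((k * M : ℕ) * q₁)) :=
    normLinfL2_sq_le fun t ht => lintegral_jb_good_le hT hW ht (hgr t ht) (main 0 t ht).1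
      fun μ hμ I => (bL μ hμ I t ht).1
  have c2 : normLinfL2 T (fun z => ‖z.2‖ ^ (-(1 / 2) : ℝ) * zAbs T N u z) ^ 2
      ≤ (k : ℝ≥0∞) * ((k * M : ℕ) * q₁) := by
    refine normLinfL2_sq_le fun t ht => ?_
    simp only [mul_pow, rpow_neg_half_sq (norm_nonneg _)]
    refine lintegral_zAbs_sq_le (ι := fun x => (t, x)) (fun x => inv_nonneg.2 (norm_nonneg x))
      (fun μ hμ I => ?_) fun μ hμ I => ?_
    · simp only [← div_eq_inv_mul]
      exact aemeasurable_of_continuousOn_ne ((contOff_sq_div hW μ hμ I).continuousOn_slice ht)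
    · simp only [← div_eq_inv_mul]
      exact (bL μ hμ I t ht).1
  have c3 : normL2 (slab T) (zGood T N u) ^ 2
      ≤ (k : ℝ≥0∞) * (((6 : ℕ) : ℝ≥0∞) * q + (k * M : ℕ) * q₁) := by
    rw [normL2_sq]
    exact lintegral_good_le hT hW bE fun μ hμ I => (bL μ hμ I T hTT).2
  have c4 : normL2 (slab T) (fun z => ‖z.2‖⁻¹ * zAbs T N u z) ^ 2
      ≤ (k : ℝ≥0∞) * ((k * M : ℕ) * q₂) := by
    rw [normL2_sq]
    simp only [mul_pow, inv_pow]
    refine lintegral_zAbs_sq_le (ι := fun z => z) (fun z => inv_nonneg.2 (sq_nonneg _))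
      (fun μ hμ I => ?_) fun μ hμ I => ?_
    · exact AEMeasurable.mul (by fun_prop) ((contOff_zComp hW μ hμ I).aemeasurable.pow_const 2)
    · simp only [← div_eq_inv_mul]
      exact bF μ hμ I
  have c5 : (⨆ j : ℕ,
            (normL2 (XU T j) (fun z => ‖z.2‖ ^ (-(1 / 2) : ℝ)
                * jb (z.1 - ‖z.2‖) ^ (-(1 / 2) : ℝ) * zOut T N u z) ^ 2
              + normL2 (XU T j) (fun z => ‖z.2‖ ^ (-(1 / 2) : ℝ) * (Real.log (jb ‖z.2‖))⁻¹
                * jb (z.1 - ‖z.2‖) ^ (-(1 / 2) : ℝ) * zAbs T N u z) ^ 2))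
      ≤ ((54 * k : ℕ) : ℝ≥0∞) * q + (k : ℝ≥0∞) * ((k * M : ℕ) * (q₂ + 10 * q₃)) := by
    refine iSup_le fun j => add_le_add ?_ ?_
    · rw [normL2_sq]
      exact lintegral_zOut_le hT hW j (main j T hTT).2
    · rw [normL2_sq]
      exact lintegral_log_weight_le hW j (bG j) bF
  refine (add_le_add (add_le_add (add_le_add (add_le_add c1 c2) c3) c4) c5).trans ?_
  refine (le_add_of_nonneg_right (zero_le (a := R))).trans (le_of_eq ?_)
  simp only [weightConst, hq₃, hq₂, hq₁, hq, ← hk]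
  push_cast
  ring

end Assembly

end GhostWave

end

/-! ### The theorem -/

theorem corollary2p5 (N M : ℕ) :
    ∃ C : ℝ≥0, ∀ (T : ℝ) (u : SpaceTime → Vec M) (h : Pert M),
      0 < T →
      Admissible T h →
      ContDiffOn ℝ ((N + 2 : ℕ) : WithTop ℕ∞) u (slab T) →
      (∀ t ∈ Icc (0 : ℝ) T,
        Tendsto (fun x : E3 => ‖x‖ ^ (3 / 2 : ℝ) * (zAbs T N u (t, x) + zGrad T N u (t, x)))
          (cocompact E3) (𝓝 0)) →
      normLinfL2 T (fun z => jb ‖z.2‖ ^ (1 / 2 : ℝ) * zGood T N u z) ^ 2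
        + normLinfL2 T (fun z => ‖z.2‖ ^ (-(1 / 2) : ℝ) * zAbs T N u z) ^ 2
        + normL2 (slab T) (zGood T N u) ^ 2
        + normL2 (slab T) (fun z => ‖z.2‖⁻¹ * zAbs T N u z) ^ 2
        + (⨆ j : ℕ,
            (normL2 (XU T j) (fun z => ‖z.2‖ ^ (-(1 / 2) : ℝ)
                * jb (z.1 - ‖z.2‖) ^ (-(1 / 2) : ℝ) * zOut T N u z) ^ 2
              + normL2 (XU T j) (fun z => ‖z.2‖ ^ (-(1 / 2) : ℝ) * (Real.log (jb ‖z.2‖))⁻¹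
                * jb (z.1 - ‖z.2‖) ^ (-(1 / 2) : ℝ) * zAbs T N u z) ^ 2))
      ≤ (C : ℝ≥0∞) *
        (eLpNorm (fun x : E3 => ‖x‖ ^ (-(1 / 2) : ℝ)
              * (zAbs T N u (0, x) + ‖x‖ * zGood T N u (0, x))) 2 volume ^ 2
          + (⨆ t ∈ Icc (0 : ℝ) T, ∫⁻ x : E3, ENNReal.ofReal
              (‖x‖ * hAbs h (t, x) * zGrad T N u (t, x)
                * (zGrad T N u (t, x) + zAbs T N u (t, x) / ‖x‖)))
          + (⨆ j : ℕ, ⨆ t ∈ Icc (0 : ℝ) T,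
              absIntegral t (pairDensity T N h u ((2 : ℝ) ^ j)))
          + (∫⁻ z in slab T, ENNReal.ofReal
              ((hGrad T h z + hAbs h z / ‖z.2‖) * zGrad T N u z * zOut T N u z))
          + (∫⁻ z in slab T, ENNReal.ofReal
              (hAbs h z * zGrad T N u z * (zAng T N u z + zAbs T N u z / ‖z.2‖)))
          + (∫⁻ z in slab T, ENNReal.ofReal
              (hAbs h z * (jb (z.1 - ‖z.2‖))⁻¹ * zGrad T N u z * zOut T N u z))
          + (∫⁻ z in slab T, ENNReal.ofReal
              (‖z.2‖ * (hOut T h z + hAbs h z / ‖z.2‖) * zGrad T N u z ^ 2))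
          + normLinfL2 T (zGrad T N u) ^ 2
          + zLE1 T N u ^ 2) := by
  refine ⟨(weightConst N M : ℝ≥0), fun T u h hT hh hu hd => ?_⟩
  rw [ENNReal.coe_natCast]
  set D := eLpNorm (fun x : E3 => ‖x‖ ^ (-(1 / 2) : ℝ)
    * (zAbs T N u (0, x) + ‖x‖ * zGood T N u (0, x))) 2 volume ^ 2 with hD
  set S := ⨆ t ∈ Icc (0 : ℝ) T, ∫⁻ x : E3, ENNReal.ofReal (‖x‖ * hAbs h (t, x) * zGrad T N u (t, x)
    * (zGrad T N u (t, x) + zAbs T N u (t, x) / ‖x‖)) with hS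
  set P := ⨆ j : ℕ, ⨆ t ∈ Icc (0 : ℝ) T, absIntegral t (pairDensity T N h u ((2 : ℝ) ^ j)) with hP
  set I₁ := ∫⁻ z in slab T, ENNReal.ofReal
    ((hGrad T h z + hAbs h z / ‖z.2‖) * zGrad T N u z * zOut T N u z)
  set I₂ := ∫⁻ z in slab T, ENNReal.ofReal
    (hAbs h z * zGrad T N u z * (zAng T N u z + zAbs T N u z / ‖z.2‖))
  set I₃ := ∫⁻ z in slab T, ENNReal.ofReal
    (hAbs h z * (jb (z.1 - ‖z.2‖))⁻¹ * zGrad T N u z * zOut T N u z)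
  set I₄ := ∫⁻ z in slab T, ENNReal.ofReal
    (‖z.2‖ * (hOut T h z + hAbs h z / ‖z.2‖) * zGrad T N u z ^ 2)
  set E := normLinfL2 T (zGrad T N u) ^ 2
  set L := zLE1 T N u ^ 2
  -- If the right-hand side is infinite the claim is trivial, the constant being positive; otherwise
  -- the gradient is finite in L^∞L², as the cutoff argument demands.
  by_cases hR : D + S + P + I₁ + I₂ + I₃ + I₄ + E + L = ∞
  · rw [hR, ENNReal.mul_top (by simp [weightConst])]
    exact le_top
  have e : ∫⁻ x, ENNReal.ofReal (‖x‖⁻¹ * (zAbs T N u (0, x) + ‖x‖ * zGood T N u (0, x)) ^ 2) = D := by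
    rw [hD, eLpNorm_two_sq]
    simp only [mul_pow, rpow_neg_half_sq (norm_nonneg _)]
  -- Each of the first eight summands is at most their total R; the ninth, the local energy norm,
  -- only enlarges R.
  have hle : ∀ a b c d e f g k l : ℝ≥0∞,
      a ≤ a + b + c + d + e + f + g + k + l ∧ b ≤ a + b + c + d + e + f + g + k + l ∧
      c ≤ a + b + c + d + e + f + g + k + l ∧ d ≤ a + b + c + d + e + f + g + k + l ∧
      e ≤ a + b + c + d + e + f + g + k + l ∧ f ≤ a + b + c + d + e + f + g + k + l ∧
      g ≤ a + b + c + d + e + f + g + k + l ∧ k ≤ a + b + c + d + e + f + g + k + l := by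
    intro a b c d e f g k l
    refine ⟨?_, ?_, ?_, ?_, ?_, ?_, ?_, ?_⟩ <;>
      repeat first | exact le_rfl | exact le_add_self | refine le_add_right ?_
  obtain ⟨l₁, l₂, l₃, l₄, l₅, l₆, l₇, l₈⟩ := hle D S P I₁ I₂ I₃ I₄ E L
  exact weighted_estimate hT hh hR (fun μ hμ => contDiffOn_Zpow hT hμ hu) hd (e.le.trans l₁)
    (fun t ht => (le_iSup₂_of_le t ht le_rfl : _ ≤ S).trans l₂)
    (fun j t ht => (le_iSup_of_le j (le_iSup₂_of_le t ht le_rfl) : _ ≤ P).trans l₃) l₄ l₅ l₆ l₇ l₈
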